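/- Let $T$ be a complete first-order theory in a language $L$, and write $|T|=|L|+\aleph_0$. Work in a monster model $\mathbb M$ of $T$; "models" below are elementary submodels of $\mathbb M$, and tuples are finite unless said otherwise. **Shredding.** Let $A$ be a set of parameters and $\lambda$ an infinite cardinal. A formula $\varphi(x;a)$ *$\lambda$-shreds over $A$* if there is a sequence of tuples $\bar b=\langle b_\alpha:\alpha<\lambda\rangle$, indiscernible over $A$, such that for no $\alpha<\lambda$ and no $c\in\mathbb M$ with $\models\varphi(c;a)$ is the end segment $\langle b_\beta:\alpha\le\beta<\lambda\rangle$ indiscernible over $Ac$. A type $p$ over $B\supseteq A$ *shreds over $A$ with a built-in witness* if it implies a formula that $\lambda$-shreds over $A$ for $\lambda=(|T|+|A|)^+$, witnessed by a sequence $\bar b$ that is contained in $B$. For $m<\omega$, let $\kappa^m_{\mathrm{shred}}(T)$ be the least regular cardinal $\kappa$ for which there do not exist an increasing continuous sequence of models $\langle M_i:i\le\kappa\rangle$ and a type $p\in S^m(M_\kappa)$ such that, for every $i<\kappa$, the restriction $p\restriction M_{i+1}$ shreds over $M_i$ with a built-in witness; if there is no such regular cardinal, put $\kappa^m_{\mathrm{shred}}(T)=\infty$.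 Let $\kappa_{\mathrm{shred}}(T)=\sup_{m<\omega}\kappa^m_{\mathrm{shred}}(T)$. The theory $T$ is *unshreddable* if $\kappa_{\mathrm{shred}}(T)<\infty$. **Independence property.** $T$ has the *independence property* if there is a formula $\varphi(x;y)$ such that for every $n$ there are tuples $a_0,\dots,a_{n-1}$ and $b_w$ ($w\subseteq\{0,\dots,n-1\}$) with $\models\varphi(a_i;b_w)$ if and only if $i\in w$. **Square.** For a set $C$ of ordinals let $\mathrm{Lim}(C)$ be the set of those nonzero $\beta\in C$ with $\sup(C\cap\beta)=\beta$. For an uncountable cardinal $\mu$, $\square_\mu$ says that there is a sequence $\langle C_\alpha:\alpha<\mu^+\text{ a limit ordinal}\rangle$ such that each $C_\alpha\subseteq\alpha$ is club in $\alpha$; if $\beta\in\mathrm{Lim}(C_\alpha)$, then $C_\beta=C_\alpha\cap\beta$; and if $\mathrm{cf}(\alpha)<\mu$, then $|C_\alpha|<\mu$. **Theorem.** Let $T$ be a complete first-order theory that has the independence property and is unshreddable. Let $\mu>|T|$ be a singular cardinal with $\mathrm{cf}(\mu)\ge\kappa_{\mathrm{shred}}(T)$ such that $\square_\mu$ holds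 and $2^\mu=\mu^+$. Then $T$ has an exactly $\mu$-saturated model, that is, a model that is $\mu$-saturated (it realizes every complete type in finitely many variables over every subset of fewer than $\mu$ elements) but not $\mu^+$-saturated. -/

import Mathlib

open FirstOrder FirstOrder.Language Cardinal Ordinal
open scoped FirstOrder

universe u

namespace Shredding

/-! ### Indiscernible sequences and types over sets -/

section Types

variable {L : FirstOrder.Language.{u, u}}

/-- The sequence `b` of `k`-tuples, indexed by the linear order `ι`, is indiscernible over the set
`A`: any two increasing `n`-tuples of indices satisfy the same formulas with parameters in `A`. -/
def Indiscernible {N : Type u} [L.Structure N] (A : Set N) {ι : Type*} [LinearOrder ι] {k : ℕ}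
    (b : ι → Fin k → N) : Prop :=
  ∀ (n : ℕ) (φ : L[[A]].Formula (Fin n × Fin k)) (s t : Fin n ↪o ι),
    φ.Realize (fun q => b (s q.1) q.2) ↔ φ.Realize (fun q => b (t q.1) q.2)

/-- `S^m(B)`: the complete `m`-types over the set `B`, computed in the structure `N`. -/
abbrev TypesOver (L : FirstOrder.Language.{u, u}) (N : Type u) [L.Structure N] (B : Set N)
    (m : ℕ) : Type u :=
  (L[[B]].completeTheory N).CompleteType (Fin m)

/-- The restriction `p ↾ B'` of a type `p ∈ S^m(B)` to `B' ⊆ B`, as a set of formulas in `m`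
variables with parameters in `B'`. -/
def restrictTo {N : Type u} [L.Structure N] {B : Set N} {m : ℕ} (p : TypesOver L N B m)
    (B' : Set N) : Set (L[[B']].Formula (Fin m)) :=
  {φ | ∃ h : B' ⊆ B,
    Formula.equivSentence ((L.lhomWithConstantsMap (Set.inclusion h)).onFormula φ) ∈ p}

/-- Satisfaction, in an elementary extension `f : N ↪ₑ[L] N'`, of a formula with parameters in
`B ⊆ N` by a tuple `c` of `N'`. -/
def RealizeIn {N N' : Type u} [L.Structure N] [L.Structure N'] (f : N ↪ₑ[L] N') {B : Set N} {m : ℕ}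
    (φ : L[[B]].Formula (Fin m)) (c : Fin m → N') : Prop :=
  letI : (constantsOn B).Structure N' := constantsOn.structure (fun b : B => f b)
  φ.Realize c

/-- `M` is `μ`-saturated: it realizes every complete type in finitely many variables over every
set of fewer than `μ` elements of `M`. -/
def Saturated (L : FirstOrder.Language.{u, u}) (M : Type u) [L.Structure M] [Nonempty M]
    (μ : Cardinal.{u}) : Prop :=
  ∀ A : Set M, #A < μ → ∀ (m : ℕ) (p : TypesOver L M A m),
    p ∈ (L[[A]].completeTheory M).realizedTypes M (Fin m)

/-- `M` is exactly `μ`-saturated: `μ`-saturated but not `μ⁺`-saturated. -/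
def ExactlySaturated (L : FirstOrder.Language.{u, u}) (M : Type u) [L.Structure M] [Nonempty M]
    (μ : Cardinal.{u}) : Prop :=
  Saturated L M μ ∧ ¬ Saturated L M (Order.succ μ)

/-! ### Shredding

The model `N` below stands for a part of the monster model; a statement about all tuples of the
monster model becomes a statement about all tuples of all elementary extensions of `N`. -/

/-- The sequence `b` witnesses that `φ(x; a)` `lam`-shreds over `A`: it is indiscernible over `A`
and has length `lam`, and no end segment of it is indiscernible over `A` together with some
realization `c` of `φ(x; a)`. In `φ`, the variables `Sum.inl` are for `a`, and `Sum.inr` are `x`. -/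
def WitnessesShredding {N : Type u} [L.Structure N] (lam : Cardinal.{u}) (A : Set N)
    {r m k : ℕ} (φ : L.Formula (Fin r ⊕ Fin m)) (a : Fin r → N)
    (b : lam.ord.ToType → Fin k → N) : Prop :=
  Indiscernible (L := L) A b ∧
    ∀ (N' : Type u) [L.Structure N'] (f : N ↪ₑ[L] N') (c : Fin m → N') (α : lam.ord.ToType),
      φ.Realize (Sum.elim (f ∘ a) c) →
        ¬ Indiscernible (L := L) (f '' A ∪ Set.range c) (fun (i : Set.Ici α) j => f (b i j))

/-- The set `q` of formulas over `B` implies the formula `φ(x; a)`. -/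
def Implies {N : Type u} [L.Structure N] {B : Set N} {r m : ℕ} (q : Set (L[[B]].Formula (Fin m)))
    (φ : L.Formula (Fin r ⊕ Fin m)) (a : Fin r → N) : Prop :=
  ∀ (N' : Type u) [L.Structure N'] (f : N ↪ₑ[L] N') (c : Fin m → N'),
    (∀ θ ∈ q, RealizeIn f θ c) → φ.Realize (Sum.elim (f ∘ a) c)

/-- The type `q` over `B` `lam`-shreds over `A` with a built-in witness. -/
def ShredsBuiltIn {N : Type u} [L.Structure N] (lam : Cardinal.{u}) (A : Set N) {B : Set N} {m : ℕ}
    (q : Set (L[[B]].Formula (Fin m))) : Prop :=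
  A ⊆ B ∧ ∃ (r : ℕ) (φ : L.Formula (Fin r ⊕ Fin m)) (a : Fin r → N) (k : ℕ)
    (b : lam.ord.ToType → Fin k → N),
      Implies q φ a ∧ (∀ i j, b i j ∈ B) ∧ WitnessesShredding lam A φ a b

end Types

section Theories

variable {L : FirstOrder.Language.{u, u}}

/-- `|T|`, the number of formulas of the language of `T`, that is, `|L| + ℵ₀`. -/
noncomputable def theoryCard (_T : L.Theory) : Cardinal.{u} :=
  max ℵ₀ L.card

/-- There are an increasing continuous sequence `⟨M i : i ≤ κ⟩` of models of `T` (elementary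
submodels of some model `N`) and a type `p ∈ S^m(M κ)` such that, for all `i < κ`, the restriction
`p ↾ M (i + 1)` shreds over `M i` with a built-in witness; here "shreds" over `A` means
`lam`-shreds for `lam = (|T| + |A|)⁺`. -/
def HasShreddingChain (T : L.Theory) (m : ℕ) (κ : Cardinal.{u}) : Prop :=
  ∃ (N : Theory.ModelType.{u, u, u} T)
    (M : Ordinal.{u} → L.ElementarySubstructure N)
    (p : TypesOver L N (M κ.ord : Set N) m),
      (∀ i j, i ≤ j → j ≤ κ.ord → M i ≤ M j) ∧
      (∀ δ ≤ κ.ord, Order.IsSuccLimit δ → (M δ : Set N) = ⋃ i < δ, (M i : Set N)) ∧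
      ∀ i < κ.ord, ShredsBuiltIn (Order.succ (theoryCard T + #(M i))) (M i : Set N)
        (restrictTo p (M (i + 1) : Set N))

/-- `κ^m_shred(T)`: the least regular `κ` such that there is no shredding chain of length `κ` for
`m`-types, and `⊤` (that is, `∞`) if there is no such `κ`. -/
noncomputable def kappaShredVar (T : L.Theory) (m : ℕ) : WithTop Cardinal.{u} :=
  sInf ((↑) '' {κ : Cardinal.{u} | κ.IsRegular ∧ ¬ HasShreddingChain T m κ})

/-- `κ_shred(T) = sup_m κ^m_shred(T)`. -/
noncomputable def kappaShred (T : L.Theory) : WithTop Cardinal.{u} :=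
  ⨆ m : ℕ, kappaShredVar T m

/-- `T` is unshreddable: `κ_shred(T) < ∞`. -/
def Unshreddable (T : L.Theory) : Prop :=
  kappaShred T < ⊤

/-- `T` has the independence property: for some formula `φ(x; y)` and every `n` there are tuples
`a i` for `i < n` and `b w` for `w ⊆ n` in a model of `T` with `φ(a i; b w)` iff `i ∈ w`. -/
def HasIP (T : L.Theory) : Prop :=
  ∃ (r s : ℕ) (φ : L.Formula (Fin r ⊕ Fin s)), ∀ n : ℕ,
    ∃ (M : Theory.ModelType.{u, u, u} T) (a : Fin n → Fin r → M)
      (b : Set (Fin n) → Fin s → M), ∀ i w, φ.Realize (Sum.elim (a i) (b w)) ↔ i ∈ w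

end Theories

/-! ### Square -/

/-- `Lim(C)`: the limit points of a set `C` of ordinals that belong to `C`. -/
def limPoints (C : Set Ordinal.{u}) : Set Ordinal.{u} :=
  {β ∈ C | β ≠ 0 ∧ IsLUB (C ∩ Set.Iio β) β}

/-- `□_μ`: there is a sequence `⟨C α : α < μ⁺ limit⟩` such that `C α` is a club of `α`,
`C β = C α ∩ β` for all `β ∈ Lim(C α)`, and `|C α| < μ` whenever `cf(α) < μ`. -/
def Square (μ : Cardinal.{u}) : Prop :=
  ∃ C : Ordinal.{u} → Set Ordinal.{u}, ∀ α < (Order.succ μ).ord, Order.IsSuccLimit α →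
    C α ⊆ Set.Iio α ∧ IsClub ((↑) ⁻¹' C α : Set (Set.Iio α)) ∧
    (∀ β ∈ limPoints (C α), C β = C α ∩ Set.Iio β) ∧
    (α.cof < μ → #(C α) < Cardinal.lift.{u + 1} μ)

end Shredding

namespace Shredding

/-! ### Transfinite dependent choice -/

/-! Everything happens inside a model `N` that realizes all types over at most `μ` parameters; `2 ^
μ = μ⁺` provides it (`exists_familySaturated`). Let `mu j`, for `j < cf μ`, increase to `μ`. The
independence property gives sequences `I j` of length `(mu j)⁺`, successive blocks of one
indiscernible sequence, on which `φ(x; d)` can define any prescribed pattern (`exists_base_chain`).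
Choose `d` so that `φ(x; d)` changes its truth value cofinally often along every `I j`. Suppose that
a model contains all `I j`, and that each finite tuple of it leaves an end segment of some `I j`
indiscernible over that tuple. Then the model omits the type of `d` over the union of the blocks, a
set of size at most `μ`, so it is not `μ⁺`-saturated.

The task is to become `μ`-saturated without losing this property. It is recorded by an
`AdaptedChain`: small models `M j`, with an end segment of `I j` indiscernible over `M j`. One step
realizes a type with fewer than `μ` formulas (`AdaptedChain.exists_extension`). Unshreddability
enters here: if realizations kept satisfying formulas that spoil every end segment of some later `I
j` over `M j`, a forbidden shredding chain would arise (`AdaptedChain.exists_not_bad`, with the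
witnesses cut to the right length by `Bad.exists_witnessesShredding`). Hence some realization
preserves end segments at all large `j` (`AdaptedChain.exists_realization`), and Ramsey's theorem
with compactness enlarges the sets so obtained to models (`exists_model_chain`).

The step is iterated `μ⁺` times. At level `j` one may unite at most `mu j` earlier models, because
that many end segments of `I j` contain a common one. Square decomposes every `β < μ⁺` into sets `S
β j` of size at most `mu j`, increasing in `j`, with `S α j = S β j ∩ α` for `α ∈ S β j`
(`exists_coherent_decomposition`). Coherence makes the unions at each level increasing
(`AdaptedChain.union`), every earlier stage is absorbed from some level on, and bookkeeping gives
saturation (`AdaptedChain.exists_saturated`). -/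

theorem exists_transfinite_choice {ι : Type*} [LinearOrder ι] [WellFoundedLT ι] {S : Type*}
    [Nonempty S] (Good : (a : ι) → (Set.Iio a → S) → S → Prop)
    (h : ∀ (a : ι) (f : ι → S), (∀ b < a, Good b (fun c => f c) (f b)) →
      ∃ s, Good a (fun c => f c) s) :
    ∃ F : ι → S, ∀ a, Good a (fun c => F c) (F a) := by
  classical
  -- The arbitrary value is never used: by induction, all earlier values are good, so a good value
  -- exists.
  let F : ι → S := WellFoundedLT.fix (motive := fun _ => S) fun a f =>
    if hs : ∃ s, Good a (fun c => f c.1 c.2) s then hs.choose else Classical.arbitrary S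
  refine ⟨F, fun a => ?_⟩
  induction a using WellFoundedLT.induction with
  | ind a ih =>
    have hs := h a F ih
    have hF : F a = hs.choose := by
      simp only [F]
      rw [WellFoundedLT.fix_eq]
      exact dif_pos hs
    rw [hF]
    exact hs.choose_spec

/-! ### Compactness for formulas with free variables -/

section Compactness

variable {L : FirstOrder.Language.{u, u}}

theorem exists_realize_of_finite (T : L.Theory) {V : Type u} (Q : Set (L.Formula V))
    (h : ∀ Q₀ : Finset (L.Formula V), ↑Q₀ ⊆ Q →
      ∃ (K : Theory.ModelType.{u, u, u} T) (v : V → K), ∀ ψ ∈ Q₀, ψ.Realize v) :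
    ∃ (K : Theory.ModelType.{u, u, u} T) (v : V → K), ∀ ψ ∈ Q, ψ.Realize v := by
  classical
  let TV : L[[V]].Theory := (L.lhomWithConstants V).onTheory T
  have hsat : (TV ∪ Formula.equivSentence '' Q).IsSatisfiable := by
    rw [Theory.isSatisfiable_iff_isFinitelySatisfiable]
    intro T₀ hT₀
    obtain ⟨K, v, hv⟩ := h ((T₀.image Formula.equivSentence.symm).filter (· ∈ Q)) (by
      intro ψ hψ
      exact (Finset.mem_filter.1 hψ).2)
    let _ : (constantsOn V).Structure K := constantsOn.structure v
    have : K ⊨ (T₀ : L[[V]].Theory) := by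
      refine ⟨fun σ hσ => ?_⟩
      rcases hT₀ hσ with h1 | ⟨ψ, hψ, rfl⟩
      · have : K ⊨ TV := (LHom.onTheory_model _ T).2 inferInstance
        exact this.realize_of_mem σ h1
      · rw [Formula.realize_equivSentence]
        exact hv ψ (Finset.mem_filter.2 ⟨Finset.mem_image.2 ⟨_, hσ, by simp⟩, hψ⟩)
    exact Theory.Model.isSatisfiable K
  obtain ⟨K⟩ := hsat
  have h1 : K ⊨ TV := K.is_model.mono Set.subset_union_left
  refine ⟨(K.subtheoryModel (T' := TV) Set.subset_union_left).reduct (L.lhomWithConstants V),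
    fun a => (L.con a : K), fun ψ hψ => ?_⟩
  have h2 := K.is_model.realize_of_mem _ (Set.mem_union_right _ (Set.mem_image_of_mem _ hψ))
  let _ : L.Structure K := (L.lhomWithConstants V).reduct K
  have : (L.lhomWithConstants V).IsExpansionOn K := LHom.isExpansionOn_reduct _ _
  exact (Formula.realize_equivSentence K ψ).1 h2

end Compactness

/-! ### Definable sets -/

section Definable

open Set

variable {L : FirstOrder.Language.{u, u}} {N : Type u} [L.Structure N] {A B : Set N}

/-- Parameters `c` become variables of an `A`-definable set. This is what lets compactness search
for a tuple `c`, possibly infinite, over which a sequence is indiscernible. -/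
theorem definable_union_range_iff {X Y : Type*} {c : X → N} {D : Set (Y → N)} :
    (A ∪ range c).Definable L D ↔
      ∃ D' : Set (X ⊕ Y → N), A.Definable L D' ∧ D = {y | Sum.elim c y ∈ D'} := by
  classical
  constructor
  · rw [definable_iff_exists_formula_sum]
    rintro ⟨φ, rfl⟩
    let g : (↑(A ∪ range c) ⊕ Y) → A ⊕ (X ⊕ Y) := Sum.elim
      (fun p => if h : (p : N) ∈ A then Sum.inl ⟨p, h⟩
        else Sum.inr (Sum.inl (p.2.resolve_left h).choose)) (fun y => Sum.inr (Sum.inr y))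
    refine ⟨_, definable_iff_exists_formula_sum.2 ⟨φ.relabel g, rfl⟩, ?_⟩
    ext y
    simp only [mem_ofPred_eq, Formula.realize_relabel]
    have : (Sum.elim (↑) (Sum.elim c y) : A ⊕ (X ⊕ Y) → N) ∘ g
        = (Sum.elim (↑) y : ↑(A ∪ range c) ⊕ Y → N) := by
      funext z
      rcases z with p | y
      · by_cases h : (p : N) ∈ A
        · simp [g, h]
        · simp [g, h, (p.2.resolve_left h).choose_spec]
      · rfl
    rw [this]
  · rintro ⟨D', hD', rfl⟩
    rw [definable_iff_exists_formula_sum] at hD' ⊢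
    obtain ⟨φ, rfl⟩ := hD'
    let g : A ⊕ (X ⊕ Y) → (↑(A ∪ range c) ⊕ Y) := Sum.elim (fun a => Sum.inl ⟨a, Or.inl a.2⟩)
      (Sum.elim (fun x => Sum.inl ⟨c x, Or.inr ⟨x, rfl⟩⟩) Sum.inr)
    refine ⟨φ.relabel g, ?_⟩
    ext y
    simp only [mem_ofPred_eq, Formula.realize_relabel]
    have : (Sum.elim (↑) y : ↑(A ∪ range c) ⊕ Y → N) ∘ g
        = (Sum.elim (↑) (Sum.elim c y) : A ⊕ (X ⊕ Y) → N) := by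
      funext z
      rcases z with p | x | y <;> rfl
    rw [this]

theorem definable_exists_finset {Z : Type*} {D : Set (Z → N)} (hD : A.Definable L D) :
    ∃ (F : Finset Z) (D₀ : Set (F → N)), A.Definable L D₀ ∧ D = {v | (fun z : F => v z) ∈ D₀} := by
  classical
  obtain ⟨φ, rfl⟩ := hD
  refine ⟨φ.freeVarFinset, _, ⟨φ.restrictFreeVar id, rfl⟩, ?_⟩
  ext v
  simp only [mem_ofPred_eq]
  exact (BoundedFormula.realize_restrictFreeVar (φ := φ) (f := id) v (fun _ => rfl)).symm

/-- `Z` may be infinite: a formula mentions finitely many variables, and the other coordinates of a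
witness are filled arbitrarily. -/
theorem definable_exists [Nonempty N] {Y Z : Type*} {D : Set (Y ⊕ Z → N)}
    (hD : A.Definable L D) : A.Definable L {y : Y → N | ∃ z : Z → N, Sum.elim y z ∈ D} := by
  classical
  obtain ⟨F, D₀, hD₀, rfl⟩ := definable_exists_finset hD
  let G : Finset Z := F.toRight
  have h : A.Definable L {w : Y ⊕ G → N |
      (fun z : F => (Sum.elim (fun y => w (Sum.inl y))
        (fun z => if h : z ∈ G then w (Sum.inr ⟨z, h⟩) else Classical.arbitrary N) z.1)) ∈ D₀} := by
    let g : F → Y ⊕ G := fun z => match z with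
      | ⟨Sum.inl y, _⟩ => Sum.inl y
      | ⟨Sum.inr z, h⟩ => Sum.inr ⟨z, Finset.mem_toRight.2 h⟩
    convert hD₀.preimage_comp g using 1
    ext w
    simp only [mem_ofPred_eq, mem_preimage]
    have : (fun z : F => (Sum.elim (fun y => w (Sum.inl y))
        (fun z => if h : z ∈ G then w (Sum.inr ⟨z, h⟩) else Classical.arbitrary N) z.1)) = w ∘ g := by
      funext z
      rcases z with ⟨y | z, hz⟩
      · rfl
      · have : z ∈ G := Finset.mem_toRight.2 hz
        simp [g, this]
    rw [this]
  convert h.exists_of_finite using 1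
  ext y
  simp only [mem_ofPred_eq]
  constructor
  · rintro ⟨z, hz⟩
    refine ⟨fun i => z i, ?_⟩
    convert hz using 1
    funext x
    rcases x with ⟨y | z, hz⟩
    · rfl
    · have : z ∈ G := Finset.mem_toRight.2 hz
      simp [this]
  · rintro ⟨z, hz⟩
    refine ⟨fun i => if h : i ∈ G then z ⟨i, h⟩ else Classical.arbitrary N, ?_⟩
    convert hz using 1
    funext x
    rcases x with ⟨y | z, hz⟩ <;> rfl

theorem definable_of_forall_finset_mem {Z J : Type*} [Nonempty J] [Preorder J] [IsDirectedOrder J]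
    {A : J → Set N} (hA : Monotone A) {D : Set (Z → N)} (hD : (⋃ j, A j).Definable L D) :
    ∃ j, (A j).Definable L D := by
  obtain ⟨A₀, h1, h2⟩ := definable_iff_finitely_definable.1 hD
  obtain ⟨j, hj⟩ := hA.directed_le.exists_mem_subset_of_finset_subset_biUnion (s := A₀) h1
  exact ⟨j, h2.mono hj⟩

theorem definable_preimage_elim_const {X Y : Type*} {D : Set (X ⊕ Y → N)} (hD : A.Definable L D)
    {c : X → N} (hc : ∀ x, c x ∈ A) : A.Definable L {y : Y → N | Sum.elim c y ∈ D} := by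
  have := (definable_union_range_iff (c := c)).2 ⟨D, hD, rfl⟩
  rwa [union_eq_self_of_subset_right (range_subset_iff.2 hc)] at this

theorem definable_iff {X : Type*} {D E : Set (X → N)} (hD : A.Definable L D)
    (hE : A.Definable L E) : A.Definable L {x | x ∈ D ↔ x ∈ E} := by
  convert (hD.inter hE).union (hD.compl.inter hE.compl) using 1
  ext x
  simp only [mem_ofPred_eq, mem_union, mem_inter_iff, mem_compl_iff]
  tauto

theorem mk_definable_le {X : Type u} :
    #{D : Set (X → N) // A.Definable L D} ≤ max ℵ₀ (L.card + #A + #X) := by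
  have h : #{D : Set (X → N) // A.Definable L D} ≤ #(L.Formula (A ⊕ X)) := by
    refine mk_le_of_surjective (f := fun φ : L.Formula (A ⊕ X) =>
      (⟨_, definable_iff_exists_formula_sum.2 ⟨φ, rfl⟩⟩ :
        {D : Set (X → N) // A.Definable L D})) ?_
    rintro ⟨D, hD⟩
    obtain ⟨φ, rfl⟩ := definable_iff_exists_formula_sum.1 hD
    exact ⟨φ, rfl⟩
  refine h.trans ?_
  have h2 : #(L.Formula (A ⊕ X)) ≤ #(Σ n, L.BoundedFormula (A ⊕ X) n) :=
    mk_le_of_injective (f := fun φ => ⟨0, φ⟩) (fun a b h => by simpa using h)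
  refine (h2.trans BoundedFormula.card_le).trans ?_
  simp only [Cardinal.lift_id, mk_sum]
  rw [add_comm L.card, add_right_comm]

end Definable

end Shredding

namespace Shredding

/-! ### Indiscernible sequences in terms of definable sets -/

section Indiscernibles

open Set

variable {L : FirstOrder.Language.{u, u}} {N : Type u} [L.Structure N] {A B : Set N}
  {ι ι' : Type*} [LinearOrder ι] [LinearOrder ι'] {k : ℕ} {b : ι → Fin k → N}

theorem indiscernible_iff :
    Indiscernible (L := L) A b ↔ ∀ (n : ℕ) (D : Set (Fin n × Fin k → N)), A.Definable L D →
      ∀ s t : Fin n ↪o ι, (fun q => b (s q.1) q.2) ∈ D ↔ (fun q => b (t q.1) q.2) ∈ D := by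
  constructor
  · rintro h n D ⟨φ, rfl⟩ s t
    exact h n φ s t
  · intro h n φ s t
    exact h n _ ⟨φ, rfl⟩ s t

theorem indiscernible_union_range_iff {X : Type*} {c : X → N} :
    Indiscernible (L := L) (A ∪ range c) b ↔
      ∀ (n : ℕ) (D : Set (X ⊕ Fin n × Fin k → N)), A.Definable L D → ∀ s t : Fin n ↪o ι,
        Sum.elim c (fun q => b (s q.1) q.2) ∈ D ↔ Sum.elim c (fun q => b (t q.1) q.2) ∈ D := by
  rw [indiscernible_iff]
  constructor
  · intro h n D hD s t
    exact h n _ (definable_union_range_iff.2 ⟨D, hD, rfl⟩) s t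
  · intro h n D hD s t
    obtain ⟨D', hD', rfl⟩ := definable_union_range_iff.1 hD
    exact h n D' hD' s t

theorem Indiscernible.mono (h : Indiscernible (L := L) B b) (hAB : A ⊆ B) :
    Indiscernible (L := L) A b :=
  indiscernible_iff.2 fun n D hD => indiscernible_iff.1 h n D (hD.mono hAB)

theorem Indiscernible.comp (h : Indiscernible (L := L) A b) (g : ι' ↪o ι) :
    Indiscernible (L := L) A (fun i => b (g i)) :=
  indiscernible_iff.2 fun n D hD s t => indiscernible_iff.1 h n D hD (s.trans g) (t.trans g)

theorem Indiscernible.tail_le {γ δ : ι} (hγδ : γ ≤ δ)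
    (h : Indiscernible (L := L) A (fun i : Ici γ => b i)) :
    Indiscernible (L := L) A (fun i : Ici δ => b i) :=
  h.comp (OrderEmbedding.ofStrictMono
    (fun i : Ici δ => (⟨i, hγδ.trans i.2⟩ : Ici γ)) fun _ _ h => h)

theorem Indiscernible.tail {γ : ι} (h : Indiscernible (L := L) A b) :
    Indiscernible (L := L) A (fun i : Ici γ => b i) :=
  h.comp (OrderEmbedding.ofStrictMono (fun i : Ici γ => (i : ι)) fun _ _ h => h)

/-- Used to hide finitely many parameters inside the tuples of the sequence;
`Indiscernible.of_substitute` recovers them. -/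
theorem Indiscernible.substitute {X : Type*} {k' : ℕ} {e : X → N} (g : Fin k' → Fin k ⊕ X)
    (h : Indiscernible (L := L) A b) (he : ∀ x, e x ∈ A) :
    Indiscernible (L := L) A (fun i j => Sum.elim (b i) e (g j)) := by
  refine indiscernible_iff.2 fun n D hD s t => ?_
  let g' : Fin n × Fin k' → X ⊕ Fin n × Fin k := fun q =>
    Sum.elim (fun j => Sum.inr (q.1, j)) Sum.inl (g q.2)
  have hD' := definable_preimage_elim_const (hD.preimage_comp g') he
  have key : ∀ s : Fin n ↪o ι, Sum.elim e (fun q => b (s q.1) q.2) ∘ g' =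
      fun q => Sum.elim (b (s q.1)) e (g q.2) := by
    intro s
    funext q
    simp only [Function.comp, g']
    rcases g q.2 with j | x <;> rfl
  have := indiscernible_iff.1 h n _ hD' s t
  simpa only [mem_ofPred_eq, mem_preimage, key] using this

theorem indiscernible_iUnion {J : Type*} [Nonempty J] [Preorder J] [IsDirectedOrder J]
    {A : J → Set N} (hA : Monotone A) (h : ∀ j, Indiscernible (L := L) (A j) b) :
    Indiscernible (L := L) (⋃ j, A j) b := by
  refine indiscernible_iff.2 fun n D hD => ?_
  obtain ⟨j, hj⟩ := definable_of_forall_finset_mem hA hD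
  exact indiscernible_iff.1 (h j) n D hj

end Indiscernibles

/-! ### Elementary submodels as sets, and equality of types -/

section MeetsDefinable

open Set

variable {L : FirstOrder.Language.{u, u}} {N : Type u} [L.Structure N] {A B : Set N}

theorem coe_toElementarySubstructure (hA : L.MeetsDefinable A) :
    (hA.toElementarySubstructure : Set N) = A :=
  hA.closure_eq_self

theorem meetsDefinable_iff : L.MeetsDefinable A ↔
    ∀ D : Set (Fin 1 → N), D.Nonempty → A.Definable L D → ∃ x ∈ D, x 0 ∈ A := by
  constructor
  · intro h D hD hdef
    obtain ⟨x, hx⟩ := hD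
    have hD' : {x : Fin 1 → N | x 0 ∈ {y : N | (fun _ => y) ∈ D}} = D := by
      ext x
      simp only [mem_ofPred_eq]
      rw [show (fun _ => x 0) = x from funext fun i => by rw [Subsingleton.elim 0 i] ]
    obtain ⟨y, hy, hyA⟩ := h {y : N | (fun _ => y) ∈ D} ⟨x 0, by
      simp only [mem_ofPred_eq]
      rwa [show (fun _ => x 0) = x from funext fun i => by rw [Subsingleton.elim 0 i] ]⟩ (by
      rw [Definable₁, hD']
      exact hdef)
    exact ⟨_, hy, hyA⟩
  · rintro h D ⟨y, hy⟩ hdef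
    obtain ⟨x, hx, hxA⟩ := h _ ⟨fun _ => y, hy⟩ hdef
    exact ⟨_, hx, hxA⟩

theorem meetsDefinable_iUnion {J : Type*} [Nonempty J] [Preorder J] [IsDirectedOrder J]
    {A : J → Set N} (hA : Monotone A) (h : ∀ j, L.MeetsDefinable (A j)) :
    L.MeetsDefinable (⋃ j, A j) := by
  refine meetsDefinable_iff.2 fun D hD hdef => ?_
  obtain ⟨j, hj⟩ := definable_of_forall_finset_mem hA hdef
  obtain ⟨x, hx, hxA⟩ := meetsDefinable_iff.1 (h j) D hD hj
  exact ⟨x, hx, mem_iUnion.2 ⟨j, hxA⟩⟩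

theorem exists_meetsDefinable_superset [Nonempty N] (A : Set N) (κ : Cardinal.{u}) (h0 : ℵ₀ ≤ κ)
    (hA : #A ≤ κ) (hL : L.card ≤ κ) : ∃ B : Set N, A ⊆ B ∧ L.MeetsDefinable B ∧ #B ≤ κ := by
  rcases le_total κ #N with h | h
  · obtain ⟨S, hS, hcard⟩ := exists_elementarySubstructure_card_eq L A κ h0 (by simpa using hA)
      (by simpa using hL) (by simpa using h)
    exact ⟨S, hS, S.meetsDefinable, by simpa using hcard.le⟩
  · exact ⟨univ, subset_univ _, fun D hD _ => by simpa using hD, by simpa using h⟩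

/-- The tuples `c` and `d` have the same type over `A`. -/
def TypeEq (L : FirstOrder.Language.{u, u}) [L.Structure N] (A : Set N) {X : Type*}
    (c d : X → N) : Prop :=
  ∀ D : Set (X → N), A.Definable L D → (c ∈ D ↔ d ∈ D)

theorem TypeEq.mono {X : Type*} {c d : X → N} (h : TypeEq L B c d) (hAB : A ⊆ B) :
    TypeEq L A c d :=
  fun D hD => h D (hD.mono hAB)

theorem TypeEq.refl {X : Type*} (c : X → N) : TypeEq L A c c :=
  fun _ _ => Iff.rfl

theorem TypeEq.trans {X : Type*} {c d e : X → N} (h : TypeEq L A c d) (h' : TypeEq L A d e) :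
    TypeEq L A c e :=
  fun D hD => (h D hD).trans (h' D hD)

theorem typeEq_of_forall_mem {X : Type*} {c d : X → N}
    (h : ∀ D : Set (X → N), A.Definable L D → c ∈ D → d ∈ D) : TypeEq L A c d :=
  fun D hD => ⟨h D hD, fun hd => by_contra fun hc => h Dᶜ hD.compl hc hd⟩

theorem TypeEq.eq_of_mem {X : Type*} {c d : X → N} (h : TypeEq L A c d) {x : X}
    (hx : c x ∈ A) : d x = c x := by
  have hdef : A.Definable L {v : X → N | v x = c x} := by
    have : A.Definable L {v : Fin 1 → N | v 0 = c x} := Definable.singleton_of_mem L hx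
    exact this.preimage_comp (fun _ : Fin 1 => x)
  exact (h _ hdef).1 rfl

/-- The Tarski–Vaught test depends only on the type of an enumeration: an existential statement
about `v` transfers to `K`, is witnessed there by one of the enumerated elements, and the same
coordinate of `v` is then a witness. -/
theorem TypeEq.meetsDefinable_range {K : Set N} (hK : L.MeetsDefinable K) {v : K → N}
    (hv : TypeEq L ∅ (fun x : K => (x : N)) v) : L.MeetsDefinable (range v) := by
  refine meetsDefinable_iff.2 fun D hD hdef => ?_
  rw [← empty_union (range v)] at hdef
  obtain ⟨D', hD', rfl⟩ := definable_union_range_iff.1 hdef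
  have hne : Nonempty N := ⟨hD.some 0⟩
  have h1 : (fun x : K => (x : N)) ∈ {w : K → N | ∃ z : Fin 1 → N, Sum.elim w z ∈ D'} :=
    (hv _ (definable_exists hD')).2 hD
  have h2 := definable_preimage_elim_const (A := K) (hD'.mono (empty_subset _))
    (c := fun x : K => (x : N)) (fun x => x.2)
  obtain ⟨z, hz, hzK⟩ := meetsDefinable_iff.1 hK _ h1 h2
  have h3 : (∅ : Set N).Definable L {w : K → N | Sum.elim w (fun _ => w ⟨z 0, hzK⟩) ∈ D'} := by
    convert hD'.preimage_comp (Sum.elim id (fun _ => ⟨z 0, hzK⟩) : K ⊕ Fin 1 → K) using 1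
    ext w
    simp only [mem_ofPred_eq, mem_preimage]
    have : w ∘ (Sum.elim id (fun _ => ⟨z 0, hzK⟩) : K ⊕ Fin 1 → K) =
        Sum.elim w (fun _ => w ⟨z 0, hzK⟩) := by
      funext i
      rcases i with i | i <;> rfl
    rw [this]
  refine ⟨fun _ => v ⟨z 0, hzK⟩, (hv _ h3).1 ?_, mem_range_self _⟩
  simp only [mem_ofPred_eq] at hz ⊢
  rwa [show (fun _ => z 0) = z from funext fun i => by rw [Subsingleton.elim 0 i] ]

end MeetsDefinable

end Shredding

namespace Shredding

/-! ### Cardinal arithmetic -/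

section Card

open Set

theorem bddAbove_of_mk_lt {κ : Cardinal.{u}} (hκ : κ.IsRegular) {s : Set κ.ord.ToType}
    (hs : #s < κ) : ∃ b, ∀ x ∈ s, x < b := by
  by_contra! h
  have h1 : IsCofinal s := fun b => h b
  have h2 := Order.cof_le h1
  rw [Ordinal.cof_toType, hκ.cof_ord] at h2
  exact absurd hs (not_lt.2 h2)

theorem mk_Iio_ord_toType_lt {κ : Cardinal.{u}} (i : κ.ord.ToType) : #(Iio i) < κ :=
  (mk_Iio_lt i (by simp)).trans_eq (by simp)

/-- The fibre over `w` of a left inverse of an injection `W × U → U` has size `μ⁺`, whereas proper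
initial segments of `U` have size at most `μ`. -/
theorem exists_bookkeeping {μ : Cardinal.{u}} (hμ : ℵ₀ ≤ μ) {W : Type u} [Nonempty W]
    (hW : #W ≤ Order.succ μ) :
    ∃ t : (Order.succ μ).ord.ToType → W, ∀ w u₀, ∃ u, u₀ < u ∧ t u = w := by
  set U := (Order.succ μ).ord.ToType
  have hU : #U = Order.succ μ := by simp [U]
  have hle : #(W × U) ≤ #U := by
    rw [mk_prod, Cardinal.lift_id, Cardinal.lift_id, hU]
    exact (mul_le_mul' hW le_rfl).trans (mul_eq_self (hμ.trans (Order.le_succ μ))).le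
  obtain ⟨⟨i, hi⟩⟩ := hle
  have : Nonempty U := mk_ne_zero_iff.1 (by rw [hU]; exact (Order.bot_lt_succ μ).ne')
  let g : U → W × U := Function.invFun i
  refine ⟨fun u => (g u).1, fun w u₀ => ?_⟩
  by_contra! h
  have h1 : #U ≤ #(Iic u₀) := by
    refine mk_le_of_injective (f := fun v => (⟨i (w, v), ?_⟩ : Iic u₀)) ?_
    · by_contra h2
      refine h (i (w, v)) (not_le.1 h2) ?_
      simp [g, Function.leftInverse_invFun hi (w, v)]
    · intro a b hab
      have := hi (Subtype.ext_iff.1 hab)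
      exact (Prod.ext_iff.1 this).2
  rw [← Iio_insert] at h1
  have h2 := (h1.trans (mk_insert_le)).trans_lt (add_lt_of_lt (c := Order.succ μ)
    (hμ.trans (Order.le_succ μ)) (mk_Iio_ord_toType_lt u₀)
    (one_lt_aleph0.trans_le (hμ.trans (Order.le_succ μ))))
  exact absurd hU h2.ne

end Card

/-! ### Saturated models -/

section Monster

open Set

/-- `N` realizes all finitely satisfiable families of at most `μ` definable conditions with at most
`μ` parameters, in at most `μ` variables. -/
def FamilySaturated (L : FirstOrder.Language.{u, u}) (N : Type u) [L.Structure N]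
    (μ : Cardinal.{u}) : Prop :=
  ∀ (X : Type u) (A : Set N) (F : Set (Set (X → N))), #A ≤ μ → #X ≤ μ →
    (∀ D ∈ F, A.Definable L D) →
    (∀ F₀ : Set (Set (X → N)), F₀.Finite → F₀ ⊆ F → (⋂₀ F₀).Nonempty) → (⋂₀ F).Nonempty

variable {L : FirstOrder.Language.{u, u}}

theorem realize_congr_of_freeVar {V : Type*} [DecidableEq V] {K : Type*} [L.Structure K]
    (φ : L.Formula V) {v w : V → K} (h : ∀ a ∈ φ.freeVarFinset, v a = w a) :
    φ.Realize v ↔ φ.Realize w := by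
  have h1 := BoundedFormula.realize_restrictFreeVar (φ := φ) (f := id) (v := fun a => v a)
    (xs := (default : Fin 0 → K)) v (fun _ => rfl)
  have h2 := BoundedFormula.realize_restrictFreeVar (φ := φ) (f := id) (v := fun a => v a)
    (xs := (default : Fin 0 → K)) w (fun a => h a.1 a.2)
  exact h1.symm.trans h2

/-- `Q` is realized in some model of `T`. -/
def SatIn (T : L.Theory) {V : Type u} (Q : Set (L.Formula V)) : Prop :=
  ∃ (K : Theory.ModelType.{u, u, u} T) (v : V → K), ∀ ψ ∈ Q, ψ.Realize v

theorem SatIn.mono {T : L.Theory} {V : Type u} {Q Q' : Set (L.Formula V)} (h : SatIn T Q')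
    (hQ : Q ⊆ Q') : SatIn T Q := by
  obtain ⟨K, v, hv⟩ := h
  exact ⟨K, v, fun ψ hψ => hv ψ (hQ hψ)⟩

theorem satIn_biUnion {T : L.Theory} (hT : T.IsSatisfiable) {V U : Type u} [LinearOrder U]
    (q : U → Set (L.Formula V)) (I : Set U) (h : ∀ w ∈ I, SatIn T (⋃ v ∈ Iic w, q v)) :
    SatIn T (⋃ v ∈ I, q v) := by
  classical
  refine exists_realize_of_finite T _ fun Q₀ hQ₀ => ?_
  have : Nonempty (Theory.ModelType.{u, u, u} T) := by
    obtain ⟨K⟩ := hT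
    exact ⟨K⟩
  have hex : ∀ ψ, ψ ∈ Q₀ → ∃ w, w ∈ I ∧ ψ ∈ q w := fun ψ hψ => by simpa using hQ₀ hψ
  rcases Q₀.eq_empty_or_nonempty with rfl | hne
  · let K := Classical.arbitrary (Theory.ModelType.{u, u, u} T)
    exact ⟨K, fun _ => Classical.arbitrary K, by simp⟩
  · have : Nonempty U := ⟨(hex _ hne.choose_spec).choose⟩
    choose! i hi using hex
    obtain ⟨ψ, hψ, hmax⟩ := Q₀.exists_max_image i hne
    refine (h (i ψ) (hi ψ hψ).1).mono ?_
    intro χ hχ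
    exact mem_iUnion₂.2 ⟨i χ, hmax χ hχ, (hi χ hχ).2⟩

/-- A Henkin construction of length `μ⁺`. The variables `(u, x)` are reserved for a solution of task
`u`, a list of `μ` formulas; by `2 ^ μ = μ⁺` there are at most `μ⁺` tasks. A task is adopted if it
mentions only earlier variables as parameters and is consistent with what has been adopted. The
values of the variables form the required model. -/
theorem exists_familySaturated (T : L.Theory) (hT : T.IsSatisfiable) (μ : Cardinal.{u})
    (hμ : theoryCard T ≤ μ) (hexp : 2 ^ μ = Order.succ μ) :
    ∃ N : Theory.ModelType.{u, u, u} T, FamilySaturated L N μ := by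
  classical
  have h0 : ℵ₀ ≤ μ := (le_max_left _ _).trans hμ
  have hL : L.card ≤ μ := (le_max_right _ _).trans hμ
  let X := μ.ord.ToType
  let U := (Order.succ μ).ord.ToType
  let V := U × X
  have hX : #X = μ := by simp [X]
  have hU : #U = Order.succ μ := by simp [U]
  have hreg : (Order.succ μ).IsRegular := isRegular_succ h0
  have hform : ∀ Y : Type u, #Y ≤ μ → #(L.Formula Y) ≤ μ := by
    intro Y hY
    have h2 : #(L.Formula Y) ≤ #(Σ n, L.BoundedFormula Y n) :=
      mk_le_of_injective (f := fun φ => ⟨0, φ⟩) (fun a b h => by simpa using h)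
    refine h2.trans (BoundedFormula.card_le.trans (max_le h0 ?_))
    simp only [Cardinal.lift_id]
    exact add_le_of_le h0 hY hL
  have hform' : #(L.Formula (V ⊕ X)) ≤ Order.succ μ := by
    have h2 : #(L.Formula (V ⊕ X)) ≤ #(Σ n, L.BoundedFormula (V ⊕ X) n) :=
      mk_le_of_injective (f := fun φ => ⟨0, φ⟩) (fun a b h => by simpa using h)
    have h1 := hreg.aleph0_le
    have h3 := Order.le_succ μ
    refine h2.trans (BoundedFormula.card_le.trans (max_le h1 ?_))
    simp only [Cardinal.lift_id]
    refine add_le_of_le h1 ?_ (hL.trans h3)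
    simp only [mk_sum, Cardinal.lift_id, V, mk_prod, hX, hU]
    exact add_le_of_le h1 ((mul_le_mul' le_rfl h3).trans (mul_eq_self h1).le) h3
  have hX0 : Nonempty X := mk_ne_zero_iff.1 (by rw [hX]; exact (aleph0_pos.trans_le h0).ne')
  have htask : #(X → L.Formula (V ⊕ X)) ≤ Order.succ μ := by
    rw [← power_def, hX]
    refine (power_le_power_right hform').trans ?_
    rw [← hexp, ← power_mul, mul_eq_self h0]
  obtain ⟨t, ht⟩ := exists_bookkeeping h0 htask
  let inst : U → Set (L.Formula V) := fun u =>
    range fun x => (t u x).relabel (Sum.elim id (fun x => (u, x)))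
  let valid : U → Prop := fun u => ∀ x, ∀ p ∈ (t u x).freeVarFinset, ∀ a, p = Sum.inl a → a.1 < u
  obtain ⟨q, hq⟩ := exists_transfinite_choice (ι := U) (S := Set (L.Formula V))
    (fun u f s => s = if valid u ∧ SatIn T ((⋃ v, f v) ∪ inst u) then inst u else ∅)
    (fun u f _ => ⟨_, rfl⟩)
  have hP : ∀ u, (⋃ v : Iio u, q v) = ⋃ v ∈ Iio u, q v := fun u => by
    rw [iUnion_subtype]
  simp only [hP] at hq
  have hIic : ∀ u, (⋃ v ∈ Iic u, q v) = (⋃ v ∈ Iio u, q v) ∪ q u := by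
    intro u
    rw [← Iio_insert, biUnion_insert, union_comm]
  have hsat : ∀ u, SatIn T (⋃ v ∈ Iic u, q v) := by
    intro u
    induction u using WellFoundedLT.induction with
    | ind u ih =>
      rw [hIic, hq u]
      split_ifs with h
      · exact h.2
      · rw [union_empty]
        exact satIn_biUnion hT q _ ih
  -- Commitments made up to stage `w` concern variables of index at most `w`, so the variables of a
  -- later stage can be reassigned freely.
  have hsupp : ∀ w, ∀ ψ ∈ q w, ∀ (K : Theory.ModelType.{u, u, u} T) (v v' : V → K),
      (∀ p : V, p.1 ≤ w → v p = v' p) → (ψ.Realize v ↔ ψ.Realize v') := by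
    intro w ψ hψ K v v' hv
    rw [hq w] at hψ
    split_ifs at hψ with h
    · obtain ⟨x, rfl⟩ := hψ
      rw [Formula.realize_relabel, Formula.realize_relabel]
      refine realize_congr_of_freeVar _ fun p hp => ?_
      rcases p with p | x'
      · exact hv p (h.1 x _ hp p rfl).le
      · exact hv _ le_rfl
    · exact absurd hψ (notMem_empty _)
  obtain ⟨K, v, hv⟩ : SatIn T (⋃ u ∈ (univ : Set U), q u) :=
    satIn_biUnion hT q univ fun w _ => hsat w
  have hv' : ∀ u, ∀ ψ ∈ q u, ψ.Realize v := fun u ψ hψ =>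
    hv ψ (mem_iUnion₂.2 ⟨u, trivial, hψ⟩)
  have key : ∀ τ : X → L.Formula (V ⊕ X),
      (∀ s : Finset X, ∃ z : X → K, ∀ x ∈ s, (τ x).Realize (Sum.elim v z)) →
      ∃ u, ∀ x, (τ x).Realize (Sum.elim v (fun x => v (u, x))) := by
    intro τ hτ
    -- The `μ` formulas mention at most `μ` parameters, so some stage beyond all of them carries the
    -- task `τ`.
    let par : Set U := ⋃ x, ((τ x).freeVarFinset.toLeft.image Prod.fst : Finset U)
    have hpar : #par < Order.succ μ := by
      rw [Order.lt_succ_iff]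
      refine (mk_iUnion_le_sum_mk.trans (sum_le_mk_mul_iSup _)).trans ?_
      rw [hX]
      refine (mul_le_mul' le_rfl (ciSup_le' (a := ℵ₀) fun x => ?_)).trans (mul_le_of_le h0 le_rfl h0)
      exact (Finset.countable_toSet _).le_aleph0
    obtain ⟨u₀, hu₀⟩ := bddAbove_of_mk_lt hreg hpar
    obtain ⟨u, hu, rfl⟩ := ht τ u₀
    have hvalid : valid u := by
      rintro x p hp a rfl
      refine (hu₀ a.1 (mem_iUnion.2 ⟨x, ?_⟩)).trans hu
      simp only [Finset.coe_image, mem_image, Finset.mem_coe, Finset.mem_toLeft]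
      exact ⟨a, hp, rfl⟩
    have hcons : SatIn T ((⋃ v ∈ Iio u, q v) ∪ inst u) := by
      refine exists_realize_of_finite T _ fun Q₀ hQ₀ => ?_
      have : ∀ ψ : inst u, ∃ x, (t u x).relabel (Sum.elim id (fun x => (u, x))) = ψ.1 :=
        fun ψ => ψ.2
      choose g hg using this
      obtain ⟨z, hz⟩ := hτ ((Q₀.subtype (· ∈ inst u)).image g)
      refine ⟨K, fun p => if p.1 = u then z p.2 else v p, fun ψ hψ => ?_⟩
      rcases hQ₀ hψ with h | h
      · obtain ⟨w, hw, hψw⟩ := mem_iUnion₂.1 h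
        refine (hsupp w ψ hψw K v _ fun p hp => ?_).1 (hv' w ψ hψw)
        rw [if_neg (hp.trans_lt hw).ne]
      · have h1 := hz (g ⟨ψ, h⟩) (Finset.mem_image_of_mem _ (Finset.mem_subtype.2 hψ))
        rw [show ψ = _ from (hg ⟨ψ, h⟩).symm, Formula.realize_relabel]
        refine (realize_congr_of_freeVar _ fun p hp => ?_).1 h1
        rcases p with p | x'
        · have := hvalid _ _ hp p rfl
          simp [this.ne]
        · simp
    refine ⟨u, fun x => ?_⟩
    have h1 : (t u x).relabel (Sum.elim id (fun x => (u, x))) ∈ q u := by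
      rw [hq u, if_pos ⟨hvalid, hcons⟩]
      exact ⟨x, rfl⟩
    have h2 := hv' u _ h1
    rw [Formula.realize_relabel] at h2
    convert h2 using 1
    funext p
    rcases p with p | x' <;> rfl
  have hmeets : L.MeetsDefinable (range v) := by
    refine meetsDefinable_iff.2 fun D hD hdef => ?_
    rw [← empty_union (range v)] at hdef
    obtain ⟨D', hD', rfl⟩ := definable_union_range_iff.1 hdef
    obtain ⟨φ, rfl⟩ := empty_definable_iff.1 hD'
    obtain ⟨y, hy⟩ := hD
    have x₀ := Classical.arbitrary X
    obtain ⟨u, hu⟩ := key (fun _ => φ.relabel (Sum.map id (fun _ => x₀))) (fun s =>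
      ⟨fun _ => y 0, fun x _ => by
        rw [Formula.realize_relabel]
        rw [mem_ofPred_eq, mem_ofPred_eq] at hy
        convert hy using 1
        funext p
        rcases p with p | i
        · rfl
        · simp [Subsingleton.elim i 0]⟩)
    refine ⟨fun _ => v (u, x₀), ?_, mem_range_self _⟩
    have := hu x₀
    rw [Formula.realize_relabel] at this
    simp only [mem_ofPred_eq]
    convert this using 1
    funext p
    rcases p with p | i <;> rfl
  let S := hmeets.toElementarySubstructure
  have hS : (S : Set K) = range v := coe_toElementarySubstructure hmeets
  have hvS : ∀ p, v p ∈ S := fun p => by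
    rw [← SetLike.mem_coe, hS]
    exact mem_range_self p
  have hSv : ∀ a : S, ∃ p, v p = a := fun a => by
    have : (a : K) ∈ range v := by
      rw [← hS]
      exact a.2
    exact this
  choose pre hpre using hSv
  suffices hfam : FamilySaturated L S μ from ⟨Theory.ModelType.of T S, hfam⟩
  intro Y A F hA hY hF hfin
  rcases isEmpty_or_nonempty F with hemp | hne
  · have : F = ∅ := isEmpty_coe_sort.1 hemp
    subst this
    rw [sInter_empty]
    exact ⟨fun _ => ⟨_, hvS (Classical.choice ⟨(Classical.choice (mk_ne_zero_iff.1 (by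
      rw [hU]; exact (Order.bot_lt_succ μ).ne')), Classical.arbitrary X)⟩)⟩, trivial⟩
  · let Φ : Set (L.Formula (A ⊕ Y)) := {φ | {w : Y → S | φ.Realize (Sum.elim (↑) w)} ∈ F}
    have hΦ : #Φ ≤ #X := by
      rw [hX]
      refine (mk_set_le _).trans (hform _ ?_)
      rw [mk_sum, Cardinal.lift_id, Cardinal.lift_id]
      exact add_le_of_le h0 hA hY
    have hΦ0 : Nonempty Φ := by
      obtain ⟨D, hD⟩ := hne
      obtain ⟨φ, hφ⟩ := definable_iff_exists_formula_sum.1 (hF D hD)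
      exact ⟨φ, by rw [mem_ofPred_eq, ← hφ]; exact hD⟩
    obtain ⟨⟨i, hi⟩⟩ := hΦ
    rw [← hX] at hY
    obtain ⟨⟨j, hj⟩⟩ := hY
    let g : A ⊕ Y → V ⊕ X := Sum.map (fun a => pre a) j
    let τ : X → L.Formula (V ⊕ X) := fun x => (Function.invFun i x).1.relabel g
    have htr : ∀ (φ : L.Formula (A ⊕ Y)) (z : X → S),
        (φ.relabel g).Realize (Sum.elim v (fun x => (z x : K))) ↔
          φ.Realize (Sum.elim (↑) (z ∘ j) : A ⊕ Y → S) := by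
      intro φ z
      rw [Formula.realize_relabel, ← S.subtype.map_formula]
      have : Sum.elim v (fun x => (z x : K)) ∘ g =
          S.subtype ∘ (Sum.elim (↑) (z ∘ j) : A ⊕ Y → S) := by
        funext p
        rcases p with a | y
        · exact hpre a
        · rfl
      rw [this]
    obtain ⟨u, hu⟩ := key τ (fun s => by
      obtain ⟨w, hw⟩ := hfin
        ((fun x => {w : Y → S | (Function.invFun i x).1.Realize (Sum.elim (↑) w)}) '' s)
        (s.finite_toSet.image _) (by
          rintro _ ⟨x, _, rfl⟩
          exact (Function.invFun i x).2)
      let z : X → S := fun x => if h : ∃ y, j y = x then w h.choose else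
        ⟨_, hvS (Classical.choice ⟨(Classical.choice (mk_ne_zero_iff.1 (by
          rw [hU]; exact (Order.bot_lt_succ μ).ne')), Classical.arbitrary X)⟩)⟩
      have hz : z ∘ j = w := by
        funext y
        have h : ∃ y', j y' = j y := ⟨y, rfl⟩
        simp only [Function.comp, z]
        rw [dif_pos h, hj h.choose_spec]
      refine ⟨fun x => z x, fun x hx => ?_⟩
      rw [htr, hz]
      exact hw _ ⟨x, hx, rfl⟩)
    refine ⟨fun y => ⟨v (u, j y), hvS _⟩, ?_⟩
    intro D hD
    obtain ⟨φ, hφ⟩ := definable_iff_exists_formula_sum.1 (hF D hD)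
    have hφΦ : φ ∈ Φ := by
      rw [mem_ofPred_eq, ← hφ]
      exact hD
    have h1 := hu (i ⟨φ, hφΦ⟩)
    simp only [τ, Function.leftInverse_invFun hi ⟨φ, hφΦ⟩] at h1
    rw [hφ]
    exact (htr φ (fun x => ⟨v (u, x), hvS _⟩)).1 h1

end Monster

end Shredding

namespace Shredding

/-! ### Ramsey's theorem -/

section Ramsey

open Filter

/-- The limit along the hyperfilter of a property of lists with respect to the last entry. -/
def limitColor (f : List ℕ → Prop) (l : List ℕ) : Prop :=
  ∀ᶠ x in (hyperfilter ℕ : Filter ℕ), f (l ++ [x])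

theorem eventually_limitColor (f : List ℕ → Prop) (l : List ℕ) :
    ∀ᶠ x in (hyperfilter ℕ : Filter ℕ), (f (l ++ [x]) ↔ limitColor f l) := by
  by_cases h : limitColor f l
  · filter_upwards [h] with x hx
    exact ⟨fun _ => h, fun _ => hx⟩
  · have h' := h
    rw [limitColor, ← Ultrafilter.eventually_not] at h'
    filter_upwards [h'] with x hx
    exact ⟨fun h1 => absurd h1 hx, fun h1 => absurd h1 h⟩

/-- Ramsey's theorem by iterated ultrafilter limits. Each `g k` is chosen so that appending it to
any short enough list of earlier values does not change the limit colour; increasing tuples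
therefore all have the limit colour of the empty list. -/
theorem exists_homogeneous {H : Type*} [Finite H] (n : H → ℕ)
    (f : ∀ h, (Fin (n h) → ℕ) → Prop) :
    ∃ g : ℕ ↪o ℕ, ∀ h (s t : Fin (n h) ↪o ℕ), f h (g ∘ s) ↔ f h (g ∘ t) := by
  let F : H → List ℕ → Prop := fun h l => ∃ v, l = List.ofFn v ∧ f h v
  obtain ⟨g, hg⟩ := exists_transfinite_choice (ι := ℕ) (S := ℕ)
    (fun k v x => (∀ i, v i < x) ∧ ∀ (h : H) (m : Fin (n h)) (t : Fin m → Set.Iio k),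
      (limitColor^[n h - 1 - m] (F h) (List.ofFn (v ∘ t) ++ [x]) ↔
        limitColor^[n h - m] (F h) (List.ofFn (v ∘ t)))) (by
    intro k v _
    have h1 : ∀ᶠ x in (hyperfilter ℕ : Filter ℕ), ∀ i : Set.Iio k, v i < x := by
      rw [eventually_all]
      intro i
      have : (Set.Ioi (v i)) ∈ (hyperfilter ℕ : Filter ℕ) := by
        apply Filter.mem_hyperfilter_of_finite_compl
        rw [Set.compl_Ioi]
        exact Set.finite_Iic _
      exact this
    have h2 : ∀ᶠ x in (hyperfilter ℕ : Filter ℕ), ∀ (h : H) (m : Fin (n h))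
        (t : Fin m → Set.Iio k),
        (limitColor^[n h - 1 - m] (F h) (List.ofFn ((fun c : Set.Iio k => v c) ∘ t) ++ [x]) ↔
        limitColor^[n h - m] (F h) (List.ofFn ((fun c : Set.Iio k => v c) ∘ t))) := by
      rw [eventually_all]
      intro h
      rw [eventually_all]
      intro m
      rw [eventually_all]
      intro t
      have : n h - m = (n h - 1 - m) + 1 := by omega
      rw [this, Function.iterate_succ_apply']
      exact eventually_limitColor _ _
    exact (h1.and h2).exists)
  have hmono : StrictMono g := fun a b hab => (hg b).1 ⟨a, hab⟩
  refine ⟨OrderEmbedding.ofStrictMono g hmono, fun h s t => ?_⟩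
  have key : ∀ s : Fin (n h) ↪o ℕ, f h (g ∘ s) ↔ limitColor^[n h] (F h) [] := by
    intro s
    have H : ∀ (m : ℕ) (hm : m ≤ n h), limitColor^[n h - m] (F h)
        (List.ofFn (fun i : Fin m => g (s (Fin.castLE hm i)))) ↔ limitColor^[n h] (F h) [] := by
      intro m
      induction m with
      | zero => simp
      | succ m ih =>
        intro hm
        rw [← ih (Nat.le_of_succ_le hm)]
        have hlt : ∀ i : Fin m, s (Fin.castLE (Nat.le_of_succ_le hm) i) < s ⟨m, hm⟩ := fun i =>
          (OrderEmbedding.lt_iff_lt s).2 (by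
            rw [Fin.lt_def]
            exact i.2)
        have this : limitColor^[n h - 1 - m] (F h)
            (List.ofFn (fun i : Fin m => g (s (Fin.castLE (Nat.le_of_succ_le hm) i))) ++
              [g (s ⟨m, hm⟩)]) ↔ limitColor^[n h - m] (F h)
            (List.ofFn (fun i : Fin m => g (s (Fin.castLE (Nat.le_of_succ_le hm) i)))) :=
          (hg (s ⟨m, hm⟩)).2 h ⟨m, hm⟩ (fun i => ⟨_, hlt i⟩)
        rw [← this, List.ofFn_succ', List.concat_eq_append]
        rw [show n h - (m + 1) = n h - 1 - m by omega]
        rfl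
    rw [← H (n h) le_rfl]
    simp only [Nat.sub_self, Function.iterate_zero, id]
    constructor
    · intro hs
      exact ⟨_, rfl, hs⟩
    · rintro ⟨v, hv, hfv⟩
      rwa [← List.ofFn_injective hv] at hfv
  exact (key s).trans (key t).symm

end Ramsey

/-! ### Preserving indiscernibility -/

section Closing

open Set

variable {L : FirstOrder.Language.{u, u}} {N : Type u} [L.Structure N]

/-- A condition on indiscernibility over a tuple indexed by `X`: a definable set and two increasing
tuples of indices. -/
structure IndCond (L : FirstOrder.Language.{u, u}) {N : Type u} [L.Structure N] (B : Set N)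
    (X : Type*) (ι : Type u) [LinearOrder ι] (k : ℕ) where
  /-- The length of the tuples. -/
  n : ℕ
  /-- The definable set. -/
  E : Set (X ⊕ Fin n × Fin k → N)
  definable : B.Definable L E
  /-- The first tuple of indices. -/
  s : Fin n ↪o ι
  /-- The second tuple of indices. -/
  t : Fin n ↪o ι

/-- The set of all tuples that satisfy an indiscernibility condition. -/
def IndCond.holds {B : Set N} {X : Type*} {ι : Type u} [LinearOrder ι] {k : ℕ}
    (c : IndCond L B X ι k) (b : ι → Fin k → N) : Set (X → N) :=
  {m | Sum.elim m (fun q => b (c.s q.1) q.2) ∈ c.E ↔ Sum.elim m (fun q => b (c.t q.1) q.2) ∈ c.E}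

variable {B : Set N} {X : Type*} {ι : Type u} [LinearOrder ι] {k : ℕ} {b : ι → Fin k → N}

theorem indiscernible_union_range_iff_holds {v : X → N} :
    Indiscernible (L := L) (B ∪ range v) b ↔ ∀ c : IndCond L B X ι k, v ∈ c.holds b := by
  rw [indiscernible_union_range_iff]
  exact ⟨fun h c => h c.n c.E c.definable c.s c.t, fun h n E hE s t => h ⟨n, E, hE, s, t⟩⟩

theorem IndCond.definable_holds (c : IndCond L B X ι k) {A : Set N} (hBA : B ⊆ A)
    (hb : ∀ i j, b i j ∈ A) : A.Definable L (c.holds b) := by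
  have key : ∀ s : Fin c.n ↪o ι,
      A.Definable L {m : X → N | Sum.elim m (fun q => b (s q.1) q.2) ∈ c.E} := by
    intro s
    have h := definable_preimage_elim_const (A := A) (Y := X)
      (c := fun q : Fin c.n × Fin k => b (s q.1) q.2)
      (((c.definable.mono hBA).preimage_comp (Equiv.sumComm X (Fin c.n × Fin k))))
      (fun q => hb _ _)
    convert h using 1
    ext m
    simp only [mem_ofPred_eq, mem_preimage]
    rw [show Sum.elim (fun q : Fin c.n × Fin k => b (s q.1) q.2) m ∘
      (Equiv.sumComm X (Fin c.n × Fin k)) = Sum.elim m (fun q => b (s q.1) q.2) from by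
        funext z
        rcases z with z | z <;> rfl]
  exact definable_iff (key c.s) (key c.t)

/-- For a fixed `m₀ ∈ D`, Ramsey's theorem yields a subsequence of `b` along which the finitely many
conditions hold at `m₀`. That some element of `D` satisfies them is a `B`-definable property of the
members of the sequence involved, so indiscernibility over `B` moves it to the indices named in `C`,
with another element `m`. -/
theorem exists_mem_holds [Nonempty N] (hι : Nonempty (ℕ ↪o ι)) (hb : Indiscernible (L := L) B b)
    {D : Set (X → N)} (hD : B.Definable L D) (hne : D.Nonempty) (C : Set (IndCond L B X ι k))
    (hC : C.Finite) : ∃ m ∈ D, ∀ c ∈ C, m ∈ c.holds b := by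
  classical
  have : Finite C := hC
  have hCft := hC.fintype
  obtain ⟨e⟩ := hι
  obtain ⟨m₀, hm₀⟩ := hne
  let w : Finset ι := (Finset.univ : Finset C).biUnion fun c =>
    Finset.univ.image c.1.s ∪ Finset.univ.image c.1.t
  let emb := w.orderEmbOfFin rfl
  have hs : ∀ c : C, ∃ s' : Fin c.1.n → Fin w.card, ∀ i, emb (s' i) = c.1.s i := by
    intro c
    refine Classical.axiomOfChoice (r := fun i x => emb x = c.1.s i) fun i => ?_
    have : c.1.s i ∈ (w : Set ι) := by simp only [w]; aesop
    rwa [← Finset.range_orderEmbOfFin w rfl] at this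
  have ht : ∀ c : C, ∃ s' : Fin c.1.n → Fin w.card, ∀ i, emb (s' i) = c.1.t i := by
    intro c
    refine Classical.axiomOfChoice (r := fun i x => emb x = c.1.t i) fun i => ?_
    have : c.1.t i ∈ (w : Set ι) := by simp only [w]; aesop
    rwa [← Finset.range_orderEmbOfFin w rfl] at this
  choose s' hs' using hs
  choose t' ht' using ht
  obtain ⟨g, hg⟩ := exists_homogeneous (fun c : C => c.1.n)
    (fun c v => Sum.elim m₀ (fun q => b (e (v q.1)) q.2) ∈ c.1.E)
  let Q : Set ((Fin w.card × Fin k) ⊕ X → N) := {z | (fun x => z (Sum.inr x)) ∈ D} ∩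
    ⋂ c : C, {z | z ∘ (Sum.elim Sum.inr (fun q => Sum.inl (s' c q.1, q.2))) ∈ c.1.E ↔
      z ∘ (Sum.elim Sum.inr (fun q => Sum.inl (t' c q.1, q.2))) ∈ c.1.E}
  have hQ : B.Definable L Q := (hD.preimage_comp _).inter (definable_iInter_of_finite fun c =>
    definable_iff (c.1.definable.preimage_comp _) (c.1.definable.preimage_comp _))
  have hQ' := definable_exists hQ
  have hrel : ∀ (y : Fin w.card × Fin k → N) (m : X → N), Sum.elim y m ∈ Q ↔ m ∈ D ∧ ∀ c : C,
      (Sum.elim m (fun q => y (s' c q.1, q.2)) ∈ c.1.E ↔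
        Sum.elim m (fun q => y (t' c q.1, q.2)) ∈ c.1.E) := by
    intro y m
    have h1 : ∀ (c : C) (r : Fin c.1.n → Fin w.card), Sum.elim y m ∘
        (Sum.elim Sum.inr (fun q => Sum.inl (r q.1, q.2)) :
          X ⊕ Fin c.1.n × Fin k → (Fin w.card × Fin k) ⊕ X) =
        Sum.elim m (fun q => y (r q.1, q.2)) := by
      intro c r
      funext z
      rcases z with z | z <;> rfl
    simp only [Q, mem_inter_iff, mem_iInter, mem_ofPred_eq, h1]
    rfl
  have hstart := (indiscernible_iff.1 hb _ _ hQ' emb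
    ((Fin.valOrderEmb w.card).trans (g.trans e))).2 (by
      refine ⟨m₀, (hrel _ _).2 ⟨hm₀, fun c => ?_⟩⟩
      have hord : ∀ (r : Fin c.1.n → Fin w.card) (o : Fin c.1.n ↪o ι), (∀ i, emb (r i) = o i) →
          StrictMono fun i => ((r i : Fin w.card) : ℕ) := by
        intro r o hr i j hij
        have : emb (r i) < emb (r j) := by
          rw [hr, hr]
          exact o.strictMono hij
        exact emb.lt_iff_lt.1 this
      exact hg c (OrderEmbedding.ofStrictMono _ (hord _ _ (hs' c)))
        (OrderEmbedding.ofStrictMono _ (hord _ _ (ht' c))))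
  obtain ⟨m, hm⟩ := hstart
  obtain ⟨hmD, hmC⟩ := (hrel _ _).1 hm
  refine ⟨m, hmD, fun c hc => ?_⟩
  have := hmC ⟨c, hc⟩
  simp only [hs' ⟨c, hc⟩, ht' ⟨c, hc⟩] at this
  exact this

variable {J : Type u} [LinearOrder J] {ι : J → Type u} [∀ j, LinearOrder (ι j)]
  {I : ∀ j, ι j → Fin k → N} {B : J → Set N}

/-- Induction by adding a largest index `a`. The earlier sequences lie in `B a`, so the conditions
on them are `B a`-definable and can be absorbed into the set to which `exists_mem_holds` is applied.
-/
theorem exists_mem_holds_chain [Nonempty N] (hι : ∀ j, Nonempty (ℕ ↪o ι j)) (hB : Monotone B)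
    (hI : ∀ j, Indiscernible (L := L) (B j) (I j)) (hIB : ∀ j j', j < j' → ∀ i l, I j i l ∈ B j')
    {D : Set (X → N)} (hD : ∀ j, (B j).Definable L D) (hne : D.Nonempty)
    (C : ∀ j, Set (IndCond L (B j) X (ι j) k)) (hC : ∀ j, (C j).Finite) (F : Finset J) :
    ∃ m ∈ D, ∀ j ∈ F, ∀ c ∈ C j, m ∈ c.holds (I j) := by
  classical
  induction F using Finset.induction_on_max with
  | empty =>
    obtain ⟨m, hm⟩ := hne
    exact ⟨m, hm, by simp⟩
  | insert a F hF ih =>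
    obtain ⟨m₁, hm₁, hm₁'⟩ := ih
    let D' : Set (X → N) := D ∩ ⋂ j ∈ F, ⋂ c : C j, c.1.holds (I j)
    have hD' : (B a).Definable L D' := by
      refine (hD a).inter ?_
      have : (⋂ j ∈ F, ⋂ c : C j, c.1.holds (I j)) =
          ⋂ j : F, ⋂ c : C j, c.1.holds (I j) := by
        rw [iInter_subtype]
      rw [this]
      refine definable_iInter_of_finite fun j => ?_
      have : Finite (C j) := hC j
      exact definable_iInter_of_finite fun c =>
        c.1.definable_holds (hB (hF j j.2).le) (hIB _ _ (hF j j.2))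
    obtain ⟨m, hm, hmC⟩ := exists_mem_holds (hι a) (hI a) hD' ⟨m₁, hm₁, by
      simp only [mem_iInter]
      exact fun j hj c => hm₁' j hj c c.2⟩ (C a) (hC a)
    refine ⟨m, hm.1, fun j hj c hc => ?_⟩
    rcases Finset.mem_insert.1 hj with rfl | hj
    · exact hmC c hc
    · have := hm.2
      simp only [mem_iInter] at this
      exact this j hj ⟨c, hc⟩

theorem exists_typeEq_indiscernible [Nonempty N] {X : Type u} {μ : Cardinal.{u}}
    (hN : FamilySaturated L N μ) (hι : ∀ j, Nonempty (ℕ ↪o ι j)) (hB : Monotone B)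
    (hI : ∀ j, Indiscernible (L := L) (B j) (I j)) (hIB : ∀ j j', j < j' → ∀ i l, I j i l ∈ B j')
    {B₀ A : Set N} (hB₀ : ∀ j, B₀ ⊆ B j) (hB₀A : B₀ ⊆ A) (hBA : ∀ j, B j ⊆ A)
    (hIA : ∀ j i l, I j i l ∈ A)
    (hA : #A ≤ μ) (hX : #X ≤ μ) (v₀ : X → N) :
    ∃ v : X → N, TypeEq L B₀ v₀ v ∧ ∀ j, Indiscernible (L := L) (B j ∪ range v) (I j) := by
  classical
  let F₁ : Set (Set (X → N)) := {D | B₀.Definable L D ∧ v₀ ∈ D}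
  let F₂ : Set (Set (X → N)) := {D | ∃ (j : J) (c : IndCond L (B j) X (ι j) k), D = c.holds (I j)}
  obtain ⟨v, hv⟩ := hN X A (F₁ ∪ F₂) hA hX (by
    rintro D (⟨hD, -⟩ | ⟨j, c, rfl⟩)
    · exact hD.mono hB₀A
    · exact c.definable_holds (hBA j) (hIA j)) (by
    intro F₀ hfin hsub
    let G : Set F₀ := {D | D.1 ∈ F₁}
    have : Finite F₀ := hfin
    have hsplit : ∀ D : F₀, D ∉ G →
        ∃ (j : J) (c : IndCond L (B j) X (ι j) k), D.1 = c.holds (I j) :=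
      fun D hD => (hsub D.2).resolve_left hD
    let D₀ : Set (X → N) := ⋂ D : G, D.1.1
    have hD₀ : B₀.Definable L D₀ := definable_iInter_of_finite fun D => D.2.1
    have hfr : ∀ D : F₀, ∃ o : Option (Σ j, IndCond L (B j) X (ι j) k), D ∉ G →
        ∃ p, o = some p ∧ D.1 = p.2.holds (I p.1) := by
      intro D
      by_cases hD : D ∈ G
      · exact ⟨none, fun h => absurd hD h⟩
      · obtain ⟨j, c, hc⟩ := hsplit D hD
        exact ⟨some ⟨j, c⟩, fun _ => ⟨_, rfl, hc⟩⟩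
    choose o ho using hfr
    have hCfin : ∀ j, {c : IndCond L (B j) X (ι j) k | some ⟨j, c⟩ ∈ range o}.Finite := by
      intro j
      refine (finite_range o).preimage (f := fun c => some (Sigma.mk j c)) ?_
      intro a _ b _ hab
      simpa using hab
    have hFfin : {j | ∃ c, some ⟨j, c⟩ ∈ range o}.Finite := by
      refine Set.Finite.subset (((finite_range o).image (Option.map Sigma.fst)).preimage
        (f := some) (Option.some_injective _).injOn) ?_
      rintro j ⟨c, hc⟩
      exact ⟨_, hc, rfl⟩
    obtain ⟨m, hm, hmC⟩ := exists_mem_holds_chain hι hB hI hIB (D := D₀)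
      (fun j => hD₀.mono (hB₀ j)) ⟨v₀, mem_iInter.2 fun D => D.2.2⟩
      (fun j => {c | some ⟨j, c⟩ ∈ range o}) hCfin hFfin.toFinset
    refine ⟨m, fun D hD => ?_⟩
    by_cases hG : (⟨D, hD⟩ : F₀) ∈ G
    · exact mem_iInter.1 hm ⟨⟨D, hD⟩, hG⟩
    · obtain ⟨⟨j, c⟩, hp, hDp⟩ := ho ⟨D, hD⟩ hG
      simp only at hDp
      rw [hDp]
      exact hmC j (hFfin.mem_toFinset.2 ⟨c, ⟨_, hp⟩⟩) c ⟨_, hp⟩)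
  refine ⟨v, fun D hD => ?_, fun j => ?_⟩
  · by_cases h : v₀ ∈ D
    · exact ⟨fun _ => hv D (Or.inl ⟨hD, h⟩), fun _ => h⟩
    · exact ⟨fun h1 => absurd h1 h, fun h1 => absurd h1 (hv Dᶜ (Or.inl ⟨hD.compl, h⟩))⟩
  · exact indiscernible_union_range_iff_holds.2 fun c => hv _ (Or.inr ⟨j, c, rfl⟩)

/-- Any small model containing `B₀` is replaced by a copy with the same type over `B₀`. The copy is
again a model and still contains `B₀`, while the new enumeration preserves all sequences at once. -/
theorem exists_meetsDefinable_indiscernible [Nonempty N] {μ κ : Cardinal.{u}}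
    (hN : FamilySaturated L N μ) (hι : ∀ j, Nonempty (ℕ ↪o ι j)) (hB : Monotone B)
    (hI : ∀ j, Indiscernible (L := L) (B j) (I j)) (hIB : ∀ j j', j < j' → ∀ i l, I j i l ∈ B j')
    {B₀ A : Set N} (hB₀ : ∀ j, B₀ ⊆ B j) (hB₀A : B₀ ⊆ A) (hBA : ∀ j, B j ⊆ A)
    (hIA : ∀ j i l, I j i l ∈ A)
    (hA : #A ≤ μ) (hκ : ℵ₀ ≤ κ) (hL : L.card ≤ κ) (hB₀κ : #B₀ ≤ κ) (hκμ : κ ≤ μ) :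
    ∃ K : Set N, B₀ ⊆ K ∧ L.MeetsDefinable K ∧ #K ≤ κ ∧
      ∀ j, Indiscernible (L := L) (B j ∪ K) (I j) := by
  obtain ⟨K, hBK, hK, hKκ⟩ := exists_meetsDefinable_superset (L := L) B₀ κ hκ hB₀κ hL
  obtain ⟨v, hv, hvI⟩ := exists_typeEq_indiscernible hN hι hB hI hIB hB₀ hB₀A hBA hIA hA
    (hKκ.trans hκμ) (fun x : K => (x : N))
  refine ⟨range v, fun x hx => ⟨⟨x, hBK hx⟩, ?_⟩,
    (hv.mono (empty_subset _)).meetsDefinable_range hK, mk_range_le.trans hKκ, hvI⟩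
  exact hv.eq_of_mem (x := ⟨x, hBK hx⟩) hx

end Closing

end Shredding

namespace Shredding

/-! ### Enlarging an increasing family of sets to a chain of models -/

section ModelChain

open Set

variable {L : FirstOrder.Language.{u, u}} {N : Type u} [L.Structure N] {k : ℕ}
  {J : Type u} [LinearOrder J] {ι : J → Type u} [∀ j, LinearOrder (ι j)]
  {I : ∀ j, ι j → Fin k → N} {B : J → Set N}

theorem mk_iUnion_le_of_le {Y : Type u} {f : Y → Set N} {κ : Cardinal.{u}} (hκ : ℵ₀ ≤ κ)
    (hY : #Y ≤ κ) (hf : ∀ y, #(f y) ≤ κ) : #(⋃ y, f y) ≤ κ :=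
  (mk_iUnion_le_sum_mk.trans (sum_le_mk_mul_iSup _)).trans
    ((mul_le_mul' hY (ciSup_le' hf)).trans (mul_eq_self hκ).le)

theorem mk_union_le_of_le {s t : Set N} {κ : Cardinal.{u}} (hκ : ℵ₀ ≤ κ)
    (hs : #s ≤ κ) (ht : #t ≤ κ) : #(s ∪ t : Set N) ≤ κ :=
  (mk_union_le s t).trans (add_le_of_le hκ hs ht)

/-- The recursion keeps every sequence `I j'` with `j ≤ j'` indiscernible over `B j' ∪ M j`, not
just `I j` itself; otherwise an earlier model could spoil a later sequence. -/
theorem exists_model_chain [WellFoundedLT J] [Nonempty N] {μ : Cardinal.{u}}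
    (hN : FamilySaturated L N μ) (hι : ∀ j, Nonempty (ℕ ↪o ι j)) (hB : Monotone B)
    (hI : ∀ j, Indiscernible (L := L) (B j) (I j)) (hIB : ∀ j j', j < j' → ∀ i l, I j i l ∈ B j')
    {A : Set N} (hBA : ∀ j, B j ⊆ A) (hIA : ∀ j i l, I j i l ∈ A) (hA : #A ≤ μ)
    {mu : J → Cardinal.{u}} (h0 : ∀ j, ℵ₀ ≤ mu j) (hL : ∀ j, L.card ≤ mu j) (hmu : Monotone mu)
    (hJ : ∀ j, #(Iio j) ≤ mu j) (hmuμ : ∀ j, mu j ≤ μ) (hBmu : ∀ j, #(B j) ≤ mu j) :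
    ∃ M : J → Set N, Monotone M ∧ ∀ j, B j ⊆ M j ∧ L.MeetsDefinable (M j) ∧ #(M j) ≤ mu j ∧
      Indiscernible (L := L) (M j) (I j) := by
  obtain ⟨M, hM⟩ := exists_transfinite_choice (ι := J) (S := Set N)
    (fun j f s => B j ⊆ s ∧ (∀ j', f j' ⊆ s) ∧ L.MeetsDefinable s ∧ #s ≤ mu j ∧
      ∀ j', j ≤ j' → Indiscernible (L := L) (B j' ∪ s) (I j')) (by
    intro j f hf
    let U : Set N := ⋃ j' : Iio j, f j'
    have hfmono : Monotone fun j' : Iio j => f j' := by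
      intro a b hab
      rcases hab.eq_or_lt with rfl | hab
      · exact le_rfl
      · exact (hf b b.2).2.1 ⟨a, hab⟩
    have hU : #U ≤ mu j := mk_iUnion_le_of_le (h0 j) (hJ j) fun j' =>
      (hf j' j'.2).2.2.2.1.trans (hmu (le_of_lt j'.2))
    obtain ⟨K, hBK, hK, hKmu, hKI⟩ := exists_meetsDefinable_indiscernible (J := Ici j)
      (ι := fun j' => ι j') (I := fun j' => I j') (B := fun j' => B j' ∪ U) hN
      (fun j' => hι j') (fun a b hab => union_subset_union_left _ (hB hab))
      (by
        intro j'
        rcases isEmpty_or_nonempty (Iio j) with he | he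
        · have : U = ∅ := by simp [U]
          rw [this, union_empty]
          exact hI _
        · simp only [U]
          rw [union_iUnion]
          refine indiscernible_iUnion (fun a b hab => union_subset_union_right _ (hfmono hab)) ?_
          exact fun a => (hf a a.2).2.2.2.2 j' (a.2.le.trans j'.2))
      (fun a b hab i l => Or.inl (hIB a b hab i l)) (B₀ := B j ∪ U) (A := A ∪ U) (κ := mu j)
      (fun a => union_subset_union_left _ (hB a.2)) (union_subset_union_left _ (hBA j))
      (fun a => union_subset_union_left _ (hBA a)) (fun a i l => Or.inl (hIA a i l))
      (mk_union_le_of_le ((h0 j).trans (hmuμ j)) hA (hU.trans (hmuμ j))) (h0 j) (hL j)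
      (mk_union_le_of_le (h0 j) (hBmu j) hU) (hmuμ j)
    refine ⟨K, subset_union_left.trans hBK, fun j' => ?_, hK, hKmu, fun j' hj' => ?_⟩
    · exact (subset_iUnion (fun j' : Iio j => f j') j').trans (subset_union_right.trans hBK)
    · exact (hKI ⟨j', hj'⟩).mono (union_subset_union_left _ subset_union_left))
  refine ⟨M, ?_, fun j => ⟨(hM j).1, (hM j).2.2.1, (hM j).2.2.2.1,
    ((hM j).2.2.2.2 j le_rfl).mono subset_union_right⟩⟩
  intro a b hab
  rcases hab.eq_or_lt with rfl | hab
  · exact le_rfl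
  · exact (hM b).2.1 ⟨a, hab⟩

end ModelChain

/-! ### Independent indiscernible sequences from the independence property -/

section IndependentSequence

open Set

variable {L : FirstOrder.Language.{u, u}} {N : Type u} [L.Structure N] {r s : ℕ}

/-- The families of tuples on which `φ` defines the trace of `P` on the finite set `W`. -/
def tracePattern (φ : L.Formula (Fin r ⊕ Fin s)) {Y : Type u} (W : Finset Y) (P : Set Y) :
    Set (Y × Fin r → N) :=
  {x | ∃ b : Fin s → N, ∀ y ∈ W, φ.Realize (Sum.elim (fun l => x (y, l)) b) ↔ y ∈ P}

theorem definable_tracePattern [Nonempty N] (φ : L.Formula (Fin r ⊕ Fin s)) {Y : Type u}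
    (W : Finset Y) (P : Set Y) : (∅ : Set N).Definable L (tracePattern (N := N) φ W P) := by
  have h : (∅ : Set N).Definable L (⋂ y : W, {z : (Y × Fin r) ⊕ Fin s → N |
      z ∈ (fun z => z ∘ (Sum.map (fun l => (y.1, l)) id : Fin r ⊕ Fin s → (Y × Fin r) ⊕ Fin s)) ⁻¹'
        (Set.ofPred φ.Realize) ↔ z ∈ {_z : (Y × Fin r) ⊕ Fin s → N | y.1 ∈ P}}) := by
    refine definable_iInter_of_finite fun y => definable_iff
      ((empty_definable_iff.2 ⟨φ, rfl⟩).preimage_comp _) ?_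
    by_cases hy : y.1 ∈ P
    · simp only [hy]
      exact definable_univ
    · simp only [hy]
      exact definable_empty
  convert definable_exists h using 1
  ext x
  simp only [tracePattern, mem_ofPred_eq, mem_iInter, mem_preimage, Subtype.forall]
  refine exists_congr fun b => forall₂_congr fun y _ => ?_
  have : Sum.elim x b ∘ (Sum.map (fun l => (y, l)) id : Fin r ⊕ Fin s → (Y × Fin r) ⊕ Fin s) =
      Sum.elim (fun l => x (y, l)) b := by
    funext z
    rcases z with z | z <;> rfl
  rw [this]

theorem exists_independent_nat [Nonempty N] {μ : Cardinal.{u}} (hμ : ℵ₀ ≤ μ)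
    (hN : FamilySaturated L N μ) (φ : L.Formula (Fin r ⊕ Fin s))
    (hφ : ∀ n : ℕ, ∃ (a : Fin n → Fin r → N) (b : Set (Fin n) → Fin s → N),
      ∀ i w, φ.Realize (Sum.elim (a i) (b w)) ↔ i ∈ w) :
    ∃ a : ℕ → Fin r → N, ∀ (W : Finset ℕ) (P : Set ℕ),
      ∃ b : Fin s → N, ∀ i ∈ W, φ.Realize (Sum.elim (a i) b) ↔ i ∈ P := by
  classical
  let Y := ULift.{u} ℕ
  obtain ⟨x, hx⟩ := hN (Y × Fin r) ∅
    (range fun p : Finset Y × Set Y => tracePattern φ p.1 p.2) (by simp)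
    ((mk_le_aleph0 (α := Y × Fin r)).trans hμ) (by
      rintro _ ⟨p, rfl⟩
      exact definable_tracePattern φ p.1 p.2) (by
    intro F₀ hfin hsub
    have : Finite F₀ := hfin
    have := Fintype.ofFinite F₀
    choose g hg using fun D : F₀ => hsub D.2
    let W₀ : Finset ℕ := Finset.univ.biUnion fun D : F₀ => (g D).1.image ULift.down
    obtain ⟨n, hn⟩ : ∃ n, ∀ i ∈ W₀, i < n :=
      ⟨W₀.sup id + 1, fun i hi => Nat.lt_succ_of_le (Finset.le_sup (f := id) hi)⟩
    obtain ⟨a, b, hab⟩ := hφ n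
    refine ⟨fun p => if h : p.1.down < n then a ⟨p.1.down, h⟩ p.2 else Classical.arbitrary N,
      fun D hD => ?_⟩
    rw [← show tracePattern φ (g ⟨D, hD⟩).1 (g ⟨D, hD⟩).2 = D from hg ⟨D, hD⟩]
    refine ⟨b {i | ULift.up i.1 ∈ (g ⟨D, hD⟩).2}, fun y hy => ?_⟩
    have hyn : y.down < n := hn _ (Finset.mem_biUnion.2 ⟨⟨D, hD⟩, Finset.mem_univ _,
      Finset.mem_image_of_mem _ hy⟩)
    simp only [hyn, dif_pos]
    exact hab ⟨y.down, hyn⟩ _)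
  refine ⟨fun i l => x (⟨i⟩, l), fun W P => ?_⟩
  obtain ⟨b, hb⟩ := hx _ ⟨(W.image ULift.up, ULift.down ⁻¹' P), rfl⟩
  exact ⟨b, fun i hi => hb ⟨i⟩ (Finset.mem_image_of_mem _ hi)⟩

/-- A finite part of the requirements involves finitely many indices. These are sent, in increasing
order, into a homogeneous subsequence of an independent sequence of length `ω`; independence passes
to subsequences. -/
theorem exists_indiscernible_independent [Nonempty N] {μ : Cardinal.{u}} (hμ : ℵ₀ ≤ μ)
    (hN : FamilySaturated L N μ) (φ : L.Formula (Fin r ⊕ Fin s))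
    (hφ : ∀ n : ℕ, ∃ (a : Fin n → Fin r → N) (b : Set (Fin n) → Fin s → N),
      ∀ i w, φ.Realize (Sum.elim (a i) (b w)) ↔ i ∈ w)
    (Y : Type u) [LinearOrder Y] (hY : #Y ≤ μ) :
    ∃ I : Y → Fin r → N, Indiscernible (L := L) ∅ I ∧ ∀ (W : Finset Y) (P : Set Y),
      ∃ b : Fin s → N, ∀ y ∈ W, φ.Realize (Sum.elim (I y) b) ↔ y ∈ P := by
  classical
  obtain ⟨a, ha⟩ := exists_independent_nat hμ hN φ hφ
  let Cnd := (Σ n : ℕ, {D : Set (Fin n × Fin r → N) // (∅ : Set N).Definable L D} ×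
    (Fin n ↪o Y) × (Fin n ↪o Y)) ⊕ (Finset Y × Set Y)
  let S : Cnd → Set (Y × Fin r → N) := Sum.elim
    (fun c => {x | (fun q => x (c.2.2.1 q.1, q.2)) ∈ c.2.1.1 ↔
      (fun q => x (c.2.2.2 q.1, q.2)) ∈ c.2.1.1})
    (fun p => tracePattern φ p.1 p.2)
  obtain ⟨x, hx⟩ := hN (Y × Fin r) ∅ (range S) (by simp)
    (by
      rw [mk_prod]
      exact mul_le_of_le hμ (by simpa using hY) ((lift_le_aleph0.2 mk_le_aleph0).trans hμ)) (by
      rintro _ ⟨c | p, rfl⟩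
      · exact definable_iff (c.2.1.2.preimage_comp (fun q => (c.2.2.1 q.1, q.2)))
          (c.2.1.2.preimage_comp (fun q => (c.2.2.2 q.1, q.2)))
      · exact definable_tracePattern φ p.1 p.2) (by
    intro F₀ hfin hsub
    have : Finite F₀ := hfin
    have := Fintype.ofFinite F₀
    choose c hc using fun D : F₀ => hsub D.2
    let supp : Cnd → Finset Y := Sum.elim
      (fun c => Finset.univ.image c.2.2.1 ∪ Finset.univ.image c.2.2.2) (fun p => p.1)
    let Y₀ : Finset Y := Finset.univ.biUnion fun D : F₀ => supp (c D)
    let rank : Y → ℕ := fun y => (Y₀.filter (· < y)).card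
    have hrank : ∀ y ∈ Y₀, ∀ y', y < y' → rank y < rank y' := by
      intro y hy y' hyy'
      refine Finset.card_lt_card ((Finset.ssubset_iff_of_subset ?_).2 ⟨y, ?_, ?_⟩)
      · intro z hz
        rw [Finset.mem_filter] at hz ⊢
        exact ⟨hz.1, hz.2.trans hyy'⟩
      · exact Finset.mem_filter.2 ⟨hy, hyy'⟩
      · simp
    have hsuppY : ∀ D : F₀, ∀ y ∈ supp (c D), y ∈ Y₀ := fun D y hy =>
      Finset.mem_biUnion.2 ⟨D, Finset.mem_univ _, hy⟩
    let len : Cnd → ℕ := Sum.elim (fun c => c.1) (fun _ => 0)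
    let col : ∀ c : Cnd, (Fin (len c) → ℕ) → Prop := fun c => match c with
      | Sum.inl c => fun v => (fun q => a (v q.1) q.2) ∈ c.2.1.1
      | Sum.inr _ => fun _ => True
    obtain ⟨g, hg⟩ := exists_homogeneous (fun D : F₀ => len (c D)) (fun D => col (c D))
    refine ⟨fun p => a (g (rank p.1)) p.2, fun D hD => ?_⟩
    have h1 := hg ⟨D, hD⟩
    have h2 := hsuppY ⟨D, hD⟩
    rw [← show S (c ⟨D, hD⟩) = D from hc ⟨D, hD⟩]
    generalize c ⟨D, hD⟩ = d at h1 h2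
    rcases d with d | p
    · have hs : StrictMono (rank ∘ d.2.2.1) := fun i j hij => hrank _ (h2 _ (by
        simp [supp])) _ (d.2.2.1.strictMono hij)
      have ht : StrictMono (rank ∘ d.2.2.2) := fun i j hij => hrank _ (h2 _ (by
        simp [supp])) _ (d.2.2.2.strictMono hij)
      exact h1 (OrderEmbedding.ofStrictMono _ hs) (OrderEmbedding.ofStrictMono _ ht)
    · obtain ⟨b, hb⟩ := ha (p.1.image fun y => g (rank y))
        {m | ∃ y ∈ p.1, y ∈ p.2 ∧ g (rank y) = m}
      refine ⟨b, fun y hy => (hb _ (Finset.mem_image_of_mem _ hy)).trans ?_⟩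
      constructor
      · rintro ⟨y', hy', hyp, he⟩
        have he' := g.injective he
        rcases lt_trichotomy y y' with h | h | h
        · exact absurd he' (hrank y (h2 y hy) y' h).ne'
        · rwa [h]
        · exact absurd he' (hrank y' (h2 y' hy') y h).ne
      · exact fun h => ⟨y, hy, h, rfl⟩)
  refine ⟨fun y l => x (y, l), ?_, ?_⟩
  · refine indiscernible_iff.2 fun n D hD s t => ?_
    exact hx _ ⟨Sum.inl ⟨n, ⟨D, hD⟩, s, t⟩, rfl⟩
  · intro W P
    exact hx _ ⟨Sum.inr (W, P), rfl⟩

/-- For each `n` the pattern is expressed by one sentence, so completeness moves it into `N`. -/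
theorem HasIP.exists_pattern {T : L.Theory} (hT : T.IsComplete) (hIP : HasIP T)
    (N : Theory.ModelType.{u, u, u} T) :
    ∃ (r s : ℕ) (φ : L.Formula (Fin r ⊕ Fin s)), ∀ n : ℕ,
      ∃ (a : Fin n → Fin r → N) (b : Set (Fin n) → Fin s → N),
        ∀ i w, φ.Realize (Sum.elim (a i) (b w)) ↔ i ∈ w := by
  classical
  obtain ⟨r, s, φ, h⟩ := hIP
  refine ⟨r, s, φ, fun n => ?_⟩
  obtain ⟨M, a, b, hab⟩ := h n
  let Z := (Fin n × Fin r) ⊕ (Set (Fin n) × Fin s)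
  let g : Fin n × Set (Fin n) → Fin r ⊕ Fin s → Empty ⊕ Z := fun p =>
    Sum.elim (fun l => Sum.inr (Sum.inl (p.1, l))) (fun l => Sum.inr (Sum.inr (p.2, l)))
  let ψ : L.Formula (Empty ⊕ Z) := Formula.iInf fun p : Fin n × Set (Fin n) =>
    if p.1 ∈ p.2 then φ.relabel (g p) else (φ.relabel (g p)).not
  let σ : L.Sentence := ψ.iExs Z
  have hreal : ∀ (K : Type u) [L.Structure K], K ⊨ σ ↔
      ∃ z : Z → K, ∀ i w, φ.Realize (Sum.elim (fun l => z (Sum.inl (i, l)))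
        (fun l => z (Sum.inr (w, l)))) ↔ i ∈ w := by
    intro K _
    simp only [Sentence.Realize, σ, Formula.realize_iExs, ψ, Formula.realize_iInf, Prod.forall]
    refine exists_congr fun z => forall₂_congr fun i w => ?_
    have : Sum.elim (default : Empty → K) z ∘ g (i, w) = Sum.elim (fun l => z (Sum.inl (i, l)))
        (fun l => z (Sum.inr (w, l))) := by
      funext l
      rcases l with l | l <;> rfl
    split_ifs with hiw
    · simp [Formula.realize_relabel, this, hiw]
    · simp [Formula.realize_relabel, this, hiw]
  have h1 : M ⊨ σ := (hreal M).2 ⟨Sum.elim (fun p => a p.1 p.2) (fun p => b p.1 p.2), hab⟩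
  have h2 : N ⊨ σ := (hT.realize_sentence_iff σ N).2 ((hT.realize_sentence_iff σ M).1 h1)
  obtain ⟨z, hz⟩ := (hreal N).1 h2
  exact ⟨_, _, hz⟩

end IndependentSequence

end Shredding

namespace Shredding

/-! ### Coherent decompositions from square -/

section Square

open Set

theorem isSuccLimit_of_mem_limPoints {C : Set Ordinal.{u}} {γ : Ordinal.{u}}
    (h : γ ∈ limPoints C) : Order.IsSuccLimit γ := by
  obtain ⟨-, h0, hlub⟩ := h
  refine ⟨fun h => h0 (by simpa using h), fun δ hδ => ?_⟩
  have : γ ≤ δ := hlub.2 fun x hx => by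
    by_contra hlt
    exact hδ.2 (not_le.1 hlt) hx.2
  exact absurd hδ.1 (not_lt.2 this)

theorem mem_limPoints_inter_Iio {C : Set Ordinal.{u}} {γ δ : Ordinal.{u}}
    (h : γ ∈ limPoints C) (hγδ : γ < δ) : γ ∈ limPoints (C ∩ Iio δ) := by
  refine ⟨⟨h.1, hγδ⟩, h.2.1, ?_⟩
  rw [inter_assoc, Iio_inter_Iio, min_eq_right hγδ.le]
  exact h.2.2

variable {C : Set Ordinal.{u}} {β : Ordinal.{u}}

theorem mem_of_isLUB_of_isClub (hC : IsClub ((↑) ⁻¹' C : Set (Iio β))) {t : Set Ordinal.{u}}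
    (ht : t ⊆ C) (hne : t.Nonempty) {x : Ordinal.{u}} (hx : IsLUB t x) (hxβ : x < β) : x ∈ C := by
  have hlt : ∀ y ∈ t, y < β := fun y hy => (hx.1 hy).trans_lt hxβ
  refine hC.isLUB_mem (t := (↑) ⁻¹' t) (x := ⟨x, hxβ⟩) (preimage_mono ht) ?_ ?_
  · obtain ⟨y, hy⟩ := hne
    exact ⟨⟨y, hlt y hy⟩, hy⟩
  · refine ⟨fun y hy => hx.1 hy, fun y hy => ?_⟩
    exact hx.2 fun z hz => hy (a := ⟨z, hlt z hz⟩) hz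

theorem exists_gt_of_isClub (hβ : Order.IsSuccLimit β)
    (hC : IsClub ((↑) ⁻¹' C : Set (Iio β))) {α : Ordinal.{u}} (hα : α < β) :
    ∃ γ ∈ C, α < γ ∧ γ < β := by
  obtain ⟨γ, hγ, hle⟩ := hC.isCofinal ⟨Order.succ α, hβ.succ_lt hα⟩
  exact ⟨γ, hγ, (Order.lt_succ α).trans_le hle, γ.2⟩

/-- Start at the last limit point (anywhere suitable if there is none) and climb through `C` for `ω`
steps: a supremum below `β` would be a further limit point. -/
theorem exists_cofinal_seq_of_isClub (hβ : Order.IsSuccLimit β)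
    (hC : IsClub ((↑) ⁻¹' C : Set (Iio β)))
    (hbdd : ∃ η < β, ∀ γ ∈ limPoints C, γ < η) :
    ∃ a : ℕ → Ordinal.{u}, StrictMono a ∧ (∀ n, a n < β) ∧ (∀ α < β, ∃ n, α ≤ a n) ∧
      (∀ γ ∈ limPoints C, γ ≤ a 0 ∧ a 0 ∈ limPoints C) := by
  obtain ⟨η, hη, hΛ⟩ := hbdd
  have hstart : ∃ a₀ < β, ∀ γ ∈ limPoints C, γ ≤ a₀ ∧ a₀ ∈ limPoints C := by
    rcases (limPoints C).eq_empty_or_nonempty with he | hne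
    · exact ⟨η, hη, by simp [he]⟩
    · have hlub : IsLUB (limPoints C) (sSup (limPoints C)) :=
        isLUB_csSup hne ⟨η, fun γ hγ => (hΛ γ hγ).le⟩
      have hlt : sSup (limPoints C) < β := (hlub.2 fun γ hγ => (hΛ γ hγ).le).trans_lt hη
      refine ⟨_, hlt, fun γ hγ => ⟨hlub.1 hγ, ?_⟩⟩
      by_contra hmem
      refine hmem ⟨mem_of_isLUB_of_isClub hC (fun x hx => hx.1) hne hlub hlt, ?_, ?_⟩
      · intro h0
        exact hγ.2.1 (le_antisymm (h0 ▸ hlub.1 hγ) (zero_le))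
      · refine ⟨fun x hx => hx.2.le, fun x hx => hlub.2 fun y hy => hx ⟨hy.1, ?_⟩⟩
        exact lt_of_le_of_ne (hlub.1 hy) (fun h => hmem (h ▸ hy))
  obtain ⟨a₀, ha₀, haΛ⟩ := hstart
  choose! nxt hnxtC hnxtlt hnxtβ using fun α (hα : α < β) => exists_gt_of_isClub hβ hC hα
  let a : ℕ → Ordinal.{u} := fun n => nxt^[n] a₀
  have hsucc : ∀ n, a (n + 1) = nxt (a n) := fun n => Function.iterate_succ_apply' _ _ _
  have haβ : ∀ n, a n < β := by
    intro n
    induction n with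
    | zero => exact ha₀
    | succ n ih =>
      rw [hsucc]
      exact hnxtβ _ ih
  have hmono : StrictMono a := strictMono_nat_of_lt_succ fun n => by
    rw [hsucc]
    exact hnxtlt _ (haβ n)
  have haC : ∀ n, a (n + 1) ∈ C := fun n => by
    rw [hsucc]
    exact hnxtC _ (haβ n)
  refine ⟨a, hmono, haβ, ?_, haΛ⟩
  by_contra! hcon
  obtain ⟨α, hα, hlt⟩ := hcon
  have hlub : IsLUB (range a) (sSup (range a)) :=
    isLUB_csSup (range_nonempty _) ⟨α, by rintro _ ⟨n, rfl⟩; exact (hlt n).le⟩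
  have hsβ : sSup (range a) < β := (hlub.2 (by rintro _ ⟨n, rfl⟩; exact (hlt n).le)).trans_lt hα
  have hlt' : ∀ n, a n < sSup (range a) := fun n =>
    (hmono n.lt_succ_self).trans_le (hlub.1 ⟨n + 1, rfl⟩)
  have hlub' : ∀ x, (∀ n, a (n + 1) ≤ x) → sSup (range a) ≤ x := fun x hx => hlub.2 (by
    rintro _ ⟨n, rfl⟩
    exact (hmono n.lt_succ_self).le.trans (hx n))
  have hmem : sSup (range a) ∈ limPoints C := by
    refine ⟨mem_of_isLUB_of_isClub hC (t := range fun n => a (n + 1)) ?_ (range_nonempty _)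
      ⟨?_, fun x hx => hlub' x fun n => hx ⟨n, rfl⟩⟩ hsβ, ?_, ⟨fun x hx => hx.2.le, ?_⟩⟩
    · rintro _ ⟨n, rfl⟩
      exact haC n
    · rintro _ ⟨n, rfl⟩
      exact (hlt' _).le
    · exact (zero_le.trans_lt (hlt' 0)).ne'
    · exact fun x hx => hlub' x fun n => hx ⟨haC n, hlt' _⟩
  exact absurd ((haΛ _ hmem).1) (not_le.2 (hlt' 0))

/-- Singularity makes the clause `|C α| < μ` of square apply to every limit `α < μ⁺`. -/
theorem cof_lt_of_isSingular {μ : Cardinal.{u}} (hμ : μ.IsSingular)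
    (hβ : β < (Order.succ μ).ord) : β.cof < μ := by
  have h1 : β.cof ≤ μ := by
    refine (Ordinal.cof_le_card β).trans ?_
    rw [← Order.lt_succ_iff]
    exact Cardinal.lt_ord.1 hβ
  refine lt_of_le_of_ne h1 fun h => ?_
  exact hμ.cof_ord_ne (by rw [← h, Ordinal.cof_ord_cof])

/-- The requirements on a decomposition `s` of `β` relative to the decompositions `f` of smaller
ordinals. -/
structure CoherentAt {J : Type u} [LinearOrder J] (mu : J → Cardinal.{u}) (β : Ordinal.{u})
    (f : Ordinal.{u} → J → Set Ordinal.{u}) (s : J → Set Ordinal.{u}) : Prop where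
  subset : ∀ j, s j ⊆ Iio β
  card : ∀ j, #(s j) ≤ Cardinal.lift.{u + 1} (mu j)
  mono : Monotone s
  covers : ∀ α < β, ∃ j, α ∈ s j
  coherent : ∀ j, ∀ α ∈ s j, f α j = s j ∩ Iio α

variable {J : Type u} [LinearOrder J] {mu : J → Cardinal.{u}}
  {f : Ordinal.{u} → J → Set Ordinal.{u}}

/-- The gluing step common to zero, successor and limit stages: by `hDcoh` the sets `insert γ (f γ
j)`, for `γ ∈ D j`, end-extend one another. -/
theorem coherentAt_biUnion (h0 : ∀ j, ℵ₀ ≤ mu j) (hf : ∀ γ < β, CoherentAt mu γ f (f γ))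
    {D : J → Set Ordinal.{u}} (hD : ∀ j, D j ⊆ Iio β) (hDmono : Monotone D)
    (hDcof : ∀ α < β, ∃ j, ∃ γ ∈ D j, α ≤ γ) (hDcoh : ∀ j, ∀ γ ∈ D j, ∀ γ' ∈ D j, γ < γ' → γ ∈ f γ' j)
    (hDcard : ∀ j, #(D j) ≤ Cardinal.lift.{u + 1} (mu j)) :
    CoherentAt mu β f (fun j => ⋃ γ ∈ D j, insert γ (f γ j)) where
  subset j α hα := by
    obtain ⟨γ, hγ, h⟩ := mem_iUnion₂.1 hα
    rcases h with rfl | h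
    · exact hD j hγ
    · have h1 : α < γ := (hf γ (hD j hγ)).subset j h
      have h2 : γ < β := hD j hγ
      exact h1.trans h2
  card j := by
    rw [biUnion_eq_iUnion]
    refine (mk_iUnion_le_sum_mk.trans (sum_le_mk_mul_iSup _)).trans ?_
    have h0' : ℵ₀ ≤ Cardinal.lift.{u + 1} (mu j) := by simpa using h0 j
    refine (mul_le_mul' (hDcard j) (ciSup_le' fun γ => ?_)).trans (mul_eq_self h0').le
    refine mk_insert_le.trans (add_le_of_le h0' ((hf γ (hD j γ.2)).card j) ?_)
    exact one_le_aleph0.trans h0'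
  mono := by
    intro j j' hjj' α hα
    obtain ⟨γ, hγ, h⟩ := mem_iUnion₂.1 hα
    refine mem_iUnion₂.2 ⟨γ, hDmono hjj' hγ, ?_⟩
    rcases h with rfl | h
    · exact mem_insert _ _
    · exact mem_insert_of_mem _ ((hf γ (hD j hγ)).mono hjj' h)
  covers := by
    intro α hα
    obtain ⟨j, γ, hγ, hle⟩ := hDcof α hα
    rcases hle.eq_or_lt with rfl | hlt
    · exact ⟨j, mem_iUnion₂.2 ⟨α, hγ, mem_insert _ _⟩⟩
    · obtain ⟨j', hj'⟩ := (hf γ (hD j hγ)).covers α hlt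
      exact ⟨max j j', mem_iUnion₂.2 ⟨γ, hDmono (le_max_left _ _) hγ,
        mem_insert_of_mem _ ((hf γ (hD j hγ)).mono (le_max_right _ _) hj')⟩⟩
  coherent := by
    intro j α hα
    obtain ⟨γ, hγ, hαγ⟩ := mem_iUnion₂.1 hα
    have hγβ := hD j hγ
    have hle : α ≤ γ := by
      rcases hαγ with rfl | h
      · exact le_rfl
      · exact ((hf γ hγβ).subset j h).le
    have h1 : f α j = f γ j ∩ Iio α := by
      rcases hαγ with rfl | h
      · exact (inter_eq_left.2 ((hf α hγβ).subset j)).symm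
      · exact (hf γ hγβ).coherent j α h
    rw [h1]
    ext δ
    constructor
    · rintro ⟨h2, h3⟩
      exact ⟨mem_iUnion₂.2 ⟨γ, hγ, mem_insert_of_mem _ h2⟩, h3⟩
    · rintro ⟨h2, h3⟩
      refine ⟨?_, h3⟩
      obtain ⟨γ', hγ', hδ⟩ := mem_iUnion₂.1 h2
      rcases lt_trichotomy γ' γ with h | rfl | h
      · have h4 := hDcoh j γ' hγ' γ hγ h
        rcases hδ with rfl | hδ
        · exact h4
        · rw [(hf γ hγβ).coherent j γ' h4] at hδ
          exact hδ.1
      · rcases hδ with rfl | hδ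
        · exact absurd hle (not_le.2 h3)
        · exact hδ
      · have h4 := hDcoh j γ hγ γ' hγ' h
        rcases hδ with rfl | hδ
        · exact absurd (h3.trans_le hle) (not_lt.2 h.le)
        · rw [(hf γ' (hD j hγ')).coherent j γ h4]
          exact ⟨hδ, h3.trans_le hle⟩

/-- The recursion carries an extra clause: limit points of `C β` belong to `S β j` once `|C β| ≤ mu
j`. For a limit point `γ'` of `C β`, the set `C γ' = C β ∩ γ'` is no larger, so the clause at `γ'`
makes the limit points of `C β` mutually coherent at these levels. -/
theorem exists_coherent_decomposition {μ : Cardinal.{u}} (hμ : μ.IsSingular) (hsq : Square μ)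
    [Nonempty J] (h0 : ∀ j, ℵ₀ ≤ mu j) (hmono : Monotone mu) (hcof : ∀ ν < μ, ∃ j, ν ≤ mu j) :
    ∃ S : Ordinal.{u} → J → Set Ordinal.{u}, ∀ β < (Order.succ μ).ord, CoherentAt mu β S (S β) := by
  classical
  obtain ⟨C, hC⟩ := hsq
  suffices H : ∃ S : Ordinal.{u} → J → Set Ordinal.{u}, ∀ β, β < (Order.succ μ).ord →
      CoherentAt mu β S (S β) ∧ (Order.IsSuccLimit β → ∀ γ ∈ limPoints (C β), ∀ j,
        #(C β) ≤ Cardinal.lift.{u + 1} (mu j) → γ ∈ S β j) by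
    obtain ⟨S, hS⟩ := H
    exact ⟨S, fun β hβ => (hS β hβ).1⟩
  obtain ⟨S, hS⟩ := exists_transfinite_choice (ι := Ordinal.{u}) (S := J → Set Ordinal.{u})
    (fun β f s => β < (Order.succ μ).ord →
      CoherentAt mu β (fun γ => if h : γ < β then f ⟨γ, h⟩ else fun _ => ∅) s ∧
      (Order.IsSuccLimit β → ∀ γ ∈ limPoints (C β), ∀ j,
        #(C β) ≤ Cardinal.lift.{u + 1} (mu j) → γ ∈ s j)) (by
    intro β f hf
    by_cases hβ : β < (Order.succ μ).ord
    swap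
    · exact ⟨fun _ => ∅, fun h => absurd h hβ⟩
    have hf1 : ∀ γ < β, CoherentAt mu γ f (f γ) := by
      intro γ hγ
      have h := (hf γ hγ (hγ.trans hβ)).1
      refine ⟨h.subset, h.card, h.mono, h.covers, fun j α hα => ?_⟩
      have := h.coherent j α hα
      rwa [dif_pos (show α < γ from h.subset j hα)] at this
    have hf2 := fun γ (hγ : γ < β) => (hf γ hγ (hγ.trans hβ)).2
    suffices H : ∃ s, CoherentAt mu β f s ∧ (Order.IsSuccLimit β → ∀ γ ∈ limPoints (C β), ∀ j,
        #(C β) ≤ Cardinal.lift.{u + 1} (mu j) → γ ∈ s j) by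
      obtain ⟨s, h, h'⟩ := H
      refine ⟨s, fun _ => ⟨⟨h.subset, h.card, h.mono, h.covers, fun j α hα => ?_⟩, h'⟩⟩
      rw [dif_pos (show α < β from h.subset j hα)]
      exact h.coherent j α hα
    have hsingle : ∀ γ j, #({γ} : Set Ordinal.{u}) ≤ Cardinal.lift.{u + 1} (mu j) := by
      intro γ j
      rw [mk_singleton]
      exact one_le_aleph0.trans (by simpa using h0 j)
    rcases Ordinal.zero_or_succ_or_isSuccLimit β with rfl | ⟨γ, rfl⟩ | hlim
    · refine ⟨_, coherentAt_biUnion h0 hf1 (D := fun _ => ∅) (by simp) monotone_const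
        (fun α hα => absurd hα not_lt_zero) (by simp) (by simp), fun h => ?_⟩
      exact absurd h (by simp)
    · refine ⟨_, coherentAt_biUnion h0 hf1 (D := fun _ => {γ}) (by simp) monotone_const
        (fun α hα => ⟨Classical.arbitrary J, γ, rfl, Order.lt_succ_iff.1 hα⟩) ?_
        (hsingle γ), fun h => ?_⟩
      · rintro j _ rfl _ rfl h
        exact absurd h (lt_irrefl _)
      · exact absurd h (Order.not_isSuccLimit_succ _)
    · obtain ⟨hCβ, hclub, hcoh, hcard⟩ := hC β hβ hlim
      have hcard' := hcard (cof_lt_of_isSingular hμ hβ)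
      obtain ⟨ν, hν⟩ := Cardinal.mem_range_lift_of_le hcard'.le
      obtain ⟨j₀, hj₀⟩ : ∃ j₀, #(C β) ≤ Cardinal.lift.{u + 1} (mu j₀) := by
        rw [← hν, Cardinal.lift_lt] at hcard'
        obtain ⟨j, hj⟩ := hcof ν hcard'
        exact ⟨j, by rw [← hν]; exact Cardinal.lift_le.2 hj⟩
      have hlow : ∀ γ' ∈ limPoints (C β), ∀ γ ∈ limPoints (C β), γ < γ' → ∀ j,
          #(C β) ≤ Cardinal.lift.{u + 1} (mu j) → γ ∈ f γ' j := by
        intro γ' hγ' γ hγ hlt j hj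
        have h1 := hcoh γ' hγ'
        refine hf2 γ' (hCβ hγ'.1) (isSuccLimit_of_mem_limPoints hγ') γ ?_ j ?_
        · rw [h1]
          exact mem_limPoints_inter_Iio hγ hlt
        · rw [h1]
          exact (mk_le_mk_of_subset inter_subset_left).trans hj
      -- If the limit points are cofinal, they span `β` by themselves; levels with `mu j < |C β|`
      -- receive nothing.
      by_cases hunb : ∀ α < β, ∃ γ ∈ limPoints (C β), α ≤ γ
      · refine ⟨_, coherentAt_biUnion h0 hf1
          (D := fun j => {γ ∈ limPoints (C β) | #(C β) ≤ Cardinal.lift.{u + 1} (mu j)})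
          (fun j γ hγ => hCβ hγ.1.1) ?_ ?_ ?_ ?_, ?_⟩
        · exact fun j j' hjj' γ hγ => ⟨hγ.1, hγ.2.trans (Cardinal.lift_le.2 (hmono hjj'))⟩
        · intro α hα
          obtain ⟨γ, hγ, hle⟩ := hunb α hα
          exact ⟨j₀, γ, ⟨hγ, hj₀⟩, hle⟩
        · exact fun j γ hγ γ' hγ' hlt => hlow γ' hγ'.1 γ hγ.1 hlt j hγ.2
        · intro j
          by_cases hj : #(C β) ≤ Cardinal.lift.{u + 1} (mu j)
          · exact (mk_le_mk_of_subset fun γ hγ => hγ.1.1).trans hj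
          · simp [hj]
        · exact fun _ γ hγ j hj => mem_iUnion₂.2 ⟨γ, ⟨hγ, hj⟩, mem_insert _ _⟩
      · push Not at hunb
        obtain ⟨a, hamono, haβ, hacof, haΛ⟩ := exists_cofinal_seq_of_isClub hlim hclub hunb
        have hjoin : ∀ j n, (∀ m < n, a m ∈ f (a (m + 1)) j) → ∀ m < n, a m ∈ f (a n) j := by
          intro j n
          induction n with
          | zero => exact fun _ m hm => absurd hm (Nat.not_lt_zero m)
          | succ n ih =>
            intro h m hm
            rcases (Nat.lt_succ_iff.1 hm).eq_or_lt with rfl | hlt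
            · exact h m hm
            · have h1 := ih (fun m hm => h m (hm.trans n.lt_succ_self)) m hlt
              rw [(hf1 _ (haβ (n + 1))).coherent j _ (h n n.lt_succ_self)] at h1
              exact h1.1
        -- The `ω`-sequence need not be coherent at a given level, so `a n` is admitted at level `j`
        -- only if every step up to it is visible there. Each `a n` qualifies from some level on, as
        -- only finitely many steps precede it.
        refine ⟨_, coherentAt_biUnion h0 hf1 (D := fun j => {γ | #(C β) ≤ Cardinal.lift.{u + 1} (mu j) ∧
          ∃ n, γ = a n ∧ ∀ m < n, a m ∈ f (a (m + 1)) j}) ?_ ?_ ?_ ?_ ?_, ?_⟩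
        · rintro j _ ⟨-, n, rfl, -⟩
          exact haβ n
        · rintro j j' hjj' _ ⟨h1, n, rfl, h2⟩
          exact ⟨h1.trans (Cardinal.lift_le.2 (hmono hjj')), n, rfl,
            fun m hm => (hf1 _ (haβ _)).mono hjj' (h2 m hm)⟩
        · intro α hα
          obtain ⟨n, hn⟩ := hacof α hα
          choose i hi using fun m : ℕ => (hf1 _ (haβ (m + 1))).covers (a m) (hamono m.lt_succ_self)
          obtain ⟨j, hj⟩ := (insert j₀ ((Finset.range n).image i)).exists_le
          refine ⟨j, a n, ⟨hj₀.trans (Cardinal.lift_le.2 (hmono (hj j₀ (by simp)))), n, rfl,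
            fun m hm => (hf1 _ (haβ _)).mono (hj (i m) ?_) (hi m)⟩, hn⟩
          exact Finset.mem_insert_of_mem (Finset.mem_image_of_mem _ (Finset.mem_range.2 hm))
        · rintro j _ ⟨-, n, rfl, -⟩ _ ⟨-, n', rfl, h⟩ hlt
          exact hjoin j n' h n (hamono.lt_iff_lt.1 hlt)
        · intro j
          have h1 : ({γ | #(C β) ≤ Cardinal.lift.{u + 1} (mu j) ∧
            ∃ n, γ = a n ∧ ∀ m < n, a m ∈ f (a (m + 1)) j}).Countable :=
            (countable_range a).mono (by rintro _ ⟨-, n, rfl, -⟩; exact ⟨n, rfl⟩)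
          exact h1.le_aleph0.trans (by simpa using h0 j)
        · intro _ γ hγ j hj
          obtain ⟨hle, ha0⟩ := haΛ γ hγ
          refine mem_iUnion₂.2 ⟨a 0, ⟨hj, 0, rfl, fun m hm => absurd hm (Nat.not_lt_zero m)⟩, ?_⟩
          rcases hle.eq_or_lt with h | h
          · rw [h]
            exact mem_insert _ _
          · exact mem_insert_of_mem _ (hlow _ ha0 γ hγ h j hj))
  refine ⟨S, fun β hβ => ?_⟩
  obtain ⟨h, h'⟩ := hS β hβ
  refine ⟨⟨h.subset, h.card, h.mono, h.covers, fun j α hα => ?_⟩, h'⟩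
  have := h.coherent j α hα
  rwa [dif_pos (show α < β from h.subset j hα)] at this

end Square

end Shredding

namespace Shredding

/-! ### From arbitrary elementary extensions back to the saturated model -/

section Transfer

open Set

variable {L : FirstOrder.Language.{u, u}} {N : Type u} [L.Structure N]

theorem FamilySaturated.exists_mem_sInter {μ : Cardinal.{u}} (hN : FamilySaturated L N μ)
    (hμ : ℵ₀ ≤ μ) {X : Type*} [Finite X] (A : Set N) (F : Set (Set (X → N))) (hA : #A ≤ μ)
    (hF : ∀ D ∈ F, A.Definable L D)
    (hfin : ∀ F₀ : Set (Set (X → N)), F₀.Finite → F₀ ⊆ F → (⋂₀ F₀).Nonempty) :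
    (⋂₀ F).Nonempty := by
  obtain ⟨n, ⟨e₀⟩⟩ := Finite.exists_equiv_fin X
  let e : X ≃ ULift.{u} (Fin n) := e₀.trans Equiv.ulift.symm
  let pre : Set (X → N) → Set (ULift.{u} (Fin n) → N) := fun D => {y | y ∘ e ∈ D}
  obtain ⟨y, hy⟩ := hN (ULift.{u} (Fin n)) A (pre '' F) hA (mk_le_aleph0.trans hμ) (by
    rintro _ ⟨D, hD, rfl⟩
    exact (hF D hD).preimage_comp e) (by
    intro F₀ hF₀ hsub
    obtain ⟨G, hGF, hGfin, rfl⟩ := exists_subset_image_finite_and.1 ⟨F₀, hsub, hF₀, rfl⟩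
    obtain ⟨x, hx⟩ := hfin G hGfin hGF
    refine ⟨x ∘ e.symm, ?_⟩
    rintro _ ⟨D, hD, rfl⟩
    simpa [pre, Function.comp_assoc] using hx D hD)
  exact ⟨y ∘ e, fun D hD => hy _ ⟨D, hD, rfl⟩⟩

/-- Shredding refers to tuples of all elementary extensions. Saturation replaces such a tuple by one
of `N` with the same type over `P`, so only tuples of `N` need be examined. -/
theorem exists_pullback {μ : Cardinal.{u}} (hN : FamilySaturated L N μ) (hμ : ℵ₀ ≤ μ)
    {N' : Type u} [L.Structure N'] (f : N ↪ₑ[L] N') {m : ℕ} (c : Fin m → N') (P : Set N)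
    (hP : #P ≤ μ) : ∃ c₀ : Fin m → N, ∀ ψ : L.Formula (P ⊕ Fin m),
      ψ.Realize (Sum.elim (fun p => f p) c) ↔ ψ.Realize (Sum.elim (↑) c₀) := by
  let S : L.Formula (P ⊕ Fin m) → Set (Fin m → N) := fun ψ => {v | ψ.Realize (Sum.elim (↑) v)}
  obtain ⟨c₀, hc₀⟩ := hN.exists_mem_sInter hμ P
    (S '' {ψ | ψ.Realize (Sum.elim (fun p => f p) c)}) hP (by
    rintro _ ⟨ψ, -, rfl⟩
    exact definable_iff_exists_formula_sum.2 ⟨ψ, rfl⟩) (by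
    intro F₀ hF₀ hsub
    obtain ⟨G, hG, hGfin, rfl⟩ := exists_subset_image_finite_and.1 ⟨F₀, hsub, hF₀, rfl⟩
    have : Finite G := hGfin
    let χ : L.Formula P := (Formula.iInf fun ψ : G => ψ.1).iExs (Fin m)
    have h1 : χ.Realize (f ∘ ((↑) : P → N)) := by
      simp only [χ, Formula.realize_iExs, Formula.realize_iInf]
      exact ⟨c, fun ψ => hG ψ.2⟩
    rw [f.map_formula] at h1
    simp only [χ, Formula.realize_iExs, Formula.realize_iInf] at h1
    obtain ⟨v, hv⟩ := h1
    refine ⟨v, ?_⟩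
    rintro _ ⟨ψ, hψ, rfl⟩
    exact hv ⟨ψ, hψ⟩)
  have key : ∀ ψ : L.Formula (P ⊕ Fin m), ψ.Realize (Sum.elim (fun p => f p) c) →
      ψ.Realize (Sum.elim (↑) c₀) := fun ψ hψ => hc₀ _ ⟨ψ, hψ, rfl⟩
  refine ⟨c₀, fun ψ => ⟨key ψ, fun h => ?_⟩⟩
  by_contra hn
  exact (key ψ.not hn) h

theorem indiscernible_pullback {N' : Type u} [L.Structure N'] (f : N ↪ₑ[L] N') {m k : ℕ}
    {c : Fin m → N'} {c₀ : Fin m → N} {P A : Set N} (hAP : A ⊆ P)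
    (hc : ∀ ψ : L.Formula (P ⊕ Fin m),
      ψ.Realize (Sum.elim (fun p => f p) c) ↔ ψ.Realize (Sum.elim (↑) c₀))
    {ι : Type*} [LinearOrder ι] {b : ι → Fin k → N} (hb : ∀ i j, b i j ∈ P)
    (h : Indiscernible (L := L) (f '' A ∪ range c) (fun i j => f (b i j))) :
    Indiscernible (L := L) (A ∪ range c₀) b := by
  rw [indiscernible_union_range_iff] at h ⊢
  intro n D hD s t
  obtain ⟨χ, rfl⟩ := definable_iff_exists_formula_sum.1 hD
  let g : (Fin n ↪o ι) → A ⊕ (Fin m ⊕ Fin n × Fin k) → P ⊕ Fin m := fun s =>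
    Sum.elim (fun a => Sum.inl ⟨a, hAP a.2⟩)
      (Sum.elim Sum.inr (fun q => Sum.inl ⟨b (s q.1) q.2, hb _ _⟩))
  let D' : Set (Fin m ⊕ Fin n × Fin k → N') := {v | χ.Realize (Sum.elim (fun a => f a) v)}
  have hD' : (f '' A).Definable L D' := by
    refine definable_iff_exists_formula_sum.2
      ⟨χ.relabel (Sum.map (fun a : A => ⟨f a, mem_image_of_mem f a.2⟩) id), ?_⟩
    ext v
    simp only [D', mem_ofPred_eq, Formula.realize_relabel]
    have : Sum.elim ((↑) : (f '' A) → N') v ∘ Sum.map (fun a : A => ⟨f a, mem_image_of_mem f a.2⟩) id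
        = Sum.elim (fun a : A => f a) v := by
      funext z
      rcases z with z | z <;> rfl
    rw [this]
  have key : ∀ s : Fin n ↪o ι, Sum.elim c (fun q => f (b (s q.1) q.2)) ∈ D' ↔
      Sum.elim c₀ (fun q => b (s q.1) q.2) ∈
        {v : Fin m ⊕ Fin n × Fin k → N | χ.Realize (Sum.elim (↑) v)} := by
    intro s
    have h1 := hc (χ.relabel (g s))
    simp only [Formula.realize_relabel] at h1
    have e1 : Sum.elim (fun p : P => f p) c ∘ g s =
        Sum.elim (fun a : A => f a) (Sum.elim c (fun q => f (b (s q.1) q.2))) := by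
      funext z
      rcases z with z | z | z <;> rfl
    have e2 : Sum.elim ((↑) : P → N) c₀ ∘ g s =
        Sum.elim ((↑) : A → N) (Sum.elim c₀ (fun q => b (s q.1) q.2)) := by
      funext z
      rcases z with z | z | z <;> rfl
    rw [e1, e2] at h1
    exact h1
  rw [← key, ← key]
  exact h n D' hD' s t

theorem realize_constantsVarsEquiv_symm {B : Type u} {m : ℕ} {K : Type u} [L.Structure K] (g : B → K)
    (ψ : L.Formula (B ⊕ Fin m)) (v : Fin m → K) :
    (letI : (constantsOn B).Structure K := constantsOn.structure g;
      Formula.Realize (L := L[[B]])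
        (BoundedFormula.constantsVarsEquiv.symm ψ : L[[B]].Formula (Fin m)) v) ↔
      ψ.Realize (Sum.elim g v) := by
  let _ : (constantsOn B).Structure K := constantsOn.structure g
  have h := BoundedFormula.realize_constantsVarsEquiv (L := L) (M := K)
    (φ := (BoundedFormula.constantsVarsEquiv.symm ψ : L[[B]].Formula (Fin m))) (v := v)
    (xs := (default : Fin 0 → K))
  rw [Equiv.apply_symm_apply] at h
  exact h.symm

theorem implies_restrictTo [Nonempty N] {B B' : Set N} (hB : B' ⊆ B) {m r : ℕ} (c : Fin m → N)
    (φ : L.Formula (Fin r ⊕ Fin m)) (a : Fin r → N) (ha : ∀ i, a i ∈ B')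
    (hφ : φ.Realize (Sum.elim a c)) :
    Implies (restrictTo ((L[[B]].completeTheory N).typeOf c) B') φ a := by
  intro N' _ f c' hc'
  let ψ : L.Formula (B' ⊕ Fin m) := φ.relabel (Sum.map (fun i => ⟨a i, ha i⟩) id)
  let θ : L[[B']].Formula (Fin m) := BoundedFormula.constantsVarsEquiv.symm ψ
  have h1 : θ ∈ restrictTo ((L[[B]].completeTheory N).typeOf c) B' := by
    refine ⟨hB, ?_⟩
    rw [Theory.CompleteType.formula_mem_typeOf, LHom.realize_onFormula]
    have h2 := (realize_constantsVarsEquiv_symm (fun b : B' => (b : N)) ψ c).2 (by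
      rw [Formula.realize_relabel]
      convert hφ using 1
      funext z
      rcases z with z | z <;> rfl)
    exact h2
  have h3 := (realize_constantsVarsEquiv_symm (fun b : B' => f b) ψ c').1 (hc' θ h1)
  rw [Formula.realize_relabel] at h3
  convert h3 using 1
  funext z
  rcases z with z | z <;> rfl

theorem definable_exists_fin {A : Set N} {m : ℕ} {D : Set (Fin m → N)} (hD : A.Definable L D) :
    ∃ (r : ℕ) (φ : L.Formula (Fin r ⊕ Fin m)) (a : Fin r → N), (∀ i, a i ∈ A) ∧
      D = {v | φ.Realize (Sum.elim a v)} := by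
  obtain ⟨A₀, hA₀, h⟩ := definable_iff_finitely_definable.1 hD
  obtain ⟨φ, rfl⟩ := definable_iff_exists_formula_sum.1 h
  let e := A₀.equivFin
  refine ⟨A₀.card, φ.relabel (Sum.map e id), fun i => (e.symm i : N),
    fun i => hA₀ (e.symm i).2, ?_⟩
  ext v
  simp only [mem_ofPred_eq, Formula.realize_relabel]
  have : Sum.elim (fun i => (e.symm i : N)) v ∘ Sum.map e id = Sum.elim (↑) v := by
    funext z
    rcases z with z | z
    · simp
    · rfl
  rw [this]
  rfl

theorem definable_realize {A : Set N} {m r : ℕ} (φ : L.Formula (Fin r ⊕ Fin m)) {a : Fin r → N}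
    (ha : ∀ i, a i ∈ A) : A.Definable L {v : Fin m → N | φ.Realize (Sum.elim a v)} :=
  definable_preimage_elim_const (D := {w | φ.Realize w})
    ((empty_definable_iff.2 ⟨φ, rfl⟩).mono (empty_subset _)) ha

end Transfer

end Shredding

namespace Shredding

/-! ### Pigeonhole and block sequences in regular cardinals -/

section Order

open Set

theorem exists_fiber_unbounded {κ : Cardinal.{u}} (hκ : κ.IsRegular) {Y : Type u} (hY : #Y < κ)
    (f : κ.ord.ToType → Y) : ∃ y, ∀ γ, ∃ δ, γ ≤ δ ∧ f δ = y := by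
  by_contra! h
  choose g hg using h
  obtain ⟨b, hb⟩ := bddAbove_of_mk_lt hκ (s := range g) (mk_range_le.trans_lt hY)
  exact hg (f b) b (hb _ (mem_range_self _)).le rfl

/-- The size of `H` makes its order type at least `κ.ord`; if it were longer, some proper initial
segment would have size `κ`. -/
theorem exists_orderEmbedding_range_eq {κ : Cardinal.{u}} {Λ : Type u} [LinearOrder Λ]
    [WellFoundedLT Λ] (H : Set Λ) (hH : κ ≤ #H) (hlt : ∀ x : H, #(Iio x) < κ) :
    ∃ h : κ.ord.ToType ↪o Λ, range h = H := by
  have hle : κ.ord ≤ Ordinal.type ((· < ·) : H → H → Prop) := by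
    rw [Cardinal.ord_le]
    simpa using hH
  have heq : Ordinal.type ((· < ·) : κ.ord.ToType → κ.ord.ToType → Prop) =
      Ordinal.type ((· < ·) : H → H → Prop) := by
    rw [Ordinal.type_toType]
    refine hle.antisymm (not_lt.1 fun h => ?_)
    obtain ⟨x, hx⟩ := Ordinal.typein_surj ((· < ·) : H → H → Prop) h
    have h1 := congrArg Ordinal.card hx
    rw [Cardinal.card_ord] at h1
    have h2 : Ordinal.card (Ordinal.typein ((· < ·) : H → H → Prop) x) = #(Iio x) := rfl
    exact (hlt x).ne (h2.symm.trans h1)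
  obtain ⟨e⟩ := Ordinal.type_eq.1 heq
  refine ⟨(OrderIso.ofRelIsoLT e).toOrderEmbedding.trans (OrderEmbedding.subtype _), ?_⟩
  ext x
  constructor
  · rintro ⟨i, rfl⟩
    exact (e i).2
  · intro hx
    exact ⟨e.symm ⟨x, hx⟩, by simp⟩

/-- From unboundedly many good finite sets in a regular cardinal one can extract a block sequence
of any infinite length below it. -/
theorem exists_orderEmbedding_blocks {κ κ' : Cardinal.{u}} (hκ : ℵ₀ < κ) (hκκ' : κ ≤ κ')
    (hκ' : κ'.IsRegular) {P : Finset κ'.ord.ToType → Prop}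
    (hP : ∀ γ, ∃ U : Finset κ'.ord.ToType, P U ∧ U.Nonempty ∧ ∀ x ∈ U, γ ≤ x) :
    ∃ h : κ.ord.ToType ↪o κ'.ord.ToType, ∀ α, (∃ U, P U ∧ (U : Set κ'.ord.ToType) ⊆ h '' Ici α) ∧
      ∃ U, P U ∧ h α ∈ U := by
  classical
  have hcard : ∀ (η : κ.ord.ToType) (f : κ.ord.ToType → Finset κ'.ord.ToType),
      #(⋃ ζ : Iic η, (f ζ : Set κ'.ord.ToType) : Set κ'.ord.ToType) < κ := by
    intro η f
    have h1 : #(Iic η) < κ := by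
      have : Iic η = insert η (Iio η) := by
        ext
        simp [le_iff_eq_or_lt]
      rw [this]
      exact (mk_insert_le).trans_lt (add_lt_of_lt hκ.le (mk_Iio_ord_toType_lt η)
        (one_lt_aleph0.trans hκ))
    refine (mk_iUnion_le_of_le (κ := max ℵ₀ #(Iic η)) (le_max_left _ _) (le_max_right _ _)
      fun ζ => ?_).trans_lt (max_lt hκ h1)
    exact (lt_aleph0_of_finite _).le.trans (le_max_left _ _)
  obtain ⟨U, hU⟩ := exists_transfinite_choice (ι := κ.ord.ToType)
    (S := Finset κ'.ord.ToType) (fun η f U => P U ∧ U.Nonempty ∧ ∀ ζ, ∀ x ∈ f ζ, ∀ y ∈ U, x < y) (by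
    intro η f _
    obtain ⟨b, hb⟩ := bddAbove_of_mk_lt hκ' ((hcard η f).trans_le hκκ')
    obtain ⟨U, hU, hne, hbU⟩ := hP b
    exact ⟨U, hU, hne, fun ζ x hx y hy =>
      (hb x (mem_iUnion.2 ⟨⟨ζ, (mem_Iio.1 ζ.2).le⟩, hx⟩)).trans_le (hbU y hy)⟩)
  have hlt : ∀ ζ η, ζ < η → ∀ x ∈ U ζ, ∀ y ∈ U η, x < y := fun ζ η h => (hU η).2.2 ⟨ζ, h⟩
  have hle : ∀ {ζ η x y}, x ∈ U ζ → y ∈ U η → x ≤ y → ζ ≤ η := fun hx hy hxy =>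
    not_lt.1 fun h => (hlt _ _ h _ hy _ hx).not_ge hxy
  let H : Set κ'.ord.ToType := ⋃ η, (U η : Set κ'.ord.ToType)
  have hUH : ∀ η, (U η : Set κ'.ord.ToType) ⊆ H := subset_iUnion _
  obtain ⟨h, hh⟩ := exists_orderEmbedding_range_eq (κ := κ) H (by
    choose m hm using fun η => (hU η).2.1
    have hinj : Function.Injective fun η => (⟨m η, hUH η (hm η)⟩ : H) := by
      intro ζ η h
      have h' : m ζ = m η := congrArg Subtype.val h
      exact (hle (hm ζ) (hm η) h'.le).antisymm (hle (hm η) (hm ζ) h'.ge)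
    simpa using mk_le_of_injective hinj) (by
    rintro ⟨x, hx⟩
    obtain ⟨η, hη⟩ := mem_iUnion.1 hx
    refine lt_of_le_of_lt ?_ (hcard η U)
    refine mk_le_of_injective (f := fun y : Iio (⟨x, hx⟩ : H) => ⟨y.1.1, ?_⟩) ?_
    · obtain ⟨ζ, hζ⟩ := mem_iUnion.1 y.1.2
      exact mem_iUnion.2 ⟨⟨ζ, hle hζ hη (le_of_lt y.2)⟩, hζ⟩
    · intro y z hyz
      exact Subtype.ext (Subtype.ext (Subtype.mk.inj hyz)))
  refine ⟨h, fun α => ?_⟩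
  have hα : h α ∈ H := hh ▸ mem_range_self α
  obtain ⟨η, hη⟩ := mem_iUnion.1 hα
  have : NoMaxOrder κ.ord.ToType := Cardinal.noMaxOrder hκ.le
  -- The block containing `h α` may begin below `h α`, but any later block lies wholly above it.
  obtain ⟨ζ, hζ⟩ := exists_gt η
  refine ⟨⟨U ζ, (hU ζ).1, fun x hx => ?_⟩, U η, (hU η).1, hη⟩
  obtain ⟨i, rfl⟩ : x ∈ range h := hh ▸ hUH ζ hx
  exact ⟨i, h.le_iff_le.1 (hlt η ζ hζ _ hη _ hx).le, rfl⟩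

end Order

/-! ### Bad sets, and shredding witnesses of prescribed length -/

section Shorten

open Set

variable {L : FirstOrder.Language.{u, u}} {N : Type u} [L.Structure N]

/-- No end segment of `b` is indiscernible over `A` together with an element of `D`. -/
def Bad (L : FirstOrder.Language.{u, u}) [L.Structure N] {Λ : Type u} [LinearOrder Λ] {k m : ℕ}
    (A : Set N) (b : Λ → Fin k → N) (D : Set (Fin m → N)) : Prop :=
  ∀ γ : Λ, ∀ c ∈ D, ¬ Indiscernible (L := L) (A ∪ range c) (fun i : Ici γ => b i)

/-- By compactness, finitely many indiscernibility conditions beyond `γ` already fail between them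
at every point of `D`. The sets `e` and `U` collect their parameters and indices. -/
theorem Bad.exists_finite {μ : Cardinal.{u}} (hN : FamilySaturated L N μ) (hμ : ℵ₀ ≤ μ) {Λ : Type u}
    [LinearOrder Λ] (hΛ : #Λ ≤ μ) {k m : ℕ} {A : Set N} (hA : #A ≤ μ) {b : Λ → Fin k → N}
    {D : Set (Fin m → N)} {B : Set N} (hB : #B ≤ μ) (hD : B.Definable L D) (h : Bad L A b D)
    (γ : Λ) : ∃ (e : Finset A) (U : Finset Λ), U.Nonempty ∧ (∀ x ∈ U, γ ≤ x) ∧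
      ∀ H : Set Λ, ↑U ⊆ H → ∀ c ∈ D,
        ¬ Indiscernible (L := L) (((↑) '' (e : Set A) : Set N) ∪ range c) (fun i : H => b i) := by
  classical
  let Cnd := IndCond L A (Fin m) (Ici γ) k
  let hold : Cnd → Set (Fin m → N) := fun c => c.holds fun i => b i
  let P : Set N := A ∪ B ∪ ⋃ i, range (b i)
  have hP : #P ≤ μ := mk_union_le_of_le hμ (mk_union_le_of_le hμ hA hB)
    (mk_iUnion_le_of_le hμ hΛ fun i => (lt_aleph0_of_finite _).le.trans hμ)
  obtain ⟨C, hC⟩ : ∃ C : Finset Cnd, ∀ v ∈ D, ∃ c ∈ C, v ∉ hold c := by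
    by_contra! hcon
    obtain ⟨v, hv⟩ := hN.exists_mem_sInter hμ P (insert D (range hold)) hP (by
      rintro _ (rfl | ⟨c, rfl⟩)
      · exact hD.mono (subset_union_right.trans subset_union_left)
      · exact c.definable_holds (subset_union_left.trans subset_union_left)
          fun i j => Or.inr (mem_iUnion.2 ⟨i, mem_range_self _⟩)) (by
      intro F₀ hF₀ hsub
      obtain ⟨G, hG⟩ : ∃ G : Finset Cnd, ∀ E ∈ F₀, E ≠ D → ∃ c ∈ G, E = hold c := by
        have h1 : (F₀ \ {D}) ⊆ range hold := fun E hE => (hsub hE.1).resolve_left hE.2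
        obtain ⟨G, -, hGfin, hG⟩ := exists_subset_image_finite_and.1
          ⟨F₀ \ {D}, by rwa [image_univ], hF₀.subset sdiff_subset, rfl⟩
        refine ⟨hGfin.toFinset, fun E hE hne => ?_⟩
        obtain ⟨c, hc, rfl⟩ : E ∈ hold '' G := hG ▸ ⟨hE, hne⟩
        exact ⟨c, hGfin.mem_toFinset.2 hc, rfl⟩
      obtain ⟨v, hvD, hv⟩ := hcon G
      refine ⟨v, fun E hE => ?_⟩
      by_cases hED : E = D
      · rwa [hED]
      · obtain ⟨c, hc, rfl⟩ := hG E hE hED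
        exact hv c hc)
    exact h γ v (hv D (mem_insert _ _)) (indiscernible_union_range_iff_holds.2
      fun c => hv _ (mem_insert_of_mem _ ⟨c, rfl⟩))
  choose e he heE using fun c : Cnd => definable_iff_finitely_definable.1 c.definable
  let e' : Finset A := C.biUnion fun c => (e c).subtype (· ∈ A)
  -- `γ` is inserted only to make the set of indices nonempty.
  refine ⟨e', insert γ (C.biUnion fun c =>
    Finset.univ.image (fun i => (c.s i : Λ)) ∪ Finset.univ.image (fun i => (c.t i : Λ))),
    Finset.insert_nonempty _ _, ?_, ?_⟩
  · intro x hx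
    simp only [Finset.mem_insert, Finset.mem_biUnion, Finset.mem_union, Finset.mem_image,
      Finset.mem_univ, true_and] at hx
    rcases hx with rfl | ⟨c, -, ⟨i, rfl⟩ | ⟨i, rfl⟩⟩
    · exact le_rfl
    · exact (c.s i).2
    · exact (c.t i).2
  · intro H hH v hv hind
    obtain ⟨c, hc, hvc⟩ := hC v hv
    refine hvc ?_
    rw [indiscernible_union_range_iff] at hind
    have hs : ∀ i, (c.s i : Λ) ∈ H := fun i => hH (by
      simp only [Finset.coe_insert, mem_insert_iff, Finset.mem_coe, Finset.mem_biUnion,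
        Finset.mem_union, Finset.mem_image, Finset.mem_univ, true_and]
      exact Or.inr ⟨c, hc, Or.inl ⟨i, rfl⟩⟩)
    have ht : ∀ i, (c.t i : Λ) ∈ H := fun i => hH (by
      simp only [Finset.coe_insert, mem_insert_iff, Finset.mem_coe, Finset.mem_biUnion,
        Finset.mem_union, Finset.mem_image, Finset.mem_univ, true_and]
      exact Or.inr ⟨c, hc, Or.inr ⟨i, rfl⟩⟩)
    refine hind c.n c.E ((heE c).mono fun x hx => ?_)
      (OrderEmbedding.ofStrictMono (fun i => ⟨c.s i, hs i⟩) fun i j hij => c.s.strictMono hij)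
      (OrderEmbedding.ofStrictMono (fun i => ⟨c.t i, ht i⟩) fun i j hij => c.t.strictMono hij)
    exact ⟨⟨x, he c hx⟩, by
      simp only [e', Finset.coe_biUnion, mem_iUnion, Finset.mem_coe, Finset.mem_subtype]
      exact ⟨c, hc, hx⟩, rfl⟩

theorem Indiscernible.of_substitute {ι : Type*} [LinearOrder ι] {k k' : ℕ} {X : Type*} {C : Set N}
    {b : ι → Fin k → N} {e : X → N} (g : Fin k' ≃ Fin k ⊕ X)
    (h : Indiscernible (L := L) C (fun i j => Sum.elim (b i) e (g j))) :
    Indiscernible (L := L) (C ∪ range e) b := by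
  rw [indiscernible_union_range_iff]
  intro n D hD s t
  cases n with
  -- The constants `e` are read off from the tuple at the first index, which does not exist for `n =
  -- 0`.
  | zero => rw [show s = t from RelEmbedding.ext fun i => i.elim0]
  | succ n =>
    let r : X ⊕ Fin (n + 1) × Fin k → Fin (n + 1) × Fin k' :=
      Sum.elim (fun x => (0, g.symm (Sum.inr x))) (fun q => (q.1, g.symm (Sum.inl q.2)))
    have key : ∀ s : Fin (n + 1) ↪o ι, (fun q : Fin (n + 1) × Fin k' =>
        Sum.elim (b (s q.1)) e (g q.2)) ∘ r = Sum.elim e (fun q => b (s q.1) q.2) := by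
      intro s
      funext z
      rcases z with z | z <;> simp [r]
    have := indiscernible_iff.1 h _ _ (hD.preimage_comp r) s t
    simpa only [mem_preimage, key] using this

/-- The sequence must be shortened from `lam'` to `lam`, and its base reduced from `A'` to `A`.
There are fewer than `lam'` finite subsets of `A'`, so one of them, `e₀`, carries the failures for
cofinally many `γ`. Appending `e₀` to each tuple makes the failures independent of the base, and a
block sequence of length `lam` contains a failure in every end segment. -/
theorem Bad.exists_witnessesShredding {μ : Cardinal.{u}} (hN : FamilySaturated L N μ)
    {lam lam' : Cardinal.{u}} (hlam : ℵ₀ < lam) (hll : lam ≤ lam') (hlam' : lam'.IsRegular)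
    (hlμ : lam' ≤ μ) {A A' : Set N} (hAA' : A ⊆ A') (hA' : #A' < lam') {k m r : ℕ}
    {b : lam'.ord.ToType → Fin k → N} {γ₀ : lam'.ord.ToType}
    (hb : Indiscernible (L := L) A' (fun i : Ici γ₀ => b i))
    {φ : L.Formula (Fin r ⊕ Fin m)} {a : Fin r → N}
    (hbad : Bad L A' b {v | φ.Realize (Sum.elim a v)}) :
    ∃ (k' : ℕ) (b' : lam.ord.ToType → Fin k' → N),
      (∀ i j, b' i j ∈ A' ∪ ⋃ i, range (b i)) ∧ WitnessesShredding lam A φ a b' := by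
  classical
  have hμ : ℵ₀ ≤ μ := hlam.le.trans (hll.trans hlμ)
  have h0 : ℵ₀ < lam' := hlam.trans_le hll
  have hΛ : #(lam'.ord.ToType) ≤ μ := by simpa using hlμ
  have ha : #(range a) ≤ μ := (lt_aleph0_of_finite _).le.trans hμ
  have hdef : (range a).Definable L {v : Fin m → N | φ.Realize (Sum.elim a v)} :=
    definable_realize φ fun i => mem_range_self i
  choose e U hne hγ hU using
    hbad.exists_finite hN hμ hΛ (hA'.le.trans hlμ) ha hdef
  obtain ⟨e₀, he₀⟩ := exists_fiber_unbounded hlam' (Y := Finset A') (by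
    rcases finite_or_infinite A' with hf | hi
    · exact (lt_aleph0_of_finite _).trans h0
    · rwa [mk_finset_of_infinite]) e
  obtain ⟨h, hh⟩ := exists_orderEmbedding_blocks hlam hll hlam'
    (P := fun U => (∀ x ∈ U, γ₀ ≤ x) ∧ ∀ H : Set lam'.ord.ToType, ↑U ⊆ H →
      ∀ c : Fin m → N, φ.Realize (Sum.elim a c) → ¬ Indiscernible (L := L)
        (((↑) '' (e₀ : Set A') : Set N) ∪ range c) (fun i : H => b i)) (by
    intro γ
    obtain ⟨δ, hδ, rfl⟩ := he₀ (max γ γ₀)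
    exact ⟨U δ, ⟨fun x hx => (le_max_right _ _).trans (hδ.trans (hγ δ x hx)), hU δ⟩, hne δ,
      fun x hx => (le_max_left _ _).trans (hδ.trans (hγ δ x hx))⟩)
  have hhγ : ∀ i, γ₀ ≤ h i := fun i => by
    obtain ⟨U, hU, hi⟩ := (hh i).2
    exact hU.1 _ hi
  let v : Fin e₀.card → N := fun i => ((e₀.equivFin.symm i : A') : N)
  have hv : range v = (↑) '' (e₀ : Set A') := by
    ext x
    constructor
    · rintro ⟨i, rfl⟩
      exact ⟨_, (e₀.equivFin.symm i).2, rfl⟩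
    · rintro ⟨y, hy, rfl⟩
      exact ⟨e₀.equivFin ⟨y, hy⟩, by simp [v]⟩
  let g : Fin (k + e₀.card) ≃ Fin k ⊕ Fin e₀.card := finSumFinEquiv.symm
  let b' : lam.ord.ToType → Fin (k + e₀.card) → N := fun i j => Sum.elim (b (h i)) v (g j)
  have hb' : ∀ i j, b' i j ∈ A' ∪ ⋃ i, range (b i) := by
    intro i j
    simp only [b']
    rcases g j with l | l
    · exact Or.inr (mem_iUnion.2 ⟨h i, mem_range_self _⟩)
    · exact Or.inl (e₀.equivFin.symm l).1.2
  refine ⟨_, b', hb', ?_, ?_⟩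
  · have h1 := hb.comp (OrderEmbedding.ofStrictMono (fun i => (⟨h i, hhγ i⟩ : Ici γ₀))
      fun i j hij => h.strictMono hij)
    exact (h1.substitute g (e := v) fun x => (e₀.equivFin.symm x).1.2).mono hAA'
  · intro N' _ f c α hφ hind
    let P : Set N := A' ∪ (⋃ i, range (b i)) ∪ range a
    have hP : #P ≤ μ := mk_union_le_of_le hμ (mk_union_le_of_le hμ (hA'.le.trans hlμ)
      (mk_iUnion_le_of_le hμ hΛ fun i => (lt_aleph0_of_finite _).le.trans hμ)) ha
    obtain ⟨c₀, hc₀⟩ := exists_pullback hN hμ f c P hP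
    have hind' := indiscernible_pullback f (P := P)
      (hAA'.trans (subset_union_left.trans subset_union_left)) hc₀
      (b := fun i : Ici α => b' i) (fun i j => Or.inl (hb' i j)) hind
    obtain ⟨U, ⟨-, hU⟩, hUα⟩ := (hh α).1
    refine hU (h '' Ici α) hUα c₀ ?_ ?_
    · have h1 := hc₀ (φ.relabel (Sum.map (fun i => ⟨a i, Or.inr (mem_range_self i)⟩) id))
      simp only [Formula.realize_relabel] at h1
      have e1 : Sum.elim (fun p : P => f p) c ∘
          Sum.map (fun i => ⟨a i, Or.inr (mem_range_self i)⟩) id = Sum.elim (f ∘ a) c := by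
        funext z
        rcases z with z | z <;> rfl
      have e2 : Sum.elim ((↑) : P → N) c₀ ∘
          Sum.map (fun i => ⟨a i, Or.inr (mem_range_self i)⟩) id = Sum.elim a c₀ := by
        funext z
        rcases z with z | z <;> rfl
      rw [e1, e2] at h1
      exact h1.1 hφ
    · rw [← hv]
      have h2 := Indiscernible.of_substitute (b := fun i : Ici α => b (h i)) g hind'
      have h3 : ∀ x : h '' Ici α, ∃ y : Ici α, h y = x := fun x => by
        obtain ⟨y, hy, hxy⟩ := x.2
        exact ⟨⟨y, hy⟩, hxy⟩
      choose s hs using h3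
      have h4 := h2.comp (OrderEmbedding.ofStrictMono s fun x y hxy => by
        have : h (s x) < h (s y) := by
          rw [hs, hs]
          exact hxy
        exact h.lt_iff_lt.1 this)
      have h5 : (fun x : h '' Ici α => b (h (s x))) = fun x : h '' Ici α => b x :=
        funext fun x => by rw [hs]
      refine Indiscernible.mono (h5 ▸ h4) ?_
      rw [union_comm]
      exact union_subset_union_left _ subset_union_right

end Shorten

end Shredding

namespace Shredding

/-! ### Adapted chains, and the use of unshreddability -/

section Chains

open Set

variable {L : FirstOrder.Language.{u, u}}

/-- Among finitely many conditions there is a largest index `j`, and `c j` satisfies them all. `hne`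
is needed when no index occurs, in particular for empty `ι`. -/
theorem exists_typeEq_of_coherent {N : Type u} [L.Structure N] {μ : Cardinal.{u}}
    (hN : FamilySaturated L N μ) (hμ : ℵ₀ ≤ μ) {ι : Type*} [LinearOrder ι] {X : Type*} [Finite X]
    {A : ι → Set N} {P : Set N} (hP : #P ≤ μ) (hA : ∀ i, A i ⊆ P) {c : ι → X → N}
    (hc : ∀ i j, i ≤ j → TypeEq L (A i) (c i) (c j)) {p : Set (Set (X → N))}
    (hp : ∀ D ∈ p, P.Definable L D) (hcp : ∀ i, c i ∈ ⋂₀ p) (hne : (⋂₀ p).Nonempty) :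
    ∃ d ∈ ⋂₀ p, ∀ i, TypeEq L (A i) (c i) d := by
  classical
  obtain ⟨d, hd⟩ := hN.exists_mem_sInter hμ P (p ∪ {D | ∃ i, (A i).Definable L D ∧ c i ∈ D}) hP (by
    rintro D (hD | ⟨i, hD, -⟩)
    · exact hp D hD
    · exact hD.mono (hA i)) (by
    intro F₀ hF₀ hsub
    suffices H : ∃ v ∈ ⋂₀ p, ∀ D ∈ F₀, D ∉ p → v ∈ D by
      obtain ⟨v, hv, hvF⟩ := H
      exact ⟨v, fun D hD => by_cases (fun h : D ∈ p => hv D h) (hvF D hD)⟩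
    have h1 : ∀ D : F₀, ∃ o : Option ι, D.1 ∉ p → ∃ i, o = some i ∧ (A i).Definable L D.1 ∧
        c i ∈ D.1 := by
      intro D
      by_cases hD : D.1 ∈ p
      · exact ⟨none, fun h => absurd hD h⟩
      · obtain ⟨i, hi⟩ := (hsub D.2).resolve_left hD
        exact ⟨some i, fun _ => ⟨i, rfl, hi⟩⟩
    choose o ho using h1
    have : Finite F₀ := hF₀
    let W : Set ι := some ⁻¹' range o
    have hW : W.Finite := (finite_range o).preimage (Option.some_injective _).injOn
    rcases W.eq_empty_or_nonempty with he | hWne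
    · obtain ⟨v, hv⟩ := hne
      refine ⟨v, hv, fun D hD hDp => ?_⟩
      obtain ⟨i, hi, -⟩ := ho ⟨D, hD⟩ hDp
      exact absurd (show i ∈ W from ⟨_, hi⟩) (by simp [he])
    · obtain ⟨j, hj, hmax⟩ := hW.exists_maximalFor id W hWne
      refine ⟨c j, hcp j, fun D hD hDp => ?_⟩
      obtain ⟨i, hi, hdef, hiD⟩ := ho ⟨D, hD⟩ hDp
      have hiW : i ∈ W := ⟨_, hi⟩
      have hij : i ≤ j := (le_total i j).elim id fun h => hmax hiW h
      exact (hc i j hij D hdef).1 hiD)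
  exact ⟨d, fun D hD => hd D (Or.inl hD), fun i =>
    typeEq_of_forall_mem fun D hD h => hd D (Or.inr ⟨i, hD, h⟩)⟩

/-- An increasing chain of small models such that the later models contain the `j`-th sequence,
and an end segment of the `j`-th sequence is indiscernible over the `j`-th model. -/
structure AdaptedChain (L : FirstOrder.Language.{u, u}) {N : Type u} [L.Structure N] {J : Type u}
    [LinearOrder J] (mu : J → Cardinal.{u}) {k : ℕ}
    (I : ∀ j, (Order.succ (mu j)).ord.ToType → Fin k → N) (M : J → Set N) : Prop where
  mono : Monotone M
  meetsDefinable : ∀ j, L.MeetsDefinable (M j)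
  card : ∀ j, #(M j) ≤ mu j
  mem : ∀ j j', j < j' → ∀ i l, I j i l ∈ M j'
  tail : ∀ j, ∃ γ : (Order.succ (mu j)).ord.ToType,
    Indiscernible (L := L) (M j) (fun i : Ici γ => I j i)

variable {T : L.Theory} {N : Theory.ModelType.{u, u, u} T} {μ κ : Cardinal.{u}} {J : Type u}
  [LinearOrder J] {mu : J → Cardinal.{u}} {k : ℕ}
  {I : ∀ j, (Order.succ (mu j)).ord.ToType → Fin k → N} {M : J → Set N}

/-- Otherwise realizations of `p` and levels are chosen for `ρ` steps: each new realization keeps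
its predecessor's type over the model reached so far and falls into a set that is bad at some level
above. A limit realization falls into all these sets, and its type shreds along the models reached,
contradicting `hsh`. -/
theorem AdaptedChain.exists_not_bad [Nonempty J] (hN : FamilySaturated L N μ)
    (hM : AdaptedChain L mu I M) (hT : ∀ j, theoryCard T ≤ mu j) (hmu : ∀ j, mu j < μ)
    (hJμ : #J ≤ μ) (hJ : ∀ s : Set J, #s < κ → ∃ b, ∀ x ∈ s, x < b) {m : ℕ} {ρ : Cardinal.{u}}
    (hρ : ρ.IsRegular) (hρκ : ρ ≤ κ) (hsh : ¬ HasShreddingChain T m ρ)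
    {p : Set (Set (Fin m → N))} (hp : ∀ D ∈ p, (⋃ j, M j).Definable L D) (hne : (⋂₀ p).Nonempty)
    (i₀ : J) : ∃ c ∈ ⋂₀ p, ∃ i, i₀ ≤ i ∧ ∀ c' ∈ ⋂₀ p, TypeEq L (M i) c c' → ∀ j, i ≤ j →
      ∀ D, (⋃ j, M j).Definable L D → c' ∈ D → ¬ Bad L (M j) (I j) D := by
  by_contra! hcon
  have h0 : ∀ j, ℵ₀ ≤ mu j := fun j => (le_max_left _ _).trans (hT j)
  have hμ : ℵ₀ ≤ μ := (h0 i₀).trans (hmu i₀).le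
  have hU : #(⋃ j, M j) ≤ μ := mk_iUnion_le_of_le hμ hJμ fun j => (hM.card j).trans (hmu j).le
  have hMU : ∀ j, M j ⊆ ⋃ j, M j := subset_iUnion M
  have hbd : ∀ s : Set J, #s < ρ → ∃ b, ∀ x ∈ s, x < b := fun s hs => hJ s (hs.trans_le hρκ)
  have hrange : ∀ (ξ : Ordinal.{u}), ξ < ρ.ord → ∀ g : Iio ξ → J, #(range g) < ρ := by
    intro ξ hξ g
    have h1 := mk_range_le_lift (f := g)
    rw [Cardinal.mk_Iio_ordinal, Cardinal.lift_lift, Cardinal.lift_umax.{u, u + 1}] at h1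
    have h2 : Cardinal.lift.{u + 1} #(range g) ≤ Cardinal.lift.{u + 1} ξ.card := by
      simpa using h1
    exact (Cardinal.lift_le.1 h2).trans_lt (Cardinal.lt_ord.1 hξ)
  obtain ⟨d₀, hd₀⟩ := hne
  obtain ⟨F, hF⟩ := exists_transfinite_choice (ι := Ordinal.{u}) (S := (Fin m → N) × J)
    (fun ξ f s => ξ < ρ.ord → s.1 ∈ ⋂₀ p ∧ i₀ ≤ s.2 ∧
      (∀ η, (f η).2 ≤ s.2 ∧ TypeEq L (M (f η).2) (f η).1 s.1) ∧
      ∃ j D, j < s.2 ∧ i₀ ≤ j ∧ (∀ η, (f η).2 ≤ j) ∧ s.1 ∈ D ∧ (M s.2).Definable L D ∧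
        Bad L (M j) (I j) D) (by
    intro ξ f hf
    by_cases hξ : ξ < ρ.ord
    swap
    · exact ⟨(d₀, i₀), fun h => absurd h hξ⟩
    have hf' : ∀ η < ξ, _ := fun η hη => hf η hη (hη.trans hξ)
    obtain ⟨d, hd, hdf⟩ := exists_typeEq_of_coherent hN hμ (ι := Iio ξ)
      (A := fun η => M (f η).2) hU (fun η => hMU _) (c := fun η => (f η).1) (by
      intro η ζ hηζ
      rcases hηζ.eq_or_lt with rfl | h
      · exact TypeEq.refl _
      · exact ((hf' ζ ζ.2).2.2.1 ⟨η, h⟩).2) hp (fun η => (hf' η η.2).1) ⟨d₀, hd₀⟩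
    obtain ⟨b, hb⟩ := hbd _ (hrange ξ hξ fun η => (f η).2)
    obtain ⟨c, hc, hdc, j, hij, D, hD, hcD, hbad⟩ := hcon d hd (max b i₀) (le_max_right _ _)
    obtain ⟨i₁, hi₁⟩ := definable_of_forall_finset_mem hM.mono hD
    obtain ⟨i, hi⟩ := hbd {i₁, j} ((lt_aleph0_of_finite _).trans_le hρ.aleph0_le)
    have hji : j < i := hi j (by simp)
    have hbi : ∀ η : Iio ξ, (f η).2 ≤ b := fun η => (hb _ (mem_range_self η)).le
    have hbj : b ≤ j := (le_max_left _ _).trans hij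
    have hi₀j : i₀ ≤ j := (le_max_right _ _).trans hij
    refine ⟨(c, i), fun _ => ⟨hc, hi₀j.trans hji.le, fun η => ⟨(hbi η).trans (hbj.trans hji.le),
      (hdf η).trans (hdc.mono (hM.mono ((hbi η).trans (le_max_left _ _))))⟩, j, D, hji, hi₀j,
      fun η => (hbi η).trans hbj, hcD, hi₁.mono (hM.mono (hi i₁ (by simp)).le), hbad⟩⟩)
  refine hsh ?_
  have hFle : ∀ η ξ, η ≤ ξ → ξ < ρ.ord → (F η).2 ≤ (F ξ).2 := fun η ξ h hξ => by
    rcases h.eq_or_lt with rfl | h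
    · exact le_rfl
    · exact ((hF ξ hξ).2.2.1 ⟨η, h⟩).1
  obtain ⟨c, hc, hcF⟩ := exists_typeEq_of_coherent hN hμ (ι := Iio ρ.ord)
    (A := fun η => M (F η).2) hU (fun η => hMU _) (c := fun η => (F η).1) (by
    intro η ζ hηζ
    rcases hηζ.eq_or_lt with rfl | h
    · exact TypeEq.refl _
    · exact ((hF ζ ζ.2).2.2.1 ⟨η, h⟩).2) hp (fun η => (hF η η.2).1) ⟨d₀, hd₀⟩
  -- `i₀` is inserted so that `M' 0` is a model. Taking unions makes the chain continuous, and at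
  -- successors `M' (o + 1)` is just `M (F o).2`.
  let K : Ordinal.{u} → Set J := fun o => insert i₀ ((fun η => (F η).2) '' {η | η < o ∧ η < ρ.ord})
  have hK0 : ∀ o, i₀ ∈ K o := fun o => mem_insert _ _
  have hKmono : ∀ {o o'}, o ≤ o' → K o ⊆ K o' := fun h =>
    insert_subset_insert (image_mono fun η hη => ⟨hη.1.trans_le h, hη.2⟩)
  let M' : Ordinal.{u} → Set N := fun o => ⋃ j : K o, M j
  have hM'meets : ∀ o, L.MeetsDefinable (M' o) := fun o => by
    have : Nonempty (K o) := ⟨⟨i₀, hK0 o⟩⟩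
    exact meetsDefinable_iUnion (fun i j h => hM.mono h) fun j => hM.meetsDefinable j
  have hM'mono : ∀ {o o'}, o ≤ o' → M' o ⊆ M' o' := fun h =>
    iUnion_subset fun j => subset_iUnion (fun j : K _ => M j) ⟨j, hKmono h j.2⟩
  have hM'succ : ∀ o < ρ.ord, M' (o + 1) = M (F o).2 := by
    intro o ho
    refine (iUnion_subset ?_).antisymm ?_
    · rintro ⟨j, rfl | ⟨η, ⟨hη, -⟩, rfl⟩⟩
      · exact hM.mono (hF o ho).2.1
      · exact hM.mono (hFle η o (Order.lt_add_one_iff.1 hη) ho)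
    · exact subset_iUnion (fun j : K (o + 1) => M j) ⟨(F o).2, Or.inr ⟨o, ⟨Order.lt_add_one_iff.2 le_rfl, ho⟩, rfl⟩⟩
  let E : Ordinal.{u} → L.ElementarySubstructure N := fun o => (hM'meets o).toElementarySubstructure
  have hE : ∀ o, (E o : Set N) = M' o := fun o => coe_toElementarySubstructure _
  refine ⟨N, E, (L[[(E ρ.ord : Set N)]].completeTheory N).typeOf c, ?_, ?_, ?_⟩
  · intro i j hij _
    rw [← SetLike.coe_subset_coe, hE, hE]
    exact hM'mono hij
  · intro δ _ hδ
    simp only [hE]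
    refine Subset.antisymm (iUnion_subset ?_) (iUnion₂_subset fun i hi => hM'mono hi.le)
    rintro ⟨j, rfl | ⟨η, ⟨hη, hηρ⟩, rfl⟩⟩
    · refine subset_iUnion₂_of_subset 0 hδ.bot_lt ?_
      exact subset_iUnion (fun j : K 0 => M j) ⟨_, hK0 0⟩
    · refine subset_iUnion₂_of_subset (η + 1) (hδ.add_one_lt hη) ?_
      rw [hM'succ η hηρ]
  · intro o ho
    obtain ⟨-, -, -, j, D, hj, hi₀j, hjη, hFD, hDdef, hbad⟩ := hF o ho
    rw [hE, hE, hM'succ o ho]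
    have hAj : M' o ⊆ M j := by
      refine iUnion_subset ?_
      rintro ⟨i, rfl | ⟨η, ⟨hη, -⟩, rfl⟩⟩
      · exact hM.mono hi₀j
      · exact hM.mono (hjη ⟨η, hη⟩)
    obtain ⟨r, φ, a, ha, rfl⟩ := definable_exists_fin hDdef
    obtain ⟨γ, hγ⟩ := hM.tail j
    have hcard : theoryCard T + #(E o) ≤ mu j := by
      refine add_le_of_le (h0 j) (hT j) ?_
      refine le_trans ?_ (hM.card j)
      exact mk_le_mk_of_subset ((hE o).trans_subset hAj)
    -- `I j` has length `(mu j)⁺` and is bad over `M j`, but the definition asks for length `(|T| +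
    -- |M' o|)⁺`, possibly smaller, over `M' o`, possibly a proper subset of `M j`.
    obtain ⟨k', b', hb', hw⟩ := hbad.exists_witnessesShredding hN
      (lam := Order.succ (theoryCard T + #(E o)))
      (Order.lt_succ_of_le ((le_max_left _ _).trans (self_le_add_right _ _)))
      (Order.succ_le_succ hcard) (isRegular_succ (h0 j)) (Order.succ_le_of_lt (hmu j)) hAj
      (Order.lt_succ_of_le (hM.card j)) hγ
    refine ⟨hAj.trans (hM.mono hj.le), r, φ, a, k', b', ?_, fun i l => ?_, hw⟩
    · refine implies_restrictTo ?_ c φ a ha ?_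
      · rw [hE]
        exact subset_iUnion (fun j : K ρ.ord => M j) ⟨(F o).2, Or.inr ⟨o, ⟨ho, ho⟩, rfl⟩⟩
      · exact (hcF ⟨o, ho⟩ _ hDdef).1 hFD
    · rcases hb' i l with h | h
      · exact hM.mono hj.le h
      · obtain ⟨i', l', h⟩ := mem_iUnion.1 h
        exact h ▸ hM.mem _ _ hj _ _

end Chains

end Shredding

namespace Shredding

/-! ### Realizing a type inside a larger adapted chain -/

section Extension

open Set

variable {L : FirstOrder.Language.{u, u}}

theorem mk_definable_fin_le {N : Type u} [L.Structure N] {κ : Cardinal.{u}} (h0 : ℵ₀ ≤ κ)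
    (hL : L.card ≤ κ) {A : Set N} (hA : #A ≤ κ) (m : ℕ) :
    #{D : Set (Fin m → N) // A.Definable L D} ≤ κ := by
  let e : Fin m ≃ ULift.{u} (Fin m) := Equiv.ulift.symm
  have h1 : #{D : Set (Fin m → N) // A.Definable L D} ≤
      #{D : Set (ULift.{u} (Fin m) → N) // A.Definable L D} := by
    refine mk_le_of_injective (f := fun D => ⟨{y | y ∘ e ∈ D.1}, D.2.preimage_comp e⟩) ?_
    intro D E h
    have h' := Subtype.mk.inj h
    ext v
    have := Set.ext_iff.1 h' (v ∘ e.symm)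
    simpa [Function.comp_assoc] using this
  refine h1.trans (mk_definable_le.trans (max_le h0 ?_))
  exact add_le_of_le h0 (add_le_of_le h0 hL hA) ((lt_aleph0_of_finite _).le.trans h0)

/-- Each finite part of `q` has an end segment of its own. There are fewer than `lam` finite parts,
so one `δ` lies beyond all the starting points, and saturation finishes. -/
theorem exists_tail_indiscernible {N : Type u} [L.Structure N] {μ : Cardinal.{u}}
    (hN : FamilySaturated L N μ) {lam : Cardinal.{u}} (hlam : lam.IsRegular) (h0 : ℵ₀ < lam)
    (hlamμ : lam ≤ μ) {k m : ℕ} {A P : Set N} {b : lam.ord.ToType → Fin k → N} (hP : #P ≤ μ)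
    (hAP : A ⊆ P) (hbP : ∀ i l, b i l ∈ P) {q : Set (Set (Fin m → N))} (hq : #q < lam)
    (hqP : ∀ D ∈ q, P.Definable L D) (h : ∀ q₀ ⊆ q, q₀.Finite → ¬ Bad L A b (⋂₀ q₀)) :
    ∃ c ∈ ⋂₀ q, ∃ γ : lam.ord.ToType,
      Indiscernible (L := L) (A ∪ range c) (fun i : Ici γ => b i) := by
  classical
  have h1 : ∀ G : Finset q, ∃ γ : lam.ord.ToType, ∃ c ∈ ⋂₀ ((↑) '' (G : Set q) : Set (Set (Fin m → N))),
      Indiscernible (L := L) (A ∪ range c) (fun i : Ici γ => b i) := by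
    intro G
    have := h ((↑) '' (G : Set q)) (by rintro _ ⟨D, -, rfl⟩; exact D.2) (G.finite_toSet.image _)
    unfold Bad at this
    push Not at this
    obtain ⟨γ, c, hc, hi⟩ := this
    exact ⟨γ, c, hc, hi⟩
  choose γ hγ using h1
  obtain ⟨δ, hδ⟩ := bddAbove_of_mk_lt hlam (s := range γ) (mk_range_le.trans_lt (by
    rcases finite_or_infinite q with hf | hi
    · exact (lt_aleph0_of_finite _).trans h0
    · rwa [mk_finset_of_infinite]))
  obtain ⟨c, hc⟩ := hN.exists_mem_sInter (h0.le.trans hlamμ) P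
    (q ∪ range fun c : IndCond L A (Fin m) (Ici δ) k => c.holds fun i => b i) hP (by
    rintro _ (hD | ⟨c, rfl⟩)
    · exact hqP _ hD
    · exact c.definable_holds hAP fun i l => hbP i l) (by
    intro F₀ hF₀ hsub
    have hfin : (F₀ ∩ q).Finite := hF₀.subset inter_subset_left
    obtain ⟨c, hc, hi⟩ := hγ (hfin.toFinset.subtype (· ∈ q))
    have hi' := indiscernible_union_range_iff_holds.1
      (hi.tail_le (b := b) (hδ _ (mem_range_self _)).le)
    refine ⟨c, fun D hD => ?_⟩
    rcases hsub hD with hDq | ⟨c', rfl⟩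
    · exact hc D ⟨⟨D, hDq⟩, by simpa using ⟨hD, hDq⟩, rfl⟩
    · exact hi' c')
  exact ⟨c, fun D hD => hc D (Or.inl hD), δ, indiscernible_union_range_iff_holds.2
    fun c' => hc _ (Or.inr ⟨c', rfl⟩)⟩

theorem TypeEq.indiscernible {N : Type u} [L.Structure N] {A B : Set N} {X : Type*} {c d : X → N}
    (h : TypeEq L B c d) (hAB : A ⊆ B) {ι : Type u} [LinearOrder ι] {k : ℕ} {b : ι → Fin k → N}
    (hb : ∀ i l, b i l ∈ B) (hc : Indiscernible (L := L) (A ∪ range c) b) :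
    Indiscernible (L := L) (A ∪ range d) b := by
  rw [indiscernible_union_range_iff_holds] at hc ⊢
  exact fun e => (h _ (e.definable_holds hAB hb)).1 (hc e)

variable {T : L.Theory} {N : Theory.ModelType.{u, u, u} T} {μ κ : Cardinal.{u}} {J : Type u}
  [LinearOrder J] [WellFoundedLT J] {mu : J → Cardinal.{u}} {k : ℕ}
  {I : ∀ j, (Order.succ (mu j)).ord.ToType → Fin k → N} {M : J → Set N}

/-- One tuple must serve all large `j`. It is a limit of tuples, the one at `j` preserving an end
segment of `I j` and agreeing with its predecessors over `M j' ∪ I j'` for `j' < j`, which is all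
that their indiscernibility depends on. At each step only `mu j` conditions are imposed, fewer than
the length of `I j`. -/
theorem AdaptedChain.exists_realization [Nonempty J] (hN : FamilySaturated L N μ)
    (hM : AdaptedChain L mu I M) (hT : ∀ j, theoryCard T ≤ mu j) (hmu : ∀ j, mu j < μ)
    (hlt : ∀ j j', j < j' → Order.succ (mu j) ≤ mu j')
    (hJmu : ∀ j, #J ≤ mu j) (hJ : ∀ s : Set J, #s < κ → ∃ b, ∀ x ∈ s, x < b) {m : ℕ}
    {ρ : Cardinal.{u}} (hρ : ρ.IsRegular) (hρκ : ρ ≤ κ) (hsh : ¬ HasShreddingChain T m ρ)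
    {p : Set (Set (Fin m → N))} (hp : ∀ D ∈ p, (⋃ j, M j).Definable L D) (hne : (⋂₀ p).Nonempty)
    (i₀ : J) (hcard : #p ≤ mu i₀) :
    ∃ c ∈ ⋂₀ p, ∃ i, ∀ j, i ≤ j → ∃ γ : (Order.succ (mu j)).ord.ToType,
      Indiscernible (L := L) (M j ∪ range c) (fun i : Ici γ => I j i) := by
  have h0 : ∀ j, ℵ₀ ≤ mu j := fun j => (le_max_left _ _).trans (hT j)
  have hL : ∀ j, L.card ≤ mu j := fun j => (le_max_right _ _).trans (hT j)
  have hμ : ℵ₀ ≤ μ := (h0 i₀).trans (hmu i₀).le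
  have hJμ : #J ≤ μ := (hJmu i₀).trans (hmu i₀).le
  have hU : #(⋃ j, M j) ≤ μ := mk_iUnion_le_of_le hμ hJμ fun j => (hM.card j).trans (hmu j).le
  have hMU : ∀ j, M j ⊆ ⋃ j, M j := subset_iUnion M
  have hmono : Monotone mu := fun i j h => by
    rcases h.eq_or_lt with rfl | h
    · exact le_rfl
    · exact (Order.le_succ _).trans (hlt i j h)
  have hIU : ∀ j i l, I j i l ∈ ⋃ j, M j := fun j i l => by
    obtain ⟨j', hj'⟩ := hJ {j} ((lt_aleph0_of_finite _).trans_le (hρ.aleph0_le.trans hρκ))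
    exact hMU j' (hM.mem j j' (hj' j rfl) i l)
  obtain ⟨c₀, hc₀, i, hi, hbad⟩ := hM.exists_not_bad hN hT hmu hJμ hJ hρ hρκ hsh hp hne i₀
  -- Fixing the type over `M i` keeps every approximation within the scope of `hbad`.
  let p' : Set (Set (Fin m → N)) := p ∪ {D | (M i).Definable L D ∧ c₀ ∈ D}
  have hp' : ∀ D ∈ p', (⋃ j, M j).Definable L D := by
    rintro D (hD | hD)
    · exact hp D hD
    · exact hD.1.mono (hMU i)
  have hne' : (⋂₀ p').Nonempty := ⟨c₀, by
    rintro D (hD | hD)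
    · exact hc₀ D hD
    · exact hD.2⟩
  let A : J → Set N := fun j => M j ∪ ⋃ i, range (I j i)
  have hAM : ∀ j j', j < j' → A j ⊆ M j' := fun j j' h => union_subset (hM.mono h.le)
    (iUnion_subset fun i => by
      rintro _ ⟨l, rfl⟩
      exact hM.mem j j' h i l)
  have hAU : ∀ j, A j ⊆ ⋃ j, M j := fun j => union_subset (hMU j) (iUnion_subset fun i => by
      rintro _ ⟨l, rfl⟩
      exact hIU j i l)
  have hAcoh : ∀ c : Ici i → Fin m → N, (∀ j, ∀ j' : Iio j, TypeEq L (A j') (c j') (c j)) →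
      ∀ j j' : Ici i, j ≤ j' → TypeEq L (A j) (c j) (c j') := by
    intro c hc j j' h
    rcases h.eq_or_lt with rfl | h
    · exact TypeEq.refl _
    · exact hc j' ⟨j, h⟩
  obtain ⟨c, hc⟩ := exists_transfinite_choice (ι := Ici i) (S := Fin m → N)
    (fun j f c => c ∈ ⋂₀ p' ∧ (∀ j' : Iio j, TypeEq L (A j') (f j') c) ∧
      ∃ γ : (Order.succ (mu j)).ord.ToType,
        Indiscernible (L := L) (M j ∪ range c) (fun i : Ici γ => I j i)) (by
    intro j f hf
    obtain ⟨d, hd, hdf⟩ := exists_typeEq_of_coherent hN hμ (ι := Iio j) (A := fun j' => A j') hU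
      (fun j' => hAU _) (c := fun j' => f j') (by
      intro η ζ hηζ
      rcases hηζ.eq_or_lt with rfl | h
      · exact TypeEq.refl _
      · exact (hf ζ ζ.2).2.1 ⟨η, h⟩) hp' (fun η => (hf η η.2).1) hne'
    let P : Set N := M i ∪ ⋃ j' : Iio j, A j'
    have hPM : P ⊆ M j := union_subset (hM.mono j.2) (iUnion_subset fun j' => hAM _ _ j'.2)
    obtain ⟨c, hc, hγ⟩ := exists_tail_indiscernible hN (isRegular_succ (h0 j))
      (Order.lt_succ_of_le (h0 j)) (Order.succ_le_of_lt (hmu j)) (A := M j) (b := I j)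
      (q := p ∪ {D | P.Definable L D ∧ d ∈ D}) hU (hMU j) (hIU j) (by
      refine Order.lt_succ_of_le ((mk_union_le _ _).trans (add_le_of_le (h0 j)
        (hcard.trans (hmono (hi.trans j.2))) ?_))
      refine le_trans ?_ (mk_definable_fin_le (h0 j) (hL j)
        ((mk_le_mk_of_subset hPM).trans (hM.card j)) m)
      exact mk_le_mk_of_subset fun D hD => hD.1) (by
      rintro D (hD | hD)
      · exact hp D hD
      · exact hD.1.mono (hPM.trans (hMU j))) (by
      intro q₀ hq₀ hfin
      refine hbad d (fun D hD => hd D (Or.inl hD)) (typeEq_of_forall_mem fun D hD h =>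
        hd D (Or.inr ⟨hD, h⟩)) j j.2 _ ?_ fun D hD => ?_
      · have : Finite q₀ := hfin
        rw [sInter_eq_iInter]
        refine definable_iInter_of_finite fun D => ?_
        rcases hq₀ D.2 with hD | hD
        · exact hp D hD
        · exact hD.1.mono (hPM.trans (hMU j))
      · rcases hq₀ hD with hD | hD
        · exact hd D (Or.inl hD)
        · exact hD.2)
    have hdc : TypeEq L P d c := typeEq_of_forall_mem fun D hD h => hc D (Or.inr ⟨hD, h⟩)
    refine ⟨c, ?_, fun j' => (hdf j').trans (hdc.mono ?_), hγ⟩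
    · rintro D (hD | hD)
      · exact hc D (Or.inl hD)
      · exact (hdc D (hD.1.mono subset_union_left)).1 (hd D (Or.inr hD))
    · exact (subset_iUnion (fun j' : Iio j => A j') j').trans subset_union_right)
  obtain ⟨d, hd, hdc⟩ := exists_typeEq_of_coherent hN hμ (ι := Ici i) (A := fun j => A j) hU
    (fun j => hAU _) (c := c) (hAcoh c fun j => (hc j).2.1) hp' (fun j => (hc j).1) hne'
  refine ⟨d, fun D hD => hd D (Or.inl hD), i, fun j hj => ?_⟩
  obtain ⟨γ, hγ⟩ := (hc ⟨j, hj⟩).2.2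
  exact ⟨γ, (hdc ⟨j, hj⟩).indiscernible subset_union_left
    (fun x l => Or.inr (mem_iUnion.2 ⟨x, mem_range_self _⟩)) hγ⟩

theorem AdaptedChain.exists_extension [Nonempty J] (hN : FamilySaturated L N μ)
    (hM : AdaptedChain L mu I M) (hT : ∀ j, theoryCard T ≤ mu j) (hmu : ∀ j, mu j < μ)
    (hlt : ∀ j j', j < j' → Order.succ (mu j) ≤ mu j')
    (hJmu : ∀ j, #J ≤ mu j) (hJ : ∀ s : Set J, #s < κ → ∃ b, ∀ x ∈ s, x < b) {m : ℕ}
    {ρ : Cardinal.{u}} (hρ : ρ.IsRegular) (hρκ : ρ ≤ κ) (hsh : ¬ HasShreddingChain T m ρ)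
    {p : Set (Set (Fin m → N))} (hp : ∀ D ∈ p, (⋃ j, M j).Definable L D) (hne : (⋂₀ p).Nonempty)
    (i₀ : J) (hcard : #p ≤ mu i₀) :
    ∃ M' : J → Set N, AdaptedChain L mu I M' ∧ (∀ j, M j ⊆ M' j) ∧
      ∃ c ∈ ⋂₀ p, ∀ l, c l ∈ ⋃ j, M' j := by
  classical
  have h0 : ∀ j, ℵ₀ ≤ mu j := fun j => (le_max_left _ _).trans (hT j)
  have hL : ∀ j, L.card ≤ mu j := fun j => (le_max_right _ _).trans (hT j)
  have hμ : ℵ₀ ≤ μ := (h0 i₀).trans (hmu i₀).le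
  have hmono : Monotone mu := fun i j h => by
    rcases h.eq_or_lt with rfl | h
    · exact le_rfl
    · exact (Order.le_succ _).trans (hlt i j h)
  obtain ⟨c, hc, i, hi⟩ := hM.exists_realization hN hT hmu hlt hJmu hJ hρ hρκ hsh hp hne i₀ hcard
  choose γ hγ using fun j : Ici i => hi j j.2
  let P : Set N := ⋃ j : Ici i, ((M j ∪ range c) ∪ ⋃ x, range (I j x))
  obtain ⟨M₁, hM₁mono, hM₁⟩ := exists_model_chain (J := Ici i) (ι := fun j => Ici (γ j))
    (I := fun j x => I j x) (B := fun j => M j ∪ range c) (mu := fun j => mu j) (A := P) hN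
    (fun j => by
      have : NoMaxOrder (Order.succ (mu j)).ord.ToType :=
        Cardinal.noMaxOrder ((h0 j).trans (Order.le_succ _))
      obtain ⟨f, hf⟩ := Nat.exists_strictMono (Ici (γ j))
      exact ⟨OrderEmbedding.ofStrictMono f hf⟩)
    (fun j j' h => union_subset_union_left _ (hM.mono h)) hγ
    (fun j j' h x l => Or.inl (hM.mem j j' h x l))
    (fun j => subset_iUnion_of_subset j subset_union_left)
    (fun j x l => mem_iUnion.2 ⟨j, Or.inr (mem_iUnion.2 ⟨x, mem_range_self _⟩)⟩)
    (mk_iUnion_le_of_le hμ ((mk_le_of_injective Subtype.val_injective).trans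
      ((hJmu i₀).trans (hmu i₀).le)) fun j => mk_union_le_of_le hμ
        (mk_union_le_of_le hμ ((hM.card j).trans (hmu j).le)
          ((lt_aleph0_of_finite _).le.trans hμ))
        (mk_iUnion_le_of_le hμ (by simpa using hmu j)
          fun x => (lt_aleph0_of_finite _).le.trans hμ))
    (fun j => h0 j) (fun j => hL j) (fun j j' h => hmono h)
    (fun j => (mk_le_of_injective (f := fun x : Iio j => (x.1 : J)) fun x y h =>
      Subtype.ext (Subtype.ext h)).trans (hJmu j)) (fun j => (hmu j).le)
    (fun j => mk_union_le_of_le (h0 j) (hM.card j) ((lt_aleph0_of_finite _).le.trans (h0 j)))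
  -- Levels below `i` are left unchanged: nothing is known there about indiscernibility over `c`.
  let M' : J → Set N := fun j => if h : i ≤ j then M₁ ⟨j, h⟩ else M j
  have hpos : ∀ j (h : i ≤ j), M' j = M₁ ⟨j, h⟩ := fun j h => dif_pos h
  have hneg : ∀ j, ¬ i ≤ j → M' j = M j := fun j h => dif_neg h
  have hMM' : ∀ j, M j ⊆ M' j := fun j => by
    by_cases h : i ≤ j
    · rw [hpos j h]
      exact subset_union_left.trans (hM₁ ⟨j, h⟩).1
    · rw [hneg j h]
  refine ⟨M', ⟨fun a b hab => ?_, fun j => ?_, fun j => ?_, fun j j' h x l => hMM' j' (hM.mem j j' h x l),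
    fun j => ?_⟩, hMM', c, hc, fun l => mem_iUnion.2 ⟨i, ?_⟩⟩
  · by_cases h : i ≤ a
    · rw [hpos a h, hpos b (h.trans hab)]
      exact hM₁mono hab
    · rw [hneg a h]
      exact (hM.mono hab).trans (hMM' b)
  · by_cases h : i ≤ j
    · rw [hpos j h]
      exact (hM₁ ⟨j, h⟩).2.1
    · rw [hneg j h]
      exact hM.meetsDefinable j
  · by_cases h : i ≤ j
    · rw [hpos j h]
      exact (hM₁ ⟨j, h⟩).2.2.1
    · rw [hneg j h]
      exact hM.card j
  · by_cases h : i ≤ j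
    · rw [hpos j h]
      exact ⟨γ ⟨j, h⟩, (hM₁ ⟨j, h⟩).2.2.2⟩
    · rw [hneg j h]
      exact hM.tail j
  · rw [hpos i le_rfl]
    exact (hM₁ ⟨i, le_rfl⟩).1 (Or.inr (mem_range_self l))

end Extension

end Shredding

namespace Shredding

/-! ### The cardinals `mu j`, the decomposition of `μ⁺`, and the base chain -/

section Preparation

open Set

/-- The bound makes the infimum an attained cardinal. `ρ` depends on `m` and may be smaller than
`κ`, which suffices because chains are only built for `ρ` steps. -/
theorem exists_regular_of_kappaShred_le {L : FirstOrder.Language.{u, u}} {T : L.Theory}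
    {κ : Cardinal.{u}} (h : kappaShred T ≤ (κ : WithTop Cardinal.{u})) (m : ℕ) :
    ∃ ρ : Cardinal.{u}, ρ.IsRegular ∧ ρ ≤ κ ∧ ¬ HasShreddingChain T m ρ := by
  have h1 : kappaShredVar T m ≤ (κ : WithTop Cardinal.{u}) :=
    (le_iSup (fun m => kappaShredVar T m) m).trans h
  set S : Set (WithTop Cardinal.{u}) :=
    (↑) '' {κ : Cardinal.{u} | κ.IsRegular ∧ ¬ HasShreddingChain T m κ} with hS
  have hne : S.Nonempty := by
    by_contra hne
    rw [not_nonempty_iff_eq_empty] at hne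
    rw [kappaShredVar, ← hS, hne, _root_.sInf_empty, top_le_iff] at h1
    exact WithTop.coe_ne_top h1
  obtain ⟨ρ, ⟨hρ, hn⟩, hρS⟩ := csInf_mem hne
  refine ⟨ρ, hρ, ?_, hn⟩
  rw [kappaShredVar, ← hS, ← hρS] at h1
  exact WithTop.coe_le_coe.1 h1

theorem exists_cardinal_seq {μ ν : Cardinal.{u}} (hμ : μ.IsSingular) (hν : ν < μ) :
    ∃ mu : μ.ord.cof.ord.ToType → Cardinal.{u}, (∀ j, ν ≤ mu j ∧ mu j < μ) ∧
      (∀ j j', j < j' → Order.succ (mu j) ≤ mu j') ∧ ∀ ν < μ, ∃ j, ν ≤ mu j := by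
  obtain ⟨s, hs, hscard⟩ := Order.exists_cof_eq μ.ord.ToType
  rw [Ordinal.cof_toType] at hscard
  obtain ⟨e⟩ : Nonempty (μ.ord.cof.ord.ToType ≃ s) := by
    rw [← Cardinal.eq, hscard]
    simp
  have hlim : Order.IsSuccLimit μ := hμ.isSuccLimit
  obtain ⟨mu, hmu⟩ := exists_transfinite_choice (ι := μ.ord.cof.ord.ToType) (S := Cardinal.{u})
    (fun j f s => s < μ ∧ ν ≤ s ∧ #(Iio (e j : μ.ord.ToType)) ≤ s ∧ ∀ j', Order.succ (f j') ≤ s) (by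
    intro j f hf
    have h1 : (⨆ j' : Iio j, Order.succ (f j')) < μ :=
      Cardinal.iSup_lt_of_lt_cof_ord (mk_Iio_ord_toType_lt j)
        fun j' => hlim.succ_lt (hf j' j'.2).1
    -- The three terms give the lower bound `ν`, cofinality in `μ` (as `e` enumerates a cofinal
    -- set), and strict growth.
    exact ⟨max (max ν #(Iio (e j : μ.ord.ToType))) (⨆ j' : Iio j, Order.succ (f j')),
      max_lt (max_lt hν (mk_Iio_ord_toType_lt _)) h1, (le_max_left _ _).trans (le_max_left _ _),
      (le_max_right _ _).trans (le_max_left _ _), fun j' =>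
      (le_ciSup (f := fun j' : Iio j => Order.succ (f j')) Cardinal.bddAbove_of_small j').trans (le_max_right _ _)⟩)
  refine ⟨mu, fun j => ⟨(hmu j).2.1, (hmu j).1⟩, fun j j' h => (hmu j').2.2.2 ⟨j, h⟩, ?_⟩
  intro ν hν
  obtain ⟨x, hx⟩ := Ordinal.typein_surj ((· < ·) : μ.ord.ToType → μ.ord.ToType → Prop)
    (o := ν.ord) (by simpa using hν)
  obtain ⟨y, hy, hxy⟩ := hs x
  obtain ⟨j, hj⟩ := e.surjective ⟨y, hy⟩
  refine ⟨j, le_trans ?_ (hmu j).2.2.1⟩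
  have h1 := congrArg Ordinal.card hx
  rw [Cardinal.card_ord] at h1
  have h2 : Ordinal.card (Ordinal.typein ((· < ·) : μ.ord.ToType → μ.ord.ToType → Prop) x) =
    #(Iio x) := rfl
  rw [← h1, h2, hj]
  exact mk_le_mk_of_subset (Iio_subset_Iio hxy)

/-- `exists_coherent_decomposition`, for the well-order of type `μ⁺`. -/
theorem exists_coherent_decomposition_toType {μ : Cardinal.{u}} (hμ : μ.IsSingular)
    (hsq : Square μ) {J : Type u} [LinearOrder J] [Nonempty J] {mu : J → Cardinal.{u}}
    (h0 : ∀ j, ℵ₀ ≤ mu j) (hmono : Monotone mu) (hcof : ∀ ν < μ, ∃ j, ν ≤ mu j) :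
    ∃ S : (Order.succ μ).ord.ToType → J → Set (Order.succ μ).ord.ToType, ∀ b,
      (∀ j, S b j ⊆ Iio b) ∧ (∀ j, #(S b j) ≤ mu j) ∧ Monotone (S b) ∧
      (∀ a < b, ∃ j, a ∈ S b j) ∧ ∀ j, ∀ a ∈ S b j, S a j = S b j ∩ Iio a := by
  obtain ⟨S, hS⟩ := exists_coherent_decomposition hμ hsq h0 hmono hcof
  let o : (Order.succ μ).ord.ToType → Ordinal.{u} := fun b => (Ordinal.ToType.mk.symm b : Iio _)
  have ho : ∀ {a b}, o a < o b ↔ a < b := fun {a b} => by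
    simp only [o, Subtype.coe_lt_coe, OrderIso.lt_iff_lt]
  have hoinj : Function.Injective o := Subtype.val_injective.comp (OrderIso.injective _)
  have hlt : ∀ b, o b < (Order.succ μ).ord := fun b => (Ordinal.ToType.mk.symm b : Iio _).2
  refine ⟨fun b j => o ⁻¹' S (o b) j, fun b => ?_⟩
  have hb := hS (o b) (hlt b)
  refine ⟨fun j a ha => ho.1 (hb.subset j ha), fun j => ?_, fun i j h a ha => hb.mono h ha,
    fun a ha => hb.covers (o a) (ho.2 ha), fun j a ha => ?_⟩
  · have h1 := mk_preimage_of_injective_lift o (S (o b) j) hoinj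
    rw [← Cardinal.lift_le.{u + 1}]
    refine le_trans ?_ ((Cardinal.lift_le.{u}.2 (hb.card j)).trans ?_)
    · simpa using h1
    · simp
  · ext x
    simp only [mem_preimage, mem_inter_iff, mem_Iio, hb.coherent j (o a) ha, ho]

variable {L : FirstOrder.Language.{u, u}} {N : Type u} [L.Structure N]

/-- Finitely many parameters are involved, and their indices precede every `g y`; prepending these
indices to two increasing tuples leaves both increasing. -/
theorem Indiscernible.over_initial {ι : Type*} [LinearOrder ι] {k : ℕ} {b : ι → Fin k → N}
    (h : Indiscernible (L := L) ∅ b) {S : Set ι} {ι' : Type*} [LinearOrder ι'] (g : ι' ↪o ι)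
    (hS : ∀ x ∈ S, ∀ y, x < g y) :
    Indiscernible (L := L) (⋃ x : S, range (b x)) (fun i => b (g i)) := by
  classical
  refine indiscernible_iff.2 fun n D hD s t => ?_
  obtain ⟨A₀, hA₀, hDA₀⟩ := definable_iff_finitely_definable.1 hD
  have h1 : ∀ x : A₀, ∃ y : S, (x : N) ∈ range (b y) := fun x => mem_iUnion.1 (hA₀ x.2)
  choose y hy using h1
  let W : Finset ι := Finset.univ.image fun x : A₀ => (y x : ι)
  have hW : ∀ x ∈ W, x ∈ S := by
    intro x hx
    obtain ⟨z, -, rfl⟩ := Finset.mem_image.1 hx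
    exact (y z).2
  let w := W.orderEmbOfFin rfl
  have hwS : ∀ i, w i ∈ S := fun i => hW _ (W.orderEmbOfFin_mem rfl i)
  let e : Fin W.card × Fin k → N := fun q => b (w q.1) q.2
  have hDe : (∅ ∪ range e).Definable L D := hDA₀.mono fun x hx => by
    obtain ⟨l, hl⟩ := hy ⟨x, hx⟩
    have h2 : (y ⟨x, hx⟩ : ι) ∈ (W : Set ι) := Finset.mem_image_of_mem _ (Finset.mem_univ _)
    rw [← Finset.range_orderEmbOfFin W rfl] at h2
    obtain ⟨i, hi⟩ := h2
    refine Or.inr ⟨(i, l), ?_⟩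
    simp only [e, w, hi]
    exact hl
  obtain ⟨D', hD', rfl⟩ := definable_union_range_iff.1 hDe
  let r : (Fin W.card × Fin k) ⊕ (Fin n × Fin k) → Fin (W.card + n) × Fin k :=
    Sum.elim (fun q => (Fin.castAdd n q.1, q.2)) (fun q => (Fin.natAdd W.card q.1, q.2))
  have happ : ∀ s : Fin n ↪o ι', StrictMono (Fin.append w fun i => g (s i)) := by
    intro s i j hij
    induction i using Fin.addCases with
    | left i =>
      induction j using Fin.addCases with
      | left j =>
        simp only [Fin.append_left]
        exact w.strictMono hij
      | right j =>
        simp only [Fin.append_left, Fin.append_right]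
        exact hS _ (hwS i) _
    | right i =>
      induction j using Fin.addCases with
      | left j =>
        simp only [Fin.lt_def, Fin.val_natAdd, Fin.val_castAdd] at hij
        omega
      | right j =>
        simp only [Fin.append_right]
        exact g.strictMono (s.strictMono (Nat.lt_of_add_lt_add_left hij))
  have key : ∀ s : Fin n ↪o ι', (fun q : Fin (W.card + n) × Fin k =>
      b (OrderEmbedding.ofStrictMono _ (happ s) q.1) q.2) ∘ r =
      Sum.elim e (fun q => b (g (s q.1)) q.2) := by
    intro s
    funext z
    rcases z with z | z <;> simp [r, e]
  have h3 := indiscernible_iff.1 h _ _ (hD'.preimage_comp r) (OrderEmbedding.ofStrictMono _ (happ s))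
    (OrderEmbedding.ofStrictMono _ (happ t))
  simpa only [mem_preimage, mem_ofPred_eq, key] using h3

/-- One independent indiscernible sequence is indexed by the lexicographic sum of the `(mu j)⁺`.
Since `(mu i)⁺ ≤ mu j` for `i < j`, all blocks before `j` fit into a model of size `mu j`. -/
theorem exists_base_chain [Nonempty N] {μ : Cardinal.{u}} (hN : FamilySaturated L N μ) {J : Type u}
    [LinearOrder J] [WellFoundedLT J] [Nonempty J] {mu : J → Cardinal.{u}}
    (h0 : ∀ j, ℵ₀ ≤ mu j) (hL : ∀ j, L.card ≤ mu j) (hmu : ∀ j, mu j < μ)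
    (hlt : ∀ j j', j < j' → Order.succ (mu j) ≤ mu j') (hJmu : ∀ j, #J ≤ mu j) {k s : ℕ}
    {φ : L.Formula (Fin k ⊕ Fin s)}
    (hφ : ∀ n : ℕ, ∃ (a : Fin n → Fin k → N) (b : Set (Fin n) → Fin s → N),
      ∀ i w, φ.Realize (Sum.elim (a i) (b w)) ↔ i ∈ w) :
    ∃ (I : ∀ j, (Order.succ (mu j)).ord.ToType → Fin k → N) (M : J → Set N),
      AdaptedChain L mu I M ∧ ∀ P : ∀ j, Set (Order.succ (mu j)).ord.ToType,
        ∃ d : Fin s → N, ∀ j x, φ.Realize (Sum.elim (I j x) d) ↔ x ∈ P j := by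
  classical
  obtain ⟨j₀⟩ := ‹Nonempty J›
  have hμ : ℵ₀ ≤ μ := (h0 j₀).trans (hmu j₀).le
  have hmono : Monotone mu := fun i j h => by
    rcases h.eq_or_lt with rfl | h
    · exact le_rfl
    · exact (Order.le_succ _).trans (hlt i j h)
  let Y := Σₗ j : J, (Order.succ (mu j)).ord.ToType
  have hY : #Y ≤ μ := by
    have : #Y = #(Σ j : J, (Order.succ (mu j)).ord.ToType) := rfl
    rw [this, mk_sigma]
    refine (sum_le_mk_mul_iSup _).trans ((mul_le_mul' ((hJmu j₀).trans (hmu j₀).le)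
      (ciSup_le' fun j => ?_)).trans (mul_eq_self hμ).le)
    simpa using hmu j
  obtain ⟨I₀, hI₀, hind⟩ := exists_indiscernible_independent hμ hN φ hφ Y hY
  let g : ∀ j, (Order.succ (mu j)).ord.ToType ↪o Y := fun j =>
    OrderEmbedding.ofStrictMono (fun x => toLex ⟨j, x⟩) fun x y h => Sigma.Lex.right _ _ h
  let I : ∀ j, (Order.succ (mu j)).ord.ToType → Fin k → N := fun j x => I₀ (g j x)
  let S : J → Set Y := fun j => {y | (ofLex y).1 < j}
  let B : J → Set N := fun j => ⋃ x : S j, range (I₀ x)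
  have hno : ∀ j, NoMaxOrder (Order.succ (mu j)).ord.ToType := fun j =>
    Cardinal.noMaxOrder ((h0 j).trans (Order.le_succ _))
  have hnonempty : ∀ j, Nonempty (Order.succ (mu j)).ord.ToType := fun j => by
    rw [← mk_ne_zero_iff]
    simp
  have hIB : ∀ j j', j < j' → ∀ i l, I j i l ∈ B j' := fun j j' h i l =>
    mem_iUnion.2 ⟨⟨g j i, h⟩, mem_range_self _⟩
  have hBI : ∀ j, Indiscernible (L := L) (B j) (I j) := fun j =>
    hI₀.over_initial (S := S j) (g j) fun x hx y => by
      obtain ⟨i, z⟩ := x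
      exact Sigma.Lex.left _ _ hx
  have hfin : ∀ y : Y, ∀ ν, ℵ₀ ≤ ν → #(range (I₀ y)) ≤ ν := fun y ν h =>
    (lt_aleph0_of_finite _).le.trans h
  obtain ⟨M, hM, hM'⟩ := exists_model_chain (ι := fun j => (Order.succ (mu j)).ord.ToType)
    (I := I) (B := B) (A := ⋃ y, range (I₀ y)) (mu := mu) hN
    (fun j => by
      obtain ⟨f, hf⟩ := Nat.exists_strictMono (Order.succ (mu j)).ord.ToType
      exact ⟨OrderEmbedding.ofStrictMono f hf⟩)
    (fun i j h => iUnion_subset fun x => subset_iUnion (fun x : S j => range (I₀ x))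
      ⟨x, lt_of_lt_of_le x.2 h⟩) hBI hIB
    (fun j => iUnion_subset fun x => subset_iUnion (fun y => range (I₀ y)) _)
    (fun j x l => mem_iUnion.2 ⟨g j x, mem_range_self _⟩)
    (mk_iUnion_le_of_le hμ hY fun y => hfin y _ hμ) h0 hL hmono
    (fun j => (mk_set_le _).trans (hJmu j)) (fun j => (hmu j).le)
    (fun j => mk_iUnion_le_of_le (h0 j) (by
      have h1 : #(S j) ≤ #(Σ i : Iio j, (Order.succ (mu i)).ord.ToType) :=
        mk_le_of_surjective (f := fun z => ⟨toLex ⟨z.1.1, z.2⟩, z.1.2⟩)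
          fun y => ⟨⟨⟨(ofLex y.1).1, y.2⟩, (ofLex y.1).2⟩, rfl⟩
      rw [mk_sigma] at h1
      refine h1.trans ((sum_le_mk_mul_iSup _).trans ((mul_le_mul' ((mk_set_le _).trans (hJmu j))
        (ciSup_le' fun i => ?_)).trans (mul_eq_self (h0 j)).le))
      simpa using Order.succ_le_iff.1 (hlt i j i.2)) fun x => hfin _ _ (h0 j))
  refine ⟨I, M, ⟨hM, fun j => (hM' j).2.1, fun j => (hM' j).2.2.1,
    fun j j' h i l => (hM' j').1 (hIB j j' h i l), fun j => ?_⟩, fun P => ?_⟩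
  · obtain ⟨γ⟩ := hnonempty j
    exact ⟨γ, (hM' j).2.2.2.tail⟩
  · let P' : Set Y := {y | (ofLex y).2 ∈ P (ofLex y).1}
    let C : Y → Set (Fin s → N) := fun y => {d | φ.Realize (Sum.elim (I₀ y) d) ↔ y ∈ P'}
    obtain ⟨d, hd⟩ := hN.exists_mem_sInter hμ (⋃ y, range (I₀ y)) (range C)
      (mk_iUnion_le_of_le hμ hY fun y => hfin y _ hμ) (by
      rintro _ ⟨y, rfl⟩
      refine definable_iff (E := {_d | y ∈ P'})
        (definable_realize φ fun i => mem_iUnion.2 ⟨y, mem_range_self i⟩) ?_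
      by_cases hy : y ∈ P'
      · rw [show {_d : Fin s → N | y ∈ P'} = Set.univ from eq_univ_of_forall fun _ => hy]
        exact definable_univ
      · rw [show {_d : Fin s → N | y ∈ P'} = ∅ from eq_empty_of_forall_notMem fun _ => hy]
        exact definable_empty) (by
      intro F₀ hF₀ hsub
      rw [← image_univ] at hsub
      obtain ⟨G, -, hGfin, rfl⟩ := exists_subset_image_finite_and.1 ⟨F₀, hsub, hF₀, rfl⟩
      obtain ⟨d, hd⟩ := hind hGfin.toFinset P'
      refine ⟨d, ?_⟩
      rintro _ ⟨y, hy, rfl⟩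
      exact hd y (hGfin.mem_toFinset.2 hy))
    exact ⟨d, fun j x => hd _ ⟨g j x, rfl⟩⟩

end Preparation

end Shredding

namespace Shredding

/-! ### Saturation in terms of families of definable sets -/

section Transfer

open Set

variable {L : FirstOrder.Language.{u, u}} {N : Type u} [L.Structure N]

theorem realize_constantsVarsEquiv_symm_coe (E : L.ElementarySubstructure N) {A : Set E} {m : ℕ}
    (ψ : L.Formula (A ⊕ Fin m)) (v : Fin m → E) :
    Formula.Realize (L := L[[A]])
        (BoundedFormula.constantsVarsEquiv.symm ψ : L[[A]].Formula (Fin m)) v ↔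
      ψ.Realize (Sum.elim (fun a : A => ((a : E) : N)) (fun i => (v i : N))) := by
  have h1 := realize_constantsVarsEquiv_symm (fun a : A => (a : E)) ψ v
  have h2 := E.subtype.map_formula ψ (Sum.elim (fun a : A => (a : E)) v)
  refine h1.trans (h2.symm.trans (iff_of_eq ?_))
  congr 1
  funext z
  rcases z with z | z <;> rfl

theorem saturated_of_forall [Nonempty N] {μ : Cardinal.{u}} (hN : FamilySaturated L N μ) (h0 : ℵ₀ < μ)
    (hL : L.card < μ) (E : L.ElementarySubstructure N)
    (h : ∀ (m : ℕ) (A : Set N) (p : Set (Set (Fin m → N))), A ⊆ E → #A < μ → #p < μ →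
      (∀ D ∈ p, A.Definable L D) → (⋂₀ p).Nonempty → ∃ c ∈ ⋂₀ p, ∀ l, c l ∈ E) :
    Saturated L E μ := by
  classical
  intro A hA m p
  let S : L.Formula (A ⊕ Fin m) → Set (Fin m → N) := fun ψ =>
    {v | ψ.Realize (Sum.elim (fun a : A => ((a : E) : N)) v)}
  let θ : L.Formula (A ⊕ Fin m) → L[[A]].Formula (Fin m) := fun ψ =>
    BoundedFormula.constantsVarsEquiv.symm ψ
  let Q : Set (L.Formula (A ⊕ Fin m)) := {ψ | Formula.equivSentence (θ ψ) ∈ p}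
  let A' : Set N := (fun a : E => (a : N)) '' A
  have hA' : #A' < μ := mk_image_le.trans_lt hA
  have hdef : ∀ ψ, A'.Definable L (S ψ) := fun ψ => by
    refine definable_iff_exists_formula_sum.2
      ⟨ψ.relabel (Sum.map (fun a : A => ⟨a, mem_image_of_mem _ a.2⟩) id), ?_⟩
    ext v
    simp only [S, mem_ofPred_eq, Formula.realize_relabel]
    refine iff_of_eq (congrArg _ ?_)
    funext z
    rcases z with z | z <;> rfl
  have hcard : #(S '' Q) < μ := by
    refine lt_of_le_of_lt ((mk_le_mk_of_subset ?_).trans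
      (mk_definable_fin_le (L := L) (A := A') (κ := max ℵ₀ (max L.card #A')) (le_max_left _ _)
      ((le_max_left _ _).trans (le_max_right _ _)) ((le_max_right _ _).trans (le_max_right _ _)) m))
      (max_lt h0 (max_lt hL hA'))
    rintro _ ⟨ψ, -, rfl⟩
    exact hdef ψ
  obtain ⟨K, hK⟩ := Theory.exists_modelType_is_realized_in _ p
  obtain ⟨v, hv⟩ := hK
  have hne : (⋂₀ (S '' Q)).Nonempty := by
    refine hN.exists_mem_sInter h0.le A' (S '' Q) hA'.le
      (by rintro _ ⟨ψ, -, rfl⟩; exact hdef ψ) fun F₀ hF₀ hsub => ?_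
    obtain ⟨G, hGQ, hGfin, rfl⟩ := exists_subset_image_finite_and.1 ⟨F₀, hsub, hF₀, rfl⟩
    have : Finite G := hGfin
    let χ : L[[A]].Formula (Fin m) := Formula.iInf fun ψ : G => θ ψ
    let σ : L[[A]].Sentence := (χ.relabel (Sum.inr : Fin m → Empty ⊕ Fin m)).iExs (Fin m)
    have hσK : K ⊨ σ := by
      simp only [σ, Sentence.Realize, Formula.realize_iExs, Formula.realize_relabel, χ,
        Formula.realize_iInf]
      refine ⟨v, fun ψ => ?_⟩
      have h1 : Formula.equivSentence (θ ψ) ∈ p := hGQ ψ.2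
      rw [← hv, Theory.CompleteType.formula_mem_typeOf] at h1
      exact h1
    have hσE : E ⊨ σ := by
      by_contra hn
      have h1 : K ⊨ σ.not := K.is_model.realize_of_mem _
        (show σ.not ∈ L[[A]].completeTheory E from hn)
      exact h1 hσK
    simp only [σ, Sentence.Realize, Formula.realize_iExs, Formula.realize_relabel, χ,
        Formula.realize_iInf] at hσE
    obtain ⟨c, hc⟩ := hσE
    refine ⟨fun i => c i, ?_⟩
    rintro _ ⟨ψ, hψ, rfl⟩
    exact (realize_constantsVarsEquiv_symm_coe E ψ c).1 (hc ⟨ψ, hψ⟩)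
  obtain ⟨c, hc, hcE⟩ := h m A' (S '' Q) (by rintro _ ⟨a, -, rfl⟩; exact a.2) hA' hcard
    (by rintro _ ⟨ψ, -, rfl⟩; exact hdef ψ) hne
  let c' : Fin m → E := fun l => ⟨c l, hcE l⟩
  have hsub : ∀ σ, σ ∈ p → σ ∈ (L[[A]].completeTheory E).typeOf c' := by
    intro σ hσ
    obtain ⟨θ', rfl⟩ := Formula.equivSentence.surjective σ
    obtain ⟨ψ, rfl⟩ : ∃ ψ, θ ψ = θ' := BoundedFormula.constantsVarsEquiv.symm.surjective θ'
    rw [Theory.CompleteType.formula_mem_typeOf]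
    exact (realize_constantsVarsEquiv_symm_coe E ψ c').2 (hc _ ⟨ψ, hσ, rfl⟩)
  refine ⟨c', SetLike.ext fun σ => ⟨fun hσ => ?_, hsub σ⟩⟩
  -- An inclusion between complete types is an equality.
  by_contra hn
  exact ((L[[A]].completeTheory E).typeOf c').not_mem_iff σ |>.1
    (hsub _ ((p.not_mem_iff σ).2 hn)) hσ

theorem not_saturated_of_forall [Nonempty N] {κ : Cardinal.{u}} (E : L.ElementarySubstructure N) (A : Set E)
    (hA : #A < κ) {s : ℕ} (d : Fin s → N)
    (h : ∀ v : Fin s → E, ¬ TypeEq L ((fun a : E => (a : N)) '' A) d (fun i => (v i : N))) :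
    ¬ Saturated L E κ := by
  intro hsat
  let _ : (constantsOn A).Structure N := constantsOn.structure fun a : A => ((a : E) : N)
  have hmodel : N ⊨ L[[A]].completeTheory E := by
    refine ⟨fun σ hσ => ?_⟩
    obtain ⟨ψ, rfl⟩ := Formula.equivSentence.surjective σ
    rw [mem_completeTheory, Formula.realize_equivSentence] at hσ
    rw [Formula.realize_equivSentence]
    exact (E.subtype.map_formula ψ _).2 hσ
  obtain ⟨v, hv⟩ := hsat A hA s ((L[[A]].completeTheory E).typeOf d)
  refine h v fun D hD => ?_
  obtain ⟨χ, rfl⟩ := definable_iff_exists_formula_sum.1 hD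
  have h1 : ∀ x : (fun a : E => (a : N)) '' A, ∃ a : A, ((a : E) : N) = x := fun x => by
    obtain ⟨a, ha, hx⟩ := x.2
    exact ⟨⟨a, ha⟩, hx⟩
  choose g hg using h1
  let ψ : L.Formula (A ⊕ Fin s) := χ.relabel (Sum.map g id)
  have hψ : ∀ w : Fin s → N, ψ.Realize (Sum.elim (fun a : A => ((a : E) : N)) w) ↔
      χ.Realize (Sum.elim (↑) w) := by
    intro w
    simp only [ψ, Formula.realize_relabel]
    refine iff_of_eq (congrArg _ ?_)
    funext z
    rcases z with z | z
    · exact hg z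
    · rfl
  have h2 : Formula.equivSentence (BoundedFormula.constantsVarsEquiv.symm ψ : L[[A]].Formula (Fin s)) ∈
      (L[[A]].completeTheory E).typeOf v ↔ Formula.equivSentence
        (BoundedFormula.constantsVarsEquiv.symm ψ : L[[A]].Formula (Fin s)) ∈
      (L[[A]].completeTheory E).typeOf d := by rw [hv]
  rw [Theory.CompleteType.formula_mem_typeOf, Theory.CompleteType.formula_mem_typeOf,
    realize_constantsVarsEquiv_symm_coe] at h2
  have h3 := realize_constantsVarsEquiv_symm (fun a : A => ((a : E) : N)) ψ d
  exact ((hψ d).symm.trans (h3.symm.trans (h2.symm.trans (hψ _))))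

end Transfer

/-! ### Unions of adapted chains, and a list of all types over a set -/

section Union

open Set

variable {L : FirstOrder.Language.{u, u}} {N : Type u} [L.Structure N] {J : Type u}
  [LinearOrder J] {mu : J → Cardinal.{u}} {k : ℕ}
  {I : ∀ j, (Order.succ (mu j)).ord.ToType → Fin k → N} {M : J → Set N}

/-- At level `j` at most `mu j` end segments of `I j` must be intersected, and `(mu j)⁺` is regular.
The term `M j` matters only where `S j` is empty. -/
theorem AdaptedChain.union (hM : AdaptedChain L mu I M) (h0 : ∀ j, ℵ₀ ≤ mu j) {U : Type u}
    [LinearOrder U] {f : U → J → Set N} {S : J → Set U} (hS : Monotone S) (hScard : ∀ j, #(S j) ≤ mu j)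
    (hf : ∀ j, ∀ a ∈ S j, AdaptedChain L mu I (f a)) (hMf : ∀ j, ∀ a ∈ S j, M j ⊆ f a j)
    (hmono : ∀ j, ∀ a ∈ S j, ∀ b ∈ S j, a < b → f a j ⊆ f b j) :
    AdaptedChain L mu I (fun j => M j ∪ ⋃ a : S j, f a j) := by
  have hmono' : ∀ j, Monotone fun a : S j => f a j := fun j a b hab => by
    rcases hab.eq_or_lt with rfl | h
    · exact le_rfl
    · exact hmono j a a.2 b b.2 h
  have hcases : ∀ j, (IsEmpty (S j) ∧ M j ∪ ⋃ a : S j, f a j = M j) ∨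
      (Nonempty (S j) ∧ M j ∪ ⋃ a : S j, f a j = ⋃ a : S j, f a j) := by
    intro j
    rcases isEmpty_or_nonempty (S j) with h | h
    · exact Or.inl ⟨h, by simp⟩
    · obtain ⟨a⟩ := h
      exact Or.inr ⟨⟨a⟩, union_eq_self_of_subset_left
        ((hMf j a a.2).trans (subset_iUnion (fun a : S j => f a j) a))⟩
  refine ⟨fun i j h => union_subset_union (hM.mono h) (iUnion_subset fun a => ?_), fun j => ?_,
    fun j => ?_, fun j j' h i l => Or.inl (hM.mem j j' h i l), fun j => ?_⟩
  · exact ((hf i a a.2).mono h).trans (subset_iUnion (fun a : S j => f a j) ⟨a, hS h a.2⟩)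
  · rcases hcases j with ⟨-, he⟩ | ⟨hne, he⟩
    · simp only [he]
      exact hM.meetsDefinable j
    · simp only [he]
      exact meetsDefinable_iUnion (hmono' j) fun a => (hf j a a.2).meetsDefinable j
  · exact mk_union_le_of_le (h0 j) (hM.card j)
      (mk_iUnion_le_of_le (h0 j) (hScard j) fun a => (hf j a a.2).card j)
  · rcases hcases j with ⟨-, he⟩ | ⟨hne, he⟩
    · simp only [he]
      exact hM.tail j
    · simp only [he]
      choose γ hγ using fun a : S j => (hf j a a.2).tail j
      obtain ⟨δ, hδ⟩ := bddAbove_of_mk_lt (isRegular_succ (h0 j)) (s := range γ)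
        (mk_range_le.trans_lt (Order.lt_succ_of_le (hScard j)))
      exact ⟨δ, indiscernible_iUnion (hmono' j) fun a =>
        (hγ a).tail_le (b := I j) (hδ _ (mem_range_self a)).le⟩

/-- All families of definable sets over a small set can be listed in order type `μ⁺`. -/
theorem exists_enumeration {μ : Cardinal.{u}} (h0 : ℵ₀ ≤ μ) (hL : L.card ≤ μ)
    (hexp : 2 ^ μ = Order.succ μ) (X : Set N) (hX : #X ≤ μ) :
    ∃ e : (Order.succ μ).ord.ToType → Σ m : ℕ, Set (Set (Fin m → N)),
      ∀ (m : ℕ) (p : Set (Set (Fin m → N))), (∀ D ∈ p, X.Definable L D) → ∃ w, e w = ⟨m, p⟩ := by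
  classical
  let Y := Σ m : ℕ, Set {D : Set (Fin m → N) // X.Definable L D}
  have hY : #Y ≤ #(Order.succ μ).ord.ToType := by
    rw [mk_sigma, mk_ord_toType]
    have h1 : ∀ m : ℕ, #(Set {D : Set (Fin m → N) // X.Definable L D}) ≤ Order.succ μ := fun m => by
      rw [mk_set, ← hexp]
      exact power_le_power_left two_ne_zero (mk_definable_fin_le h0 hL hX m)
    refine (sum_le_sum _ _ h1).trans ?_
    rw [sum_const]
    simp only [mk_nat, lift_aleph0, Cardinal.lift_uzero]
    exact (mul_le_mul' (h0.trans (Order.le_succ μ)) le_rfl).trans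
      (mul_eq_self (h0.trans (Order.le_succ μ))).le
  obtain ⟨⟨g, hg⟩⟩ := hY
  have : Nonempty Y := ⟨⟨0, ∅⟩⟩
  refine ⟨fun w => ⟨(Function.invFun g w).1, (↑) '' (Function.invFun g w).2⟩, fun m p hp => ?_⟩
  refine ⟨g ⟨m, (↑) ⁻¹' p⟩, ?_⟩
  beta_reduce
  rw [Function.leftInverse_invFun hg]
  congr 1
  ext D
  exact ⟨by rintro ⟨E, hE, rfl⟩; exact hE, fun hD => ⟨⟨D, hp D hD⟩, hD, rfl⟩⟩

end Union

end Shredding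

namespace Shredding

/-! ### The construction of length `μ⁺` and the omitted type -/

section Construction

open Set

variable {L : FirstOrder.Language.{u, u}} {T : L.Theory} {N : Theory.ModelType.{u, u, u} T}
  {μ κ : Cardinal.{u}} {J : Type u} [LinearOrder J] [WellFoundedLT J] {mu : J → Cardinal.{u}}
  {k : ℕ} {I : ∀ j, (Order.succ (mu j)).ord.ToType → Fin k → N} {M : J → Set N}

/-- A base chain can be closed off to a model that realizes all types over small subsets, such that
an end segment of some `I j` is indiscernible over each finite tuple of the model. -/
theorem AdaptedChain.exists_saturated [Nonempty J] (hN : FamilySaturated L N μ)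
    (hμ : μ.IsSingular) (hsq : Square μ) (hexp : 2 ^ μ = Order.succ μ)
    (hM : AdaptedChain L mu I M) (hT : ∀ j, theoryCard T ≤ mu j) (hmu : ∀ j, mu j < μ)
    (hlt : ∀ j j', j < j' → Order.succ (mu j) ≤ mu j') (hcof : ∀ ν < μ, ∃ j, ν ≤ mu j)
    (hJmu : ∀ j, #J ≤ mu j) (hJ : ∀ s : Set J, #s < κ → ∃ b, ∀ x ∈ s, x < b)
    (hsh : ∀ m, ∃ ρ : Cardinal.{u}, ρ.IsRegular ∧ ρ ≤ κ ∧ ¬ HasShreddingChain T m ρ) :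
    ∃ K : Set N, L.MeetsDefinable K ∧ (∀ j, M j ⊆ K) ∧
      (∀ (m : ℕ) (v : Fin m → N), (∀ l, v l ∈ K) → ∃ j, ∃ γ : (Order.succ (mu j)).ord.ToType,
        Indiscernible (L := L) (∅ ∪ range v) (fun i : Ici γ => I j i)) ∧
      ∀ (m : ℕ) (A : Set N) (p : Set (Set (Fin m → N))), A ⊆ K → #A < μ → #p < μ →
        (∀ D ∈ p, A.Definable L D) → (⋂₀ p).Nonempty → ∃ c ∈ ⋂₀ p, ∀ l, c l ∈ K := by
  classical
  obtain ⟨j₀⟩ := ‹Nonempty J›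
  have h0 : ∀ j, ℵ₀ ≤ mu j := fun j => (le_max_left _ _).trans (hT j)
  have hL : ∀ j, L.card ≤ mu j := fun j => (le_max_right _ _).trans (hT j)
  have hμ0 : ℵ₀ ≤ μ := (h0 j₀).trans (hmu j₀).le
  have hmono : Monotone mu := fun i j h => by
    rcases h.eq_or_lt with rfl | h
    · exact le_rfl
    · exact (Order.le_succ _).trans (hlt i j h)
  let U := (Order.succ μ).ord.ToType
  have hU : Nonempty U := by
    rw [← mk_ne_zero_iff]
    simp [U]
  obtain ⟨S, hS⟩ := exists_coherent_decomposition_toType hμ hsq h0 hmono hcof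
  -- A pair `(a, w)` asks for a realization of the `w`-th type over the union of stage `a`.
  obtain ⟨t, ht⟩ := exists_bookkeeping hμ0 (W := U × U) (by
    simpa [U] using (mul_eq_self (hμ0.trans (Order.le_succ μ))).le)
  have hen : ∀ X : Set N, ∃ e : U → Σ m : ℕ, Set (Set (Fin m → N)), #X ≤ μ →
      ∀ (m : ℕ) (p : Set (Set (Fin m → N))), (∀ D ∈ p, X.Definable L D) → ∃ w, e w = ⟨m, p⟩ := by
    intro X
    by_cases hX : #X ≤ μ
    · obtain ⟨e, he⟩ := exists_enumeration hμ0 ((hL j₀).trans (hmu j₀).le) hexp X hX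
      exact ⟨e, fun _ => he⟩
    · exact ⟨fun _ => ⟨0, ∅⟩, fun h => absurd h hX⟩
  choose e he using hen
  obtain ⟨F, hF⟩ := exists_transfinite_choice (ι := U) (S := J → Set N)
    (fun b f s => AdaptedChain L mu I s ∧ (∀ j, M j ⊆ s j) ∧
      (∀ (a : Iio b) (j : J), (a : U) ∈ S b j → f a j ⊆ s j) ∧
      ∀ (a : Iio b) (w : U), t b = (a.1, w) → (⋂₀ (e (⋃ j, f a j) w).2).Nonempty →
        (∀ D ∈ (e (⋃ j, f a j) w).2, (⋃ j, f a j).Definable L D) → #(e (⋃ j, f a j) w).2 < μ →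
        ∃ c ∈ ⋂₀ (e (⋃ j, f a j) w).2, ∀ l, c l ∈ ⋃ j, s j) (by
    intro b f hf
    obtain ⟨hSb, hScard, hSmono, hScov, hScoh⟩ := hS b
    let pre : J → Set N := fun j => M j ∪ ⋃ a : S b j, f a j
    have hpre : AdaptedChain L mu I pre := hM.union h0 hSmono hScard
      (fun j a ha => (hf a (hSb j ha)).1) (fun j a ha => (hf a (hSb j ha)).2.1 j)
      fun j a ha a' ha' h => (hf a' (hSb j ha')).2.2.1 ⟨a, h⟩ j (by
        rw [hScoh j a' ha']
        exact ⟨ha, h⟩)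
    have hfpre : ∀ (a : Iio b) (j : J), (a : U) ∈ S b j → f a j ⊆ pre j := fun a j ha =>
      (subset_iUnion (fun a : S b j => f a j) ⟨a, ha⟩).trans subset_union_right
    by_cases H : ∃ (a : Iio b) (w : U), t b = (a.1, w) ∧ (⋂₀ (e (⋃ j, f a j) w).2).Nonempty ∧
        (∀ D ∈ (e (⋃ j, f a j) w).2, (⋃ j, f a j).Definable L D) ∧ #(e (⋃ j, f a j) w).2 < μ
    · obtain ⟨a, w, htb, hne, hdef, hcard⟩ := H
      -- Stage `a` is absorbed only at levels from some `i` on, which suffices for the unions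
      -- because its models increase with `j`.
      have haU : (⋃ j, f a j) ⊆ ⋃ j, pre j := by
        obtain ⟨i, hi⟩ := hScov a a.2
        refine iUnion_subset fun j => ?_
        exact ((hf a a.2).1.mono (le_max_left j i)).trans ((hfpre a _ (hSmono (le_max_right j i) hi)).trans
          (subset_iUnion pre _))
      obtain ⟨ρ, hρ, hρκ, hρsh⟩ := hsh (e (⋃ j, f a j) w).1
      obtain ⟨i₀, hi₀⟩ := hcof _ hcard
      obtain ⟨s, hs, hpres, c, hc, hcs⟩ := hpre.exists_extension hN hT hmu hlt hJmu hJ hρ hρκ hρsh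
        (fun D hD => (hdef D hD).mono haU) hne i₀ hi₀
      refine ⟨s, hs, fun j => subset_union_left.trans (hpres j),
        fun a j ha => (hfpre a j ha).trans (hpres j), fun a' w' htb' _ _ _ => ?_⟩
      have heq := htb.symm.trans htb'
      obtain rfl : a = a' := Subtype.ext (congrArg Prod.fst heq)
      obtain rfl : w = w' := congrArg Prod.snd heq
      exact ⟨c, hc, hcs⟩
    · exact ⟨pre, hpre, fun j => subset_union_left, hfpre, fun a w h1 h2 h3 h4 =>
        absurd ⟨a, w, h1, h2, h3, h4⟩ H⟩)
  let V : U → Set N := fun a => ⋃ j, F a j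
  have hVcard : ∀ a, #(V a) ≤ μ := fun a => mk_iUnion_le_of_le hμ0 ((hJmu j₀).trans (hmu j₀).le)
    fun j => ((hF a).1.card j).trans (hmu j).le
  have hVmono : Monotone V := by
    intro a b hab
    rcases hab.eq_or_lt with rfl | h
    · exact le_rfl
    · obtain ⟨-, -, hSmono, hScov, -⟩ := hS b
      obtain ⟨i, hi⟩ := hScov a h
      exact iUnion_subset fun j => ((hF a).1.mono (le_max_left j i)).trans
        (((hF b).2.2.1 ⟨a, h⟩ _ (hSmono (le_max_right j i) hi)).trans (subset_iUnion (F b) _))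
  obtain ⟨a₀⟩ := id hU
  refine ⟨⋃ a, V a, meetsDefinable_iUnion hVmono fun a => meetsDefinable_iUnion (hF a).1.mono
    (hF a).1.meetsDefinable, fun j => ?_, fun m v hv => ?_, fun m A p hA hAμ hpμ hp hne => ?_⟩
  · exact ((hF a₀).2.1 j).trans ((subset_iUnion (F a₀) j).trans (subset_iUnion V a₀))
  · choose a ha using fun l => mem_iUnion.1 (hv l)
    obtain ⟨b, hb⟩ := Finite.exists_le a
    choose j hj using fun l => mem_iUnion.1 (hVmono (hb l) (ha l))
    obtain ⟨i, hi⟩ := Finite.exists_le j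
    obtain ⟨γ, hγ⟩ := (hF b).1.tail i
    refine ⟨i, γ, hγ.mono (union_subset (empty_subset _) ?_)⟩
    rintro _ ⟨l, rfl⟩
    exact (hF b).1.mono (hi l) (hj l)
  · choose a ha using fun x : A => mem_iUnion.1 (hA x.2)
    -- By regularity of `μ⁺`, the small set `A` already lies in a single stage.
    obtain ⟨b, hb⟩ := bddAbove_of_mk_lt (isRegular_succ hμ0) (s := range a)
      (mk_range_le.trans_lt (hAμ.trans (Order.lt_succ μ)))
    have hAb : A ⊆ V b := fun x hx => hVmono (hb _ (mem_range_self ⟨x, hx⟩)).le (ha ⟨x, hx⟩)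
    have hpb : ∀ D ∈ p, (V b).Definable L D := fun D hD => (hp D hD).mono hAb
    obtain ⟨w, hw⟩ := he (V b) (hVcard b) m p hpb
    obtain ⟨b', hbb', htb'⟩ := ht (b, w) b
    have h1 : ∀ q, e (V b) w = q → (⋂₀ q.2).Nonempty → (∀ D ∈ q.2, (V b).Definable L D) →
        #q.2 < μ → ∃ c ∈ ⋂₀ q.2, ∀ l, c l ∈ V b' := by
      rintro _ rfl
      exact (hF b').2.2.2 ⟨b, hbb'⟩ w htb'
    obtain ⟨c, hc, hcV⟩ := h1 ⟨m, p⟩ hw hne hpb hpμ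
    exact ⟨c, hc, fun l => mem_iUnion.2 ⟨b', hcV l⟩⟩

theorem exists_exactlySaturated (T : L.Theory) (hT : T.IsComplete) (hIP : HasIP T) (μ : Cardinal.{u})
    (hμ : μ.IsSingular) (hTμ : theoryCard T < μ)
    (hcof : kappaShred T ≤ (μ.ord.cof : WithTop Cardinal.{u})) (hsq : Square μ)
    (hexp : 2 ^ μ = Order.succ μ) :
    ∃ M : Theory.ModelType.{u, u, u} T, ExactlySaturated L M μ := by
  classical
  have hμ0 : ℵ₀ < μ := (le_max_left _ _).trans_lt hTμ
  have hLμ : L.card < μ := (le_max_right _ _).trans_lt hTμ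
  obtain ⟨N, hN⟩ := exists_familySaturated T hT.1 μ hTμ.le hexp
  obtain ⟨k, s, φ, hφ⟩ := hIP.exists_pattern hT N
  let J := μ.ord.cof.ord.ToType
  have hκreg : μ.ord.cof.IsRegular := isRegular_cof (isSuccLimit_ord hμ0.le)
  have hJne : Nonempty J := by
    rw [← mk_ne_zero_iff]
    simpa [J] using hκreg.pos.ne'
  obtain ⟨mu, hmu, hlt, hmucof⟩ := exists_cardinal_seq hμ (max_lt hTμ hμ.cof_ord_lt)
  have hTmu : ∀ j, theoryCard T ≤ mu j := fun j => (le_max_left _ _).trans (hmu j).1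
  have h0 : ∀ j, ℵ₀ ≤ mu j := fun j => (le_max_left _ _).trans (hTmu j)
  have hJmu : ∀ j, #J ≤ mu j := fun j => by
    simpa [J] using (le_max_right _ _).trans (hmu j).1
  obtain ⟨j₀⟩ := id hJne
  obtain ⟨I, M, hM, hI⟩ := exists_base_chain hN h0 (fun j => (le_max_right _ _).trans (hTmu j))
    (fun j => (hmu j).2) hlt hJmu hφ
  obtain ⟨K, hK, hMK, hKI, hKsat⟩ := hM.exists_saturated hN hμ hsq hexp hTmu (fun j => (hmu j).2) hlt
    hmucof hJmu (fun _ hs => bddAbove_of_mk_lt hκreg hs) (exists_regular_of_kappaShred_le hcof)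
  let E := hK.toElementarySubstructure
  have hE : ∀ x, x ∈ E ↔ x ∈ K := fun x => by
    rw [← SetLike.mem_coe, coe_toElementarySubstructure]
  refine ⟨Theory.ModelType.of T E, ?_, ?_⟩
  · refine saturated_of_forall hN hμ0 hLμ E fun m A p hA hAμ hpμ hp hne => ?_
    obtain ⟨c, hc, hcK⟩ := hKsat m A p (fun x hx => (hE x).1 (hA hx)) hAμ hpμ hp hne
    exact ⟨c, hc, fun l => (hE _).2 (hcK l)⟩
  -- `P j` and its complement are both cofinal, so no end segment of `I j` is indiscernible over a
  -- tuple `v` for which `φ(x; v)` defines `P j` along `I j`.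
  · have hcol : ∀ j, ∃ P : Set (Order.succ (mu j)).ord.ToType, ∀ γ,
        (∃ x, γ ≤ x ∧ x ∈ P) ∧ ∃ x, γ ≤ x ∧ x ∉ P := by
      intro j
      obtain ⟨t, ht⟩ := exists_bookkeeping (h0 j) (W := ULift.{u} Prop)
        ((lt_aleph0_of_finite _).le.trans ((h0 j).trans (Order.le_succ _)))
      refine ⟨{x | (t x).down}, fun γ => ⟨?_, ?_⟩⟩
      · obtain ⟨x, hx, h⟩ := ht ⟨True⟩ γ
        exact ⟨x, hx.le, by simp [h]⟩
      · obtain ⟨x, hx, h⟩ := ht ⟨False⟩ γ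
        exact ⟨x, hx.le, by simp [h]⟩
    choose P hP using hcol
    obtain ⟨d, hd⟩ := hI P
    have hIK : ∀ j i l, I j i l ∈ E := fun j i l => by
      obtain ⟨j', hj'⟩ := bddAbove_of_mk_lt hκreg (s := {j})
        ((lt_aleph0_of_finite _).trans_le hκreg.aleph0_le)
      exact (hE _).2 (hMK j' (hM.mem j j' (hj' j rfl) i l))
    let A : Set E := ⋃ j, ⋃ i, range fun l => ⟨I j i l, hIK j i l⟩
    have hA : #A ≤ μ := by
      refine mk_iUnion_le_of_le hμ0.le ((hJmu j₀).trans (hmu j₀).2.le) fun j =>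
        mk_iUnion_le_of_le hμ0.le (by simpa using (hmu j).2) fun i => ?_
      exact (lt_aleph0_of_finite _).le.trans hμ0.le
    refine not_saturated_of_forall E A (Order.lt_succ_of_le hA) d fun v hv => ?_
    obtain ⟨j, γ, hγ⟩ := hKI s (fun i => (v i : N)) fun i => (hE _).1 (v i).2
    have hiff : ∀ x, φ.Realize (Sum.elim (I j x) fun i => (v i : N)) ↔ x ∈ P j := fun x => by
      rw [← hd j x]
      refine (hv {w | φ.Realize (Sum.elim (I j x) w)} (definable_realize φ fun l => ?_)).symm
      exact ⟨⟨I j x l, hIK j x l⟩, mem_iUnion.2 ⟨j, mem_iUnion.2 ⟨x, mem_range_self l⟩⟩, rfl⟩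
    obtain ⟨⟨x, hx, hxP⟩, y, hy, hyP⟩ := hP j γ
    let D : Set (Fin s ⊕ Fin 1 × Fin k → N) :=
      {w | φ.Realize (Sum.elim (fun l => w (Sum.inr (0, l))) (fun i => w (Sum.inl i)))}
    have hD : (∅ : Set N).Definable L D := by
      refine empty_definable_iff.2
        ⟨φ.relabel (Sum.elim (fun l => Sum.inr (0, l)) (fun i => Sum.inl i)), ?_⟩
      ext w
      simp only [D, mem_ofPred_eq, Formula.realize_relabel]
      refine iff_of_eq (congrArg _ ?_)
      funext z
      rcases z with z | z <;> rfl
    have h1 := indiscernible_union_range_iff.1 hγ 1 D hD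
      (OrderEmbedding.ofStrictMono (fun _ => ⟨x, hx⟩) (Subsingleton.strictMono _))
      (OrderEmbedding.ofStrictMono (fun _ => ⟨y, hy⟩) (Subsingleton.strictMono _))
    exact hyP ((hiff y).1 (h1.1 ((hiff x).2 hxP)))

end Construction

end Shredding
theorem mainTheorem1 {L : FirstOrder.Language.{u, u}} (T : L.Theory) (hT : T.IsComplete)
    (hIP : Shredding.HasIP T) (hshred : Shredding.Unshreddable T)
    (μ : Cardinal.{u}) (hμ : μ.IsSingular) (hTμ : Shredding.theoryCard T < μ)
    (hcof : Shredding.kappaShred T ≤ (μ.ord.cof : WithTop Cardinal.{u}))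
    (hsq : Shredding.Square μ) (hexp : 2 ^ μ = Order.succ μ) :
    ∃ M : FirstOrder.Language.Theory.ModelType.{u, u, u} T,
      Shredding.ExactlySaturated L M μ :=
  Shredding.exists_exactlySaturated T hT hIP μ hμ hTμ hcof hsq hexp
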